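/- Let $N\ge 4$ and let $$\Lambda(x,y,v)=\frac{x^{N-1}}{N-1}+xy^2+\sum_{i=1}^N v_i\phi_i,\qquad \phi_k=x^{k-1}\ (1\le k\le N-1),\quad \phi_N=y,$$ be the universal unfolding of the singularity $D_N$. Let $c_{ij}^k\in\mathbb C[v_1,\dots,v_N]$ be the structure constants of the ring $\mathbb C[x,y,v_1,\dots,v_N]/(\partial_x\Lambda,\partial_y\Lambda)$ in the basis $[\phi_1],\dots,[\phi_N]$ over $\mathbb C[v_1,\dots,v_N]$, i.e. $[\phi_i][\phi_j]=\sum_k c_{ij}^k[\phi_k]$. They define a multiplication $\frac{\partial}{\partial v_i}\circ\frac{\partial}{\partial v_j}=\sum_k c^k_{ij}\frac{\partial}{\partial v_k}$ and a metric $\eta\left(\frac{\partial}{\partial v_i},\frac{\partial}{\partial v_j}\right)=c_{ij}^{N-1}$ on $\mathbb C^N$ (the Saito Frobenius manifold of $D_N$). Put $q_k=\frac{N-k}{N-1}$ for $1\le k\le N-1$, $q_N=\frac{N}{2(N-1)}$, and $\delta=1-q_{N-1}=\frac{N-2}{N-1}$. There exist polynomial coordinates $t^i(v_1,\dots,v_N)=v_i+O(v^2)$,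 $1\le i\le N$, on $\mathbb C^N$, with polynomial inverse $v_i(t^1,\dots,t^N)$, in which the metric has a constant non-degenerate matrix $(\eta_{\alpha\beta})$ (flat coordinates), and a polynomial $F_{D_N}\in\mathbb C[t^1,\dots,t^N]$ without monomials of degree less than $3$ such that $\frac{\partial^3F_{D_N}}{\partial t^\alpha\partial t^\beta\partial t^\gamma}=\eta\left(\frac{\partial}{\partial t^\alpha}\circ\frac{\partial}{\partial t^\beta},\frac{\partial}{\partial t^\gamma}\right)$. For any such $t^i$, $v_i$, $F=F_{D_N}$ let $$F^o=F^o_{D_N}:=\sum_{k=1}^{N-1}\frac{v_k\,s^{2k-1}}{2^{k-1}(2k-1)}+\frac{s^{2N-1}}{2^{N-2}(2N-1)(2N-2)}+\frac{v_N^2}{2s}\ \in\ \mathbb C[t^1,\dots,t^N][s,s^{-1}],\qquad v_i=v_i(t^1,\dots,t^N).$$ Then the following holds. 1. With $(\eta^{\alpha\beta})=(\eta_{\alpha\beta})^{-1}$ and summation over $\mu,\nu$ from $1$ to $N$, the function $F^o$ satisfies the open WDVV equations $$\frac{\partial^3F}{\partial t^\alpha\partial t^\beta\partial t^\mu}\eta^{\mu\nu}\frac{\partial^2F^o}{\partial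 t^\nu\partial t^\gamma}+\frac{\partial^2F^o}{\partial t^\alpha\partial t^\beta}\frac{\partial^2F^o}{\partial s\,\partial t^\gamma}=\frac{\partial^3F}{\partial t^\gamma\partial t^\beta\partial t^\mu}\eta^{\mu\nu}\frac{\partial^2F^o}{\partial t^\nu\partial t^\alpha}+\frac{\partial^2F^o}{\partial t^\gamma\partial t^\beta}\frac{\partial^2F^o}{\partial s\,\partial t^\alpha},$$ $$\frac{\partial^3F}{\partial t^\alpha\partial t^\beta\partial t^\mu}\eta^{\mu\nu}\frac{\partial^2F^o}{\partial t^\nu\partial s}+\frac{\partial^2F^o}{\partial t^\alpha\partial t^\beta}\frac{\partial^2F^o}{\partial s^2}=\frac{\partial^2F^o}{\partial s\,\partial t^\beta}\frac{\partial^2F^o}{\partial s\,\partial t^\alpha}$$ for all $1\le\alpha,\beta,\gamma\le N$, the unit condition $\frac{\partial^2F^o}{\partial t^1\partial t^\alpha}=0$ for $1\le\alpha\le N$ and $\frac{\partial^2F^o}{\partial t^1\partial s}=1$, and the quasi-homogeneity $$\sum_{\alpha=1}^N q_\alpha t^\alpha\frac{\partial F^o}{\partial t^\alpha}+\frac{1-\delta}{2}\,s\,\frac{\partial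 F^o}{\partial s}=\frac{3-\delta}{2}F^o.$$ 2. For $1\le k\le N-1$ we have $v_k(t^1,\dots,t^N)=2^{k-1}(2k-1)\,\mathrm{Coef}_{s^{2k-1}}F^o$, and $v_N(t^1,\dots,t^N)=\sqrt{2\,\mathrm{Coef}_{s^{-1}}F^o}$, where the square root is the unique polynomial in $t^1,\dots,t^N$ whose square is $2\,\mathrm{Coef}_{s^{-1}}F^o$ and in which the monomial $t^N$ has coefficient $1$. -/

import Mathlib

namespace SaitoDN

open MvPolynomial

noncomputable section

/-- Polynomials in `N` complex variables. It is used both for polynomials in the unfolding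
parameters `v_1, …, v_N` and for polynomials in the flat coordinates `t^1, …, t^N`.
The variable with index `i : Fin N` is the one that is numbered `i + 1` in `1, …, N`. -/
abbrev Poly (N : ℕ) : Type := MvPolynomial (Fin N) ℂ

/-- The ring `ℂ[v_1, …, v_N][x, y]`. -/
abbrev PolyXY (N : ℕ) : Type := MvPolynomial (Fin 2) (Poly N)

/-- The variable `x`. -/
def x (N : ℕ) : PolyXY N := X 0

/-- The variable `y`. -/
def y (N : ℕ) : PolyXY N := X 1

/-- The monomials `1, x, …, x^{N-2}, y`. -/
def phi (N : ℕ) (i : Fin N) : PolyXY N :=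
  if i.val + 1 < N then x N ^ i.val else y N

/-- The polynomial `x^{N-1}/(N-1) + x y^2` of the singularity `D_N`. -/
def singularity (N : ℕ) : PolyXY N :=
  C (C (1 / ((N : ℂ) - 1))) * x N ^ (N - 1) + x N * y N ^ 2

/-- The universal unfolding
`Λ = x^{N-1}/(N-1) + x y^2 + ∑_{k=1}^{N-1} v_k x^{k-1} + v_N y`. -/
def unfolding (N : ℕ) : PolyXY N :=
  singularity N + ∑ i : Fin N, C (X i) * phi N i

/-- The ideal `(∂Λ/∂x, ∂Λ/∂y)`. -/
def jacobianIdeal (N : ℕ) : Ideal (PolyXY N) :=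
  Ideal.span {pderiv 0 (unfolding N), pderiv 1 (unfolding N)}

/-- The ring `ℂ[x, y, v_1, …, v_N] / (∂Λ/∂x, ∂Λ/∂y)`. -/
abbrev JacobianRing (N : ℕ) : Type := PolyXY N ⧸ jacobianIdeal N

/-- The class `[φ_i]` in the quotient ring. -/
def phiClass (N : ℕ) (i : Fin N) : JacobianRing N :=
  Ideal.Quotient.mk (jacobianIdeal N) (phi N i)

/-- The weights `q_k = (N-k)/(N-1)` for `1 ≤ k ≤ N-1` and `q_N = N/(2(N-1))`. -/
def weight (N : ℕ) (i : Fin N) : ℂ :=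
  if i.val + 1 < N then ((N : ℂ) - (i.val + 1)) / ((N : ℂ) - 1)
  else (N : ℂ) / (2 * ((N : ℂ) - 1))

/-- The weights are those for which the unfolding is quasi-homogeneous of degree `1`:
`q_x x ∂Λ/∂x + q_y y ∂Λ/∂y + ∑ q_k v_k ∂Λ/∂v_k = Λ`, with `q_x = 1/(N-1)`,
`q_y = (N-2)/(2(N-1))` and `∂Λ/∂v_k = φ_k`. -/
theorem euler_unfolding {N : ℕ} (hN : 4 ≤ N) :
    C (C (1 / ((N : ℂ) - 1))) * (x N * pderiv 0 (unfolding N))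
      + C (C (((N : ℂ) - 2) / (2 * ((N : ℂ) - 1)))) * (y N * pderiv 1 (unfolding N))
      + ∑ i : Fin N, C (C (weight N i)) * (C (X i) * phi N i)
    = unfolding N := by
  have h1 : (N : ℂ) - 1 ≠ 0 := by
    have : (N : ℂ) ≠ 1 := by exact_mod_cast (by omega : N ≠ 1)
    exact sub_ne_zero.mpr this
  have key : ∀ i : Fin N,
      C (C (1 / ((N : ℂ) - 1))) * (x N * pderiv 0 (phi N i))
      + C (C (((N : ℂ) - 2) / (2 * ((N : ℂ) - 1)))) * (y N * pderiv 1 (phi N i))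
      + C (C (weight N i)) * phi N i = phi N i := by
    intro i
    unfold phi weight
    split_ifs with h
    · rcases hi : i.val with _ | m
      · simp [h1]
      · have e : x N * pderiv 0 (x N ^ (m + 1)) = C (C ((m : ℂ) + 1)) * x N ^ (m + 1) := by
          simp [x]
          ring
        have e2 : pderiv 1 (x N ^ (m + 1)) = 0 := by simp [x, pderiv_X]
        rw [e, e2, mul_zero, mul_zero, add_zero, ← mul_assoc, ← add_mul, ← C_mul, ← C_mul,
          ← C_add, ← C_add]
        have : 1 / ((N : ℂ) - 1) * (m + 1) + ((N : ℂ) - (((m + 1 : ℕ) : ℂ) + 1)) / ((N : ℂ) - 1)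
            = 1 := by push_cast; field_simp; ring
        rw [this]; simp
    · have e : pderiv 0 (y N) = 0 := by simp [y, pderiv_X]
      have e2 : pderiv 1 (y N) = 1 := by simp [y]
      rw [e, e2, mul_zero, mul_zero, zero_add, mul_one, ← add_mul, ← C_add, ← C_add]
      have : ((N : ℂ) - 2) / (2 * ((N : ℂ) - 1)) + (N : ℂ) / (2 * ((N : ℂ) - 1)) = 1 := by
        field_simp; ring
      rw [this]; simp
  have sing : C (C (1 / ((N : ℂ) - 1))) * (x N * pderiv 0 (singularity N))
      + C (C (((N : ℂ) - 2) / (2 * ((N : ℂ) - 1)))) * (y N * pderiv 1 (singularity N))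
      = singularity N := by
    obtain ⟨m, rfl⟩ : ∃ m, N = m + 2 := ⟨N - 2, by omega⟩
    have a0 : pderiv 0 (singularity (m + 2))
        = C (C (1 / (((m + 2 : ℕ) : ℂ) - 1))) * (C (C ((m : ℂ) + 1)) * x (m + 2) ^ m)
          + y (m + 2) ^ 2 := by
      simp [singularity, x, y, pderiv_X]
    have a1 : pderiv 1 (singularity (m + 2)) = 2 * (x (m + 2) * y (m + 2)) := by
      simp [singularity, x, y, pderiv_X]
      ring
    rw [a0, a1]
    have u : C (C (1 / (((m + 2 : ℕ) : ℂ) - 1))) * C (C ((m : ℂ) + 1)) = (1 : PolyXY (m + 2)) := by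
      rw [← C_mul, ← C_mul]
      have : 1 / (((m + 2 : ℕ) : ℂ) - 1) * ((m : ℂ) + 1) = 1 := by
        push_cast at h1 ⊢; field_simp; ring
      rw [this]; simp
    have w : C (C (1 / (((m + 2 : ℕ) : ℂ) - 1)))
        + C (C ((((m + 2 : ℕ) : ℂ) - 2) / (2 * (((m + 2 : ℕ) : ℂ) - 1)))) * 2
        = (1 : PolyXY (m + 2)) := by
      have h2 : (2 : PolyXY (m + 2)) = C (C 2) := by
        rw [map_ofNat (C : ℂ →+* Poly (m + 2)) 2, map_ofNat (C : Poly (m + 2) →+* PolyXY (m + 2)) 2]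
      rw [h2, ← C_mul, ← C_mul, ← C_add, ← C_add]
      have : 1 / (((m + 2 : ℕ) : ℂ) - 1)
          + (((m + 2 : ℕ) : ℂ) - 2) / (2 * (((m + 2 : ℕ) : ℂ) - 1)) * 2 = 1 := by
        push_cast at h1 ⊢; field_simp; ring
      rw [this]; simp
    have hs : singularity (m + 2) = C (C (1 / (((m + 2 : ℕ) : ℂ) - 1))) * x (m + 2) ^ (m + 1)
        + x (m + 2) * y (m + 2) ^ 2 := rfl
    rw [hs]
    linear_combination C (C (1 / (((m + 2 : ℕ) : ℂ) - 1))) * x (m + 2) ^ (m + 1) * u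
      + x (m + 2) * y (m + 2) ^ 2 * w
  have hs : ∀ j : Fin 2, pderiv j (unfolding N)
      = pderiv j (singularity N) + ∑ i : Fin N, C (X i) * pderiv j (phi N i) := by
    intro j; simp [unfolding, map_sum]
  rw [hs, hs]
  have : ∑ i : Fin N, C (X i) * phi N i = ∑ i : Fin N, C (X i) *
      (C (C (1 / ((N : ℂ) - 1))) * (x N * pderiv 0 (phi N i))
      + C (C (((N : ℂ) - 2) / (2 * ((N : ℂ) - 1)))) * (y N * pderiv 1 (phi N i))
      + C (C (weight N i)) * phi N i) :=
    Finset.sum_congr rfl fun i _ => by rw [key i]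
  conv_rhs => rw [unfolding, this, ← sing]
  simp only [mul_add, Finset.mul_sum, Finset.sum_add_distrib]
  have r1 : ∀ (a b : PolyXY N) (j : Fin 2) , ∑ i : Fin N, a * (b * (C (X i) * pderiv j (phi N i)))
     = ∑ i : Fin N, C (X i) * (a * (b * pderiv j (phi N i))) := by
    intro a b j; exact Finset.sum_congr rfl fun i _ => by ring
  have r2 : ∑ i : Fin N, C (C (weight N i)) * (C (X i) * phi N i)
     = ∑ i : Fin N, C (X i) * (C (C (weight N i)) * phi N i) :=
    Finset.sum_congr rfl fun i _ => by ring
  rw [r1, r1, r2]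
  ring

section Indices

variable {N : ℕ} (hN : 4 ≤ N)

/-- The index `1`. -/
def idxOne : Fin N := ⟨0, by omega⟩

/-- The index `N - 1`, at which the weight `q` is minimal. -/
def idxMin : Fin N := ⟨N - 2, by omega⟩

/-- The index `N`. -/
def idxLast : Fin N := ⟨N - 1, by omega⟩

/-- The conformal dimension `δ = 1 - q_{N-1}`. -/
def confDim : ℂ := 1 - weight N (idxMin hN)

end Indices

/-- Candidates for the objects that describe the Saito Frobenius manifold of `D_N` in flat
coordinates. The conditions that determine them are in `FlatData.IsSaito`. -/
structure FlatData (N : ℕ) where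
  /-- `c i j k` is the structure constant `c_{ij}^k(v)` in the coordinates `v`. -/
  c : Fin N → Fin N → Fin N → Poly N
  /-- The matrix `(η_{αβ})` of the metric in flat coordinates. -/
  eta : Matrix (Fin N) (Fin N) ℂ
  /-- The flat coordinates `t^α(v_1, …, v_N)`. -/
  t : Fin N → Poly N
  /-- The inverse change of coordinates `v_i(t^1, …, t^N)`. -/
  v : Fin N → Poly N
  /-- The Frobenius potential `F(t^1, …, t^N)`. -/
  F : Poly N

namespace FlatData

variable {N : ℕ}

/-- The component of the metric `η(∂/∂v_i, ∂/∂v_j) = c_{ij}^{N-1}`. -/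
def metricV (hN : 4 ≤ N) (D : FlatData N) (i j : Fin N) : Poly N :=
  D.c i j (idxMin hN)

/-- The component of the metric `η(∂/∂t^α, ∂/∂t^β)`, as a polynomial in `t^1, …, t^N`. -/
def metricT (hN : 4 ≤ N) (D : FlatData N) (α β : Fin N) : Poly N :=
  ∑ i, ∑ j, pderiv α (D.v i) * pderiv β (D.v j) * aeval D.v (D.metricV hN i j)

/-- The structure constant `c_{αβ}^γ` of the multiplication in the coordinates
`t^1, …, t^N`, as a polynomial in `t^1, …, t^N`. -/
def cT (D : FlatData N) (α β γ : Fin N) : Poly N :=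
  ∑ i, ∑ j, ∑ k, pderiv α (D.v i) * pderiv β (D.v j) * aeval D.v (D.c i j k)
    * aeval D.v (pderiv k (D.t γ))

/-- `D` describes the Saito Frobenius manifold of the singularity `D_N` in the flat
coordinates normalized by `t^i = v_i + O(v^2)`. -/
structure IsSaito (hN : 4 ≤ N) (D : FlatData N) : Prop where
  /-- The multiplication of the tangent vectors `∂/∂v_i` is that of the classes `[φ_i]`. -/
  mul_phi : ∀ i j, phiClass N i * phiClass N j = ∑ k, D.c i j k • phiClass N k
  /-- `t` and `v` are mutually inverse changes of coordinates. -/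
  t_comp_v : ∀ α, aeval D.v (D.t α) = X α
  v_comp_t : ∀ i, aeval D.t (D.v i) = X i
  /-- `t^i = v_i + O(v^2)`. -/
  t_const : ∀ α, constantCoeff (D.t α) = 0
  t_linear : ∀ α i, coeff (Finsupp.single i 1) (D.t α) = if α = i then 1 else 0
  /-- The metric is constant in the coordinates `t`, with matrix `(η_{αβ})`. -/
  flat : ∀ α β, D.metricT hN α β = C (D.eta α β)
  /-- The metric is non-degenerate. -/
  nondegenerate : D.eta.det ≠ 0
  /-- `∂³F/∂t^α∂t^β∂t^γ = η(∂/∂t^α ∘ ∂/∂t^β, ∂/∂t^γ)`. -/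
  potential : ∀ α β γ,
    pderiv α (pderiv β (pderiv γ D.F)) = ∑ μ, D.eta γ μ • D.cT α β μ
  /-- `F` has no monomials of degree less than `3`. -/
  normalized : ∀ m ∈ D.F.support, 3 ≤ m.degree

end FlatData

/-- Laurent polynomials in `s` whose coefficients are polynomials in `t^1, …, t^N`. -/
abbrev Laurent (N : ℕ) : Type := LaurentPolynomial (Poly N)

/-- The derivative `∂/∂t^α` of a Laurent polynomial in `s`. -/
def dt {N : ℕ} (α : Fin N) (f : Laurent N) : Laurent N :=
  f.coeff.sum fun n a => LaurentPolynomial.C (pderiv α a) * LaurentPolynomial.T n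

/-- The derivative `∂/∂s` of a Laurent polynomial in `s`. -/
def ds {N : ℕ} (f : Laurent N) : Laurent N :=
  f.coeff.sum fun n a => LaurentPolynomial.C ((n : ℂ) • a) * LaurentPolynomial.T (n - 1)

namespace FlatData

variable {N : ℕ}

/-- The function
`F^o = ∑_{k=1}^{N-1} v_k s^{2k-1} / (2^{k-1} (2k-1)) + s^{2N-1} / (2^{N-2} (2N-1) (2N-2))
  + v_N^2 / (2 s)`, where `v_i = v_i(t^1, …, t^N)`. -/
def Fo (hN : 4 ≤ N) (D : FlatData N) : Laurent N :=
  (∑ k : Fin N, if k.val + 1 < N then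
      LaurentPolynomial.C ((1 / (2 ^ k.val * (2 * (k.val : ℂ) + 1))) • D.v k)
        * LaurentPolynomial.T (2 * (k.val : ℤ) + 1)
    else 0)
  + LaurentPolynomial.C (C (1 / (2 ^ (N - 2) * (2 * (N : ℂ) - 1) * (2 * (N : ℂ) - 2))))
      * LaurentPolynomial.T (2 * (N : ℤ) - 1)
  + LaurentPolynomial.C ((1 / 2 : ℂ) • D.v (idxLast hN) ^ 2) * LaurentPolynomial.T (-1)

end FlatData

/-- The third derivative of `F`, viewed as a Laurent polynomial in `s` of degree `0`. -/
def thirdDeriv {N : ℕ} (F : Poly N) (α β γ : Fin N) : Laurent N :=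
  LaurentPolynomial.C (pderiv α (pderiv β (pderiv γ F)))

/-- The open WDVV equations for `Fo(t^1, …, t^N, s)`, associated to the potential
`F(t^1, …, t^N)` and the metric `η`; here `η⁻¹ μ ν` is `η^{μν}`. -/
structure OpenWDVV {N : ℕ} (eta : Matrix (Fin N) (Fin N) ℂ) (F : Poly N) (Fo : Laurent N) :
    Prop where
  eq_one : ∀ α β γ,
    (∑ μ, ∑ ν, eta⁻¹ μ ν • (thirdDeriv F α β μ * dt ν (dt γ Fo)))
        + dt α (dt β Fo) * ds (dt γ Fo)
      = (∑ μ, ∑ ν, eta⁻¹ μ ν • (thirdDeriv F γ β μ * dt ν (dt α Fo)))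
        + dt γ (dt β Fo) * ds (dt α Fo)
  eq_two : ∀ α β,
    (∑ μ, ∑ ν, eta⁻¹ μ ν • (thirdDeriv F α β μ * dt ν (ds Fo)))
        + dt α (dt β Fo) * ds (ds Fo)
      = ds (dt β Fo) * ds (dt α Fo)

/-- The unit condition `∂²Fo/∂t^1∂t^α = 0`, `∂²Fo/∂t^1∂s = 1`. -/
structure UnitCondition {N : ℕ} (hN : 4 ≤ N) (Fo : Laurent N) : Prop where
  dt_dt : ∀ α, dt (idxOne hN) (dt α Fo) = 0
  dt_ds : dt (idxOne hN) (ds Fo) = 1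

/-- The quasi-homogeneity
`∑ q_α t^α ∂Fo/∂t^α + (1-δ)/2 s ∂Fo/∂s = (3-δ)/2 Fo`. -/
def QuasiHomogeneous {N : ℕ} (hN : 4 ≤ N) (Fo : Laurent N) : Prop :=
  (∑ α, weight N α • (LaurentPolynomial.C (X α) * dt α Fo))
      + ((1 - confDim hN) / 2) • (LaurentPolynomial.T 1 * ds Fo)
    = ((3 - confDim hN) / 2) • Fo

end

end SaitoDN

/-! Write M = N - 1. On the curve x = s²/2, y = -v_N/s² the derivative ∂_yΛ vanishes, Λ restricts to
λ = ∂_s F^o (`curve_unfolding`), and ∂_s λ = s ∂_xΛ (`ds_ds_openPot_eq_curve`). Relations in the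
Jacobian ring therefore become congruences between Laurent polynomials modulo ∂_s λ, namely ∂_αλ
∂_βλ = ∑ c_{αβ}^μ ∂_μλ + q ∂_s λ. The heart of the matter is that q = ∂_α∂_β F^o in flat
coordinates, which is the second open WDVV equation.

To prove this, put the flat coordinates into an explicit expression s(σ), affine in t
(`uniformizer`), and let v_1, …, v_{N-1} be the functions of t for which the polynomial part of λ
becomes σ^{2M}/(2^M M) up to negative powers of σ; put v_N = t^N. Degree estimates and a residue in
σ show that ∂_αλ ∂_βλ - ∂_α∂_βF^o ∂_s λ has exponents in [-2, 2M-2] only, with constant top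
coefficient (`defect_spec`). All combinations of the restricted φ_i live in the same window, whereas
∂_s λ has extreme exponents -3 and 2M-1, so division by ∂_s λ with remainder in the window is unique
(`eq_zero_of_mul_ds_ds_mem`). This identifies q (`defect_eq_sum`), and the top coefficient shows
that the metric is constant (`mixedConst_eq_flatMetric`).

The other structure is formal. Expanding ∂_αλ ∂_βλ ∂_γλ in two ways gives associativity and the
first open WDVV equation (`IsOpenMul.assoc_and_open`); differentiating the product formula gives the
symmetry of ∂_γ c_{αβ}^μ (`IsOpenMul.closed`), so a polynomial potential exists
(`exists_flat_potential`). Quasi-homogeneity comes from s(σ) being homogeneous of the weight of s.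

Finally, the result must hold for every choice of data. Two normalized flat coordinate systems
differ by an isometry of constant metrics tangent to the identity, hence coincide
(`eq_X_of_isometry`, `FlatData.IsSaito.v_eq_flatParam`), so computing with one system suffices. -/

namespace SaitoDN

open MvPolynomial

noncomputable section

/-! ### Derivations, degree bounds and parity of Laurent polynomials in s. -/

section LaurentDerivations

variable {N : ℕ}

lemma coeff_C_mul_T (a : Poly N) (m n : ℤ) :
    (LaurentPolynomial.C a * LaurentPolynomial.T m : Laurent N).coeff n =
      if n = m then a else 0 := by
  rw [← LaurentPolynomial.single_eq_C_mul_T, AddMonoidAlgebra.coeff_single,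
    Finsupp.single_apply]
  simp [eq_comm]

lemma coeff_dt (α : Fin N) (f : Laurent N) (n : ℤ) :
    (dt α f).coeff n = pderiv α (f.coeff n) := by
  classical
  rw [dt, Finsupp.sum, AddMonoidAlgebra.coeff_sum, Finsupp.finsetSum_apply]
  simp only [coeff_C_mul_T, Finset.sum_ite_eq]
  split_ifs with h
  · rfl
  · rw [Finsupp.notMem_support_iff.1 h, map_zero]

lemma coeff_ds (f : Laurent N) (n : ℤ) :
    (ds f).coeff n = ((n : ℂ) + 1) • f.coeff (n + 1) := by
  classical
  rw [ds, Finsupp.sum, AddMonoidAlgebra.coeff_sum, Finsupp.finsetSum_apply]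
  simp only [coeff_C_mul_T]
  have : ∀ m : ℤ, (n = m - 1) = (m = n + 1) := fun m => by simp; omega
  simp only [this, Finset.sum_ite_eq', Int.cast_add, Int.cast_one]
  split_ifs with h
  · rfl
  · rw [Finsupp.notMem_support_iff.1 h, smul_zero]

lemma laurent_induction {p : Laurent N → Prop} (f : Laurent N)
    (add : ∀ f g, p f → p g → p (f + g))
    (single : ∀ a n, p (LaurentPolynomial.C a * LaurentPolynomial.T n)) : p f :=
  LaurentPolynomial.induction_on' f (fun f g => add f g) (fun n a => single a n)

lemma dt_add (α : Fin N) (f g : Laurent N) : dt α (f + g) = dt α f + dt α g := by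
  ext n : 1
  simp [coeff_dt]

lemma ds_add (f g : Laurent N) : ds (f + g) = ds f + ds g := by
  ext n : 1
  simp [coeff_ds]

@[simp] lemma dt_C_mul_T (α : Fin N) (a : Poly N) (n : ℤ) :
    dt α (LaurentPolynomial.C a * LaurentPolynomial.T n) =
      LaurentPolynomial.C (pderiv α a) * LaurentPolynomial.T n := by
  ext m : 1
  rw [coeff_dt, coeff_C_mul_T, coeff_C_mul_T]
  split_ifs <;> simp

@[simp] lemma ds_C_mul_T (a : Poly N) (n : ℤ) :
    ds (LaurentPolynomial.C a * LaurentPolynomial.T n) =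
      LaurentPolynomial.C ((n : ℂ) • a) * LaurentPolynomial.T (n - 1) := by
  ext m : 1
  rw [coeff_ds, coeff_C_mul_T, coeff_C_mul_T]
  by_cases h : m + 1 = n
  · subst h; simp
  · rw [if_neg h, if_neg (by omega), smul_zero]

lemma C_mul_T_mul (a b : Poly N) (m n : ℤ) :
    (LaurentPolynomial.C a * LaurentPolynomial.T m : Laurent N) *
      (LaurentPolynomial.C b * LaurentPolynomial.T n) =
      LaurentPolynomial.C (a * b) * LaurentPolynomial.T (m + n) := by
  rw [LaurentPolynomial.T_add, map_mul]; ring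

lemma dt_mul (α : Fin N) (f g : Laurent N) : dt α (f * g) = f * dt α g + g * dt α f := by
  induction f using laurent_induction with
  | add f₁ f₂ h₁ h₂ => rw [add_mul, dt_add, h₁, h₂, dt_add]; ring
  | single a m =>
    induction g using laurent_induction with
    | add g₁ g₂ h₁ h₂ => rw [mul_add, dt_add, h₁, h₂, dt_add]; ring
    | single b n =>
      simp only [C_mul_T_mul, dt_C_mul_T, Derivation.leibniz, smul_eq_mul, map_add, add_mul]
      rw [add_comm n m]

lemma C_smul (c : ℂ) (a : Poly N) :
    (LaurentPolynomial.C (c • a) : Laurent N) = c • LaurentPolynomial.C a := by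
  ext n : 1
  simp only [LaurentPolynomial.C_apply, AddMonoidAlgebra.coeff_smul_apply]
  split_ifs <;> simp

lemma ds_mul (f g : Laurent N) : ds (f * g) = f * ds g + g * ds f := by
  induction f using laurent_induction with
  | add f₁ f₂ h₁ h₂ => rw [add_mul, ds_add, h₁, h₂, ds_add]; ring
  | single a m =>
    induction g using laurent_induction with
    | add g₁ g₂ h₁ h₂ => rw [mul_add, ds_add, h₁, h₂, ds_add]; ring
    | single b n =>
      simp only [C_mul_T_mul, ds_C_mul_T]
      rw [show m + (n - 1) = m + n - 1 by ring, show n + (m - 1) = m + n - 1 by ring, ← add_mul,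
        ← map_add, mul_smul_comm, mul_smul_comm, mul_comm b a, ← add_smul]
      push_cast
      rw [add_comm (m : ℂ)]

lemma dt_smul (α : Fin N) (c : ℂ) (f : Laurent N) : dt α (c • f) = c • dt α f := by
  ext n : 1
  simp [coeff_dt]

lemma ds_smul (c : ℂ) (f : Laurent N) : ds (c • f) = c • ds f := by
  ext n : 1
  simp [coeff_ds, smul_comm c]

/-- `∂/∂t^α` as a derivation. -/
def dtDer (α : Fin N) : Derivation ℂ (Laurent N) (Laurent N) :=
  Derivation.mk' { toFun := dt α, map_add' := dt_add α, map_smul' := dt_smul α } (dt_mul α)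

/-- `∂/∂s` as a derivation. -/
def dsDer : Derivation ℂ (Laurent N) (Laurent N) :=
  Derivation.mk' { toFun := ds, map_add' := ds_add, map_smul' := ds_smul } ds_mul

lemma dtDer_apply (α : Fin N) (f : Laurent N) : dtDer α f = dt α f := rfl

lemma dsDer_apply (f : Laurent N) : dsDer f = ds f := rfl

lemma dt_sub (α : Fin N) (f g : Laurent N) : dt α (f - g) = dt α f - dt α g :=
  map_sub (dtDer α) f g

lemma ds_sub (f g : Laurent N) : ds (f - g) = ds f - ds g := map_sub dsDer f g

@[simp] lemma dt_zero (α : Fin N) : dt α 0 = 0 := map_zero (dtDer α)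

@[simp] lemma ds_zero : ds (0 : Laurent N) = 0 := map_zero dsDer

lemma dt_sum {ι : Type*} (α : Fin N) (s : Finset ι) (f : ι → Laurent N) :
    dt α (∑ i ∈ s, f i) = ∑ i ∈ s, dt α (f i) := map_sum (dtDer α) f s

lemma ds_sum {ι : Type*} (s : Finset ι) (f : ι → Laurent N) :
    ds (∑ i ∈ s, f i) = ∑ i ∈ s, ds (f i) := map_sum dsDer f s

@[simp] lemma dt_T (α : Fin N) (n : ℤ) : dt α (LaurentPolynomial.T n) = 0 := by
  have := dt_C_mul_T α 1 n
  simpa using this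

@[simp] lemma dt_C (α : Fin N) (a : Poly N) :
    dt α (LaurentPolynomial.C a) = LaurentPolynomial.C (pderiv α a) := by
  have := dt_C_mul_T α a 0
  simpa using this

@[simp] lemma ds_C (a : Poly N) : ds (LaurentPolynomial.C a) = 0 := by
  have := ds_C_mul_T a 0
  simpa using this

lemma ds_T (n : ℤ) :
    ds (LaurentPolynomial.T n : Laurent N) = (n : ℂ) • LaurentPolynomial.T (n - 1) := by
  have := ds_C_mul_T (1 : Poly N) n
  simpa [C_smul] using this

lemma pderiv_comm (i j : Fin N) (p : Poly N) :
    pderiv i (pderiv j p) = pderiv j (pderiv i p) := by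
  ext m
  simp only [coeff_pderiv, Finsupp.add_apply]
  by_cases h : i = j
  · subst h; rfl
  · rw [add_right_comm, Finsupp.single_eq_of_ne h, Finsupp.single_eq_of_ne (Ne.symm h)]
    push_cast
    ring

lemma dt_comm (α β : Fin N) (f : Laurent N) : dt α (dt β f) = dt β (dt α f) := by
  ext n : 1
  simp only [coeff_dt, pderiv_comm α β]

lemma dt_ds (α : Fin N) (f : Laurent N) : dt α (ds f) = ds (dt α f) := by
  ext n : 1
  simp [coeff_dt, coeff_ds]

/-- Laurent polynomials all of whose exponents are at most `d`. -/
def degLE (N : ℕ) (d : ℤ) : Submodule ℂ (Laurent N) where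
  carrier := {f | ∀ n, d < n → f.coeff n = 0}
  add_mem' := fun hf hg n hn => by simp [hf n hn, hg n hn]
  zero_mem' := fun n _ => by simp
  smul_mem' := fun c f hf n hn => by simp [hf n hn]

lemma degLE_mono {d e : ℤ} (h : d ≤ e) {f : Laurent N} (hf : f ∈ degLE N d) : f ∈ degLE N e :=
  fun n hn => hf n (h.trans_lt hn)

lemma C_mul_T_mem_degLE (a : Poly N) {m d : ℤ} (h : m ≤ d) :
    LaurentPolynomial.C a * LaurentPolynomial.T m ∈ degLE N d := fun n hn => by
  rw [coeff_C_mul_T, if_neg (by omega)]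

lemma C_mem_degLE (a : Poly N) : LaurentPolynomial.C a ∈ degLE N 0 := by
  simpa using C_mul_T_mem_degLE a (le_refl 0)

lemma T_mem_degLE {m d : ℤ} (h : m ≤ d) : LaurentPolynomial.T m ∈ degLE N d := by
  simpa using C_mul_T_mem_degLE 1 h

lemma mul_mem_degLE {d e : ℤ} {f g : Laurent N} (hf : f ∈ degLE N d) (hg : g ∈ degLE N e) :
    f * g ∈ degLE N (d + e) := fun n hn => by
  classical
  rw [AddMonoidAlgebra.coeff_mul]
  refine Finset.sum_eq_zero fun i _ => Finset.sum_eq_zero fun j _ => ?_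
  dsimp only
  split_ifs with h
  · by_cases hi : d < i
    · simp [hf i hi]
    · simp [hg j (by omega)]
  · rfl

lemma coeff_mul_top {d e : ℤ} {f g : Laurent N} (hf : f ∈ degLE N d) (hg : g ∈ degLE N e) :
    (f * g).coeff (d + e) = f.coeff d * g.coeff e := by
  classical
  rw [AddMonoidAlgebra.coeff_mul, Finsupp.sum, Finset.sum_eq_single d]
  · rw [Finsupp.sum, Finset.sum_eq_single e]
    · simp
    · intro j _ hj; rw [if_neg (by omega)]
    · intro h; simp [Finsupp.notMem_support_iff.1 h]
  · intro i _ hi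
    refine Finset.sum_eq_zero fun j _ => ?_
    dsimp only
    split_ifs with h
    · by_cases hi : d < i
      · simp [hf i hi]
      · simp [hg j (by omega)]
    · rfl
  · intro h; simp [Finsupp.notMem_support_iff.1 h]

lemma pow_mem_degLE {d : ℤ} {f : Laurent N} (hf : f ∈ degLE N d) (n : ℕ) :
    f ^ n ∈ degLE N (n * d) := by
  induction n with
  | zero => simpa using C_mem_degLE (N := N) 1
  | succ n ih =>
    rw [pow_succ]
    exact degLE_mono (by push_cast; linarith) (mul_mem_degLE ih hf)

lemma coeff_pow_top {d : ℤ} {f : Laurent N} (hf : f ∈ degLE N d) (n : ℕ) :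
    (f ^ n).coeff (n * d) = f.coeff d ^ n := by
  induction n with
  | zero => simp [← LaurentPolynomial.T_zero]
  | succ n ih =>
    rw [pow_succ, pow_succ, ← ih, ← coeff_mul_top (pow_mem_degLE hf n) hf]
    congr 1; push_cast; ring

lemma C_mul_mem_degLE (a : Poly N) {d : ℤ} {f : Laurent N} (hf : f ∈ degLE N d) :
    LaurentPolynomial.C a * f ∈ degLE N d := by
  simpa using mul_mem_degLE (C_mem_degLE a) hf

lemma coeff_C_mul (a : Poly N) (f : Laurent N) (n : ℤ) :
    (LaurentPolynomial.C a * f).coeff n = a * f.coeff n := by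
  rw [← LaurentPolynomial.smul_eq_C_mul]; rfl

lemma dt_mem_degLE (α : Fin N) {d : ℤ} {f : Laurent N} (hf : f ∈ degLE N d) :
    dt α f ∈ degLE N d := fun n hn => by rw [coeff_dt, hf n hn, map_zero]

lemma ds_mem_degLE {d : ℤ} {f : Laurent N} (hf : f ∈ degLE N d) :
    ds f ∈ degLE N (d - 1) := fun n hn => by rw [coeff_ds, hf (n + 1) (by omega), smul_zero]

lemma degLE_of_coeff_eq_zero {d : ℤ} {f : Laurent N} (hf : f ∈ degLE N d) (h : f.coeff d = 0) :
    f ∈ degLE N (d - 1) := fun n hn => by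
  rcases eq_or_ne n d with rfl | hne
  · exact h
  · exact hf n (by omega)

lemma exists_top {f : Laurent N} (hf : f ≠ 0) : ∃ d, f ∈ degLE N d ∧ f.coeff d ≠ 0 := by
  have hs : f.coeff.support.Nonempty := by
    rw [Finsupp.support_nonempty_iff]; simpa using hf
  refine ⟨f.coeff.support.max' hs, fun n hn => ?_, Finsupp.mem_support_iff.1 (Finset.max'_mem _ hs)⟩
  by_contra h
  exact absurd (Finset.le_max' _ n (Finsupp.mem_support_iff.2 h)) (not_le.2 hn)

/-- Laurent polynomials all of whose exponents have the parity of `e`. -/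
def parity (N : ℕ) (e : ℤ) : Submodule ℂ (Laurent N) where
  carrier := {f | ∀ n, ¬ Even (n - e) → f.coeff n = 0}
  add_mem' := fun hf hg n hn => by simp [hf n hn, hg n hn]
  zero_mem' := fun n _ => by simp
  smul_mem' := fun c f hf n hn => by simp [hf n hn]

lemma C_mul_T_mem_parity (a : Poly N) {m e : ℤ} (h : Even (m - e)) :
    LaurentPolynomial.C a * LaurentPolynomial.T m ∈ parity N e := fun n hn => by
  rw [coeff_C_mul_T, if_neg (by rintro rfl; exact hn h)]

lemma mul_mem_parity {d e : ℤ} {f g : Laurent N} (hf : f ∈ parity N d) (hg : g ∈ parity N e) :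
    f * g ∈ parity N (d + e) := fun n hn => by
  classical
  rw [AddMonoidAlgebra.coeff_mul]
  refine Finset.sum_eq_zero fun i _ => Finset.sum_eq_zero fun j _ => ?_
  dsimp only
  split_ifs with h
  · by_cases hi : Even (i - d)
    · rw [hg j fun hj => hn ?_, mul_zero]
      rw [show n - (d + e) = (i - d) + (j - e) by omega]
      exact hi.add hj
    · rw [hf i hi, zero_mul]
  · rfl

lemma pow_mem_parity {d : ℤ} {f : Laurent N} (hf : f ∈ parity N d) (n : ℕ) :
    f ^ n ∈ parity N (n * d) := by
  induction n with
  | zero => simpa using C_mul_T_mem_parity (N := N) 1 (m := 0) (e := 0) (by simp)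
  | succ n ih =>
    rw [pow_succ]
    convert mul_mem_parity ih hf using 1
    push_cast; ring_nf

lemma C_mul_mem_parity (a : Poly N) {d : ℤ} {f : Laurent N} (hf : f ∈ parity N d) :
    LaurentPolynomial.C a * f ∈ parity N d := fun n hn => by
  rw [coeff_C_mul, hf n hn, mul_zero]

lemma dt_mem_parity (α : Fin N) {d : ℤ} {f : Laurent N} (hf : f ∈ parity N d) :
    dt α f ∈ parity N d := fun n hn => by rw [coeff_dt, hf n hn, map_zero]

/-- Laurent polynomials all of whose exponents are at least `d`. -/
def degGE (N : ℕ) (d : ℤ) : Submodule ℂ (Laurent N) where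
  carrier := {f | ∀ n, n < d → f.coeff n = 0}
  add_mem' := fun hf hg n hn => by simp [hf n hn, hg n hn]
  zero_mem' := fun n _ => by simp
  smul_mem' := fun c f hf n hn => by simp [hf n hn]

lemma mem_degGE_iff_invert {d : ℤ} {f : Laurent N} :
    f ∈ degGE N d ↔ LaurentPolynomial.invert f ∈ degLE N (-d) := by
  constructor
  · intro h n hn
    rw [LaurentPolynomial.invert_apply]
    exact h _ (by omega)
  · intro h n hn
    simpa using h (-n) (by omega)

lemma degGE_mono {d e : ℤ} (h : e ≤ d) {f : Laurent N} (hf : f ∈ degGE N d) : f ∈ degGE N e :=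
  fun n hn => hf n (by omega)

lemma C_mul_T_mem_degGE (a : Poly N) {m d : ℤ} (h : d ≤ m) :
    LaurentPolynomial.C a * LaurentPolynomial.T m ∈ degGE N d := fun n hn => by
  rw [coeff_C_mul_T, if_neg (by omega)]

lemma mul_mem_degGE {d e : ℤ} {f g : Laurent N} (hf : f ∈ degGE N d) (hg : g ∈ degGE N e) :
    f * g ∈ degGE N (d + e) := by
  rw [mem_degGE_iff_invert] at *
  rw [map_mul]
  exact degLE_mono (by omega) (mul_mem_degLE hf hg)

lemma coeff_mul_bot {d e : ℤ} {f g : Laurent N} (hf : f ∈ degGE N d) (hg : g ∈ degGE N e) :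
    (f * g).coeff (d + e) = f.coeff d * g.coeff e := by
  rw [mem_degGE_iff_invert] at *
  have := coeff_mul_top hf hg
  rw [← map_mul, ← neg_add] at this
  simpa only [LaurentPolynomial.invert_apply, neg_neg] using this

lemma exists_bot {f : Laurent N} (hf : f ≠ 0) : ∃ d, f ∈ degGE N d ∧ f.coeff d ≠ 0 := by
  have h : LaurentPolynomial.invert f ≠ 0 := by simpa using hf
  obtain ⟨d, h1, h2⟩ := exists_top h
  refine ⟨-d, mem_degGE_iff_invert.2 (by simpa using h1), ?_⟩
  simpa only [LaurentPolynomial.invert_apply] using h2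

/-- A Laurent polynomial whose extreme exponents are `a` and `b` has no nonzero multiple that is
supported strictly above `a` and strictly below `b`. -/
lemma eq_zero_of_mul_mem {a b : ℤ} {p q : Laurent N} (hpa : p ∈ degGE N a) (hpb : p ∈ degLE N b)
    (ha : p.coeff a ≠ 0) (hb : p.coeff b ≠ 0) (hqa : q * p ∈ degGE N (a + 1))
    (hqb : q * p ∈ degLE N (b - 1)) : q = 0 := by
  by_contra hq
  obtain ⟨d, hd, hd0⟩ := exists_top hq
  obtain ⟨e, he, he0⟩ := exists_bot hq
  -- Coefficients lie in a domain, so the extreme terms of `q * p`, at exponents d + b and e + a,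
  -- survive. The bounds force d ≤ -1 and e ≥ 1, although e ≤ d.
  have h1 : ¬ (b - 1 < d + b) := fun h => by
    have := hqb _ h
    rw [coeff_mul_top hd hpb] at this
    exact mul_ne_zero hd0 hb this
  have h2 : ¬ (e + a < a + 1) := fun h => by
    have := hqa _ h
    rw [coeff_mul_bot he hpa] at this
    exact mul_ne_zero he0 ha this
  exact he0 (hd e (by omega))

end LaurentDerivations

/-! ### Substituting a Laurent polynomial for the variable of a polynomial. -/

section Substitution

variable {N : ℕ}

lemma coeff_sum_monomial_pderiv (α : Fin N) (p : Polynomial (Poly N)) (n : ℕ) :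
    (∑ n ∈ Finset.range (p.natDegree + 1),
      Polynomial.monomial n (pderiv α (p.coeff n))).coeff n = pderiv α (p.coeff n) := by
  rw [Polynomial.finsetSum_coeff]
  simp only [Polynomial.coeff_monomial, Finset.sum_ite_eq', Finset.mem_range]
  split_ifs with h
  · rfl
  · rw [Polynomial.coeff_eq_zero_of_natDegree_lt (by omega), map_zero]

/-- The coefficientwise derivative `∂/∂t^α` of a polynomial in `s`. -/
def polyDt (α : Fin N) : Polynomial (Poly N) →+ Polynomial (Poly N) where
  toFun p := ∑ n ∈ Finset.range (p.natDegree + 1), Polynomial.monomial n (pderiv α (p.coeff n))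
  map_add' p q := by
    ext1 n
    rw [Polynomial.coeff_add, coeff_sum_monomial_pderiv, coeff_sum_monomial_pderiv,
      coeff_sum_monomial_pderiv, Polynomial.coeff_add, map_add]
  map_zero' := by simp

lemma coeff_polyDt (α : Fin N) (p : Polynomial (Poly N)) (n : ℕ) :
    (polyDt α p).coeff n = pderiv α (p.coeff n) := coeff_sum_monomial_pderiv α p n

lemma polyDt_C_mul_X_pow (α : Fin N) (a : Poly N) (n : ℕ) :
    polyDt α (Polynomial.C a * Polynomial.X ^ n) =
      Polynomial.C (pderiv α a) * Polynomial.X ^ n := by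
  ext1 m
  rw [coeff_polyDt, Polynomial.coeff_C_mul_X_pow, Polynomial.coeff_C_mul_X_pow]
  split_ifs <;> simp

/-- Substitution of a Laurent polynomial into a polynomial. -/
def subst (S : Laurent N) : Polynomial (Poly N) →+* Laurent N :=
  Polynomial.eval₂RingHom LaurentPolynomial.C S

@[simp] lemma subst_C (S : Laurent N) (a : Poly N) :
    subst S (Polynomial.C a) = LaurentPolynomial.C a := by simp [subst]

@[simp] lemma subst_X (S : Laurent N) : subst S Polynomial.X = S := by simp [subst]

lemma subst_C_mul_X_pow (S : Laurent N) (a : Poly N) (n : ℕ) :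
    subst S (Polynomial.C a * Polynomial.X ^ n) = LaurentPolynomial.C a * S ^ n := by simp

lemma poly_induction {P : Polynomial (Poly N) → Prop} (p : Polynomial (Poly N))
    (add : ∀ p q, P p → P q → P (p + q))
    (mono : ∀ a n, P (Polynomial.C a * Polynomial.X ^ n)) : P p :=
  Polynomial.induction_on' p add fun n a => by
    rw [← Polynomial.C_mul_X_pow_eq_monomial]; exact mono a n

lemma dt_pow (α : Fin N) (f : Laurent N) (n : ℕ) :
    dt α (f ^ n) = n * f ^ (n - 1) * dt α f := by
  rw [← dtDer_apply, Derivation.leibniz_pow, dtDer_apply, nsmul_eq_mul, smul_eq_mul, mul_assoc]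

lemma ds_pow (f : Laurent N) (n : ℕ) : ds (f ^ n) = n * f ^ (n - 1) * ds f := by
  rw [← dsDer_apply, Derivation.leibniz_pow, dsDer_apply, nsmul_eq_mul, smul_eq_mul, mul_assoc]

/-- Chain rule: `p` depends on t through its coefficients, and the substituted `S` depends on t as
well. -/
lemma dt_subst (α : Fin N) (S : Laurent N) (p : Polynomial (Poly N)) :
    dt α (subst S p) = subst S (polyDt α p) + subst S p.derivative * dt α S := by
  induction p using poly_induction with
  | add p q hp hq => simp only [map_add, dt_add, hp, hq]; ring
  | mono a n =>
    rw [polyDt_C_mul_X_pow, Polynomial.derivative_C_mul_X_pow, subst_C_mul_X_pow,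
      subst_C_mul_X_pow, dt_mul, dt_pow, dt_C, subst_C_mul_X_pow]
    simp only [map_mul, map_natCast]
    ring

lemma ds_subst (S : Laurent N) (p : Polynomial (Poly N)) :
    ds (subst S p) = subst S p.derivative * ds S := by
  induction p using poly_induction with
  | add p q hp hq => simp only [map_add, ds_add, hp, hq]; ring
  | mono a n =>
    rw [Polynomial.derivative_C_mul_X_pow, subst_C_mul_X_pow, ds_mul, ds_pow, ds_C,
      subst_C_mul_X_pow]
    simp only [map_mul, map_natCast]
    ring

lemma subst_mem_degLE {S : Laurent N} (hS : S ∈ degLE N 1) {p : Polynomial (Poly N)} {d : ℤ}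
    (hp : ∀ n : ℕ, d < n → p.coeff n = 0) : subst S p ∈ degLE N d := by
  rw [p.as_sum_range_C_mul_X_pow, map_sum]
  refine Submodule.sum_mem _ fun n _ => ?_
  rw [subst_C_mul_X_pow]
  by_cases h : d < n
  · simp [hp n h]
  · exact C_mul_mem_degLE _ (degLE_mono (by omega) (pow_mem_degLE hS n))

lemma coeff_subst_top {S : Laurent N} (hS : S ∈ degLE N 1) (hS1 : S.coeff 1 = 1)
    {p : Polynomial (Poly N)} {d : ℕ} (hp : ∀ n : ℕ, d < n → p.coeff n = 0) :
    (subst S p).coeff d = p.coeff d := by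
  -- After removal of the term of degree `d`, the rest cannot reach the exponent `d`.
  have h1 : subst S (p - Polynomial.C (p.coeff d) * Polynomial.X ^ d) ∈ degLE N ((d : ℤ) - 1) := by
    refine subst_mem_degLE hS fun n hn => ?_
    rw [Polynomial.coeff_sub, Polynomial.coeff_C_mul_X_pow]
    split_ifs with h
    · rw [h, sub_self]
    · rw [hp n (by omega), sub_zero]
  have h2 := h1 d (by omega)
  have h3 := coeff_pow_top hS d
  rw [map_sub, subst_C_mul_X_pow, AddMonoidAlgebra.coeff_sub, Finsupp.sub_apply, coeff_C_mul,
    sub_eq_zero] at h2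
  rw [mul_one, hS1, one_pow] at h3
  rw [h2, h3, mul_one]

/-- Substituting a monic element of degree one preserves the degree and the leading coefficient.
Coefficients are thus killed one by one from the top. This turns estimates in σ into statements
about polynomials in s. -/
lemma coeff_eq_zero_of_subst_mem {S : Laurent N} (hS : S ∈ degLE N 1) (hS1 : S.coeff 1 = 1)
    {p : Polynomial (Poly N)} {d : ℤ} (hp : subst S p ∈ degLE N d) (n : ℕ) (hn : d < n) :
    p.coeff n = 0 := by
  have key : ∀ k n : ℕ, p.natDegree < n + k → d < n → p.coeff n = 0 := by
    intro k
    induction k with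
    | zero => intro n h _; exact Polynomial.coeff_eq_zero_of_natDegree_lt (by omega)
    | succ k ih =>
      intro n h hn
      rw [← coeff_subst_top hS hS1 (fun m hm => ih m (by omega) (by omega))]
      exact hp n hn
  exact key (p.natDegree + 1) n (by omega) hn

lemma subst_T_one (p : Polynomial (Poly N)) :
    subst (LaurentPolynomial.T 1) p = Polynomial.toLaurent p := by
  induction p using poly_induction with
  | add p q hp hq => simp only [map_add, hp, hq]
  | mono a n => rw [subst_C_mul_X_pow]; simp

lemma dt_toLaurent (α : Fin N) (p : Polynomial (Poly N)) :
    dt α (Polynomial.toLaurent p) = Polynomial.toLaurent (polyDt α p) := by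
  simp only [← subst_T_one, dt_subst, dt_T, mul_zero, add_zero]

lemma ds_toLaurent (p : Polynomial (Poly N)) :
    ds (Polynomial.toLaurent p) = Polynomial.toLaurent p.derivative := by
  simp [← subst_T_one, ds_subst, ds_T]

lemma toLaurent_mem_degLE {p : Polynomial (Poly N)} {d : ℤ}
    (hp : ∀ n : ℕ, d < n → p.coeff n = 0) : Polynomial.toLaurent p ∈ degLE N d := by
  rw [← subst_T_one]
  exact subst_mem_degLE (T_mem_degLE le_rfl) hp

lemma coeff_toLaurent_natCast (p : Polynomial (Poly N)) (n : ℕ) :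
    (Polynomial.toLaurent p).coeff (n : ℤ) = p.coeff n := by
  induction p using poly_induction with
  | add p q hp hq =>
    rw [map_add, AddMonoidAlgebra.coeff_add, Finsupp.add_apply, hp, hq, Polynomial.coeff_add]
  | mono a m =>
    rw [Polynomial.toLaurent_C_mul_X_pow, coeff_C_mul_T, Polynomial.coeff_C_mul_X_pow]
    simp

lemma toLaurent_mem_degGE {p : Polynomial (Poly N)} {d : ℕ}
    (hp : ∀ n : ℕ, n < d → p.coeff n = 0) : Polynomial.toLaurent p ∈ degGE N d := by
  rw [p.as_sum_range_C_mul_X_pow, map_sum]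
  refine Submodule.sum_mem _ fun n _ => ?_
  rw [Polynomial.toLaurent_C_mul_X_pow]
  by_cases h : n < d
  · simp [hp n h]
  · exact C_mul_T_mem_degGE _ (by omega)

/-! ### The polynomial parts of λ and of its primitive F^o. -/

section Superpotential

variable {M : ℕ}

/-- The even polynomial `∑ u_k s^{2k} / 2^k`. -/
def evenPoly (u : Fin M → Poly N) : Polynomial (Poly N) :=
  ∑ k : Fin M, Polynomial.C ((1 / 2 ^ k.val : ℂ) • u k) * Polynomial.X ^ (2 * k.val)

/-- The odd polynomial `∑ u_k s^{2k+1} / (2^k (2k+1))`, a primitive of `evenPoly u`. -/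
def oddPoly (u : Fin M → Poly N) : Polynomial (Poly N) :=
  ∑ k : Fin M, Polynomial.C ((1 / (2 ^ k.val * (2 * k.val + 1)) : ℂ) • u k) *
    Polynomial.X ^ (2 * k.val + 1)

lemma derivative_oddPoly (u : Fin M → Poly N) : (oddPoly u).derivative = evenPoly u := by
  rw [oddPoly, evenPoly, Polynomial.derivative_sum]
  refine Finset.sum_congr rfl fun k _ => ?_
  rw [Polynomial.derivative_C_mul_X_pow]
  congr 2
  have h : (2 * (k.val : ℂ) + 1) ≠ 0 := by exact_mod_cast (by omega : 2 * k.val + 1 ≠ 0)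
  rw [← map_natCast (MvPolynomial.C : ℂ →+* Poly N), mul_comm, ← smul_eq_C_mul, smul_smul]
  congr 1
  push_cast
  field_simp

lemma polyDt_evenPoly (α : Fin N) (u : Fin M → Poly N) :
    polyDt α (evenPoly u) = evenPoly fun k => pderiv α (u k) := by
  simp only [evenPoly, map_sum, polyDt_C_mul_X_pow, Derivation.map_smul]

lemma polyDt_oddPoly (α : Fin N) (u : Fin M → Poly N) :
    polyDt α (oddPoly u) = oddPoly fun k => pderiv α (u k) := by
  simp only [oddPoly, map_sum, polyDt_C_mul_X_pow, Derivation.map_smul]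

lemma coeff_evenPoly (u : Fin M → Poly N) (k : Fin M) :
    (evenPoly u).coeff (2 * k.val) = (1 / 2 ^ k.val : ℂ) • u k := by
  simp only [evenPoly, Polynomial.finsetSum_coeff, Polynomial.coeff_C_mul_X_pow]
  rw [Finset.sum_eq_single k]
  · simp
  · intro j _ hj; rw [if_neg (by have := Fin.val_ne_of_ne hj; omega)]
  · simp

lemma coeff_evenPoly_of_le (u : Fin M → Poly N) (n : ℕ) (h : 2 * M - 2 < n) :
    (evenPoly u).coeff n = 0 := by
  simp only [evenPoly, Polynomial.finsetSum_coeff, Polynomial.coeff_C_mul_X_pow]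
  exact Finset.sum_eq_zero fun k _ => if_neg (by omega)

lemma coeff_oddPoly (u : Fin M → Poly N) (k : Fin M) :
    (oddPoly u).coeff (2 * k.val + 1) = (1 / (2 ^ k.val * (2 * k.val + 1)) : ℂ) • u k := by
  simp only [oddPoly, Polynomial.finsetSum_coeff, Polynomial.coeff_C_mul_X_pow]
  rw [Finset.sum_eq_single k]
  · simp
  · intro j _ hj; rw [if_neg (by have := Fin.val_ne_of_ne hj; omega)]
  · simp

lemma coeff_oddPoly_of_lt (u : Fin M → Poly N) (n : ℕ) (h : 2 * M - 1 < n) :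
    (oddPoly u).coeff n = 0 := by
  simp only [oddPoly, Polynomial.finsetSum_coeff, Polynomial.coeff_C_mul_X_pow]
  exact Finset.sum_eq_zero fun k _ => if_neg (by omega)

lemma coeff_oddPoly_zero (u : Fin M → Poly N) : (oddPoly u).coeff 0 = 0 := by
  simp only [oddPoly, Polynomial.finsetSum_coeff, Polynomial.coeff_C_mul_X_pow]
  exact Finset.sum_eq_zero fun k _ => if_neg (by omega)

lemma evenPoly_eq_of_coeff {u : Fin M → Poly N} {k : Fin M} {a : Poly N}
    (h : (evenPoly u).coeff (2 * k.val) = (1 / 2 ^ k.val : ℂ) • a) : u k = a := by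
  rw [coeff_evenPoly] at h
  exact smul_right_injective _ (by simp : (1 / 2 ^ k.val : ℂ) ≠ 0) h

lemma subst_oddPoly_mem_parity {S : Laurent N} (hS : S ∈ parity N 1) (u : Fin M → Poly N) :
    subst S (oddPoly u) ∈ parity N 1 := by
  rw [oddPoly, map_sum]
  refine Submodule.sum_mem _ fun k _ => ?_
  rw [subst_C_mul_X_pow]
  exact C_mul_mem_parity _ fun n hn => pow_mem_parity hS _ n (by
    contrapose! hn
    have : Even ((2 * k.val : ℕ) * 1 : ℤ) := by simp
    have := hn.add this
    push_cast at this
    ring_nf at this ⊢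
    exact this)

/-- The leading coefficient `1 / (2^M M)` of the superpotential. -/
def leadCoeff (M : ℕ) : ℂ := 1 / (2 ^ M * M)

/-- The polynomial part `∑ w_k s^{2k} / 2^k + s^{2M} / (2^M M)` of the superpotential. -/
def superpot (w : Fin M → Poly N) : Polynomial (Poly N) :=
  evenPoly w + Polynomial.C (C (leadCoeff M)) * Polynomial.X ^ (2 * M)

/-- The odd primitive of `superpot w`. -/
def openPoly (w : Fin M → Poly N) : Polynomial (Poly N) :=
  oddPoly w + Polynomial.C (C (leadCoeff M / (2 * M + 1))) * Polynomial.X ^ (2 * M + 1)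

lemma derivative_openPoly (w : Fin M → Poly N) : (openPoly w).derivative = superpot w := by
  rw [openPoly, superpot, Polynomial.derivative_add, derivative_oddPoly,
    Polynomial.derivative_C_mul_X_pow]
  congr 3
  have h : (2 * (M : ℂ) + 1) ≠ 0 := by exact_mod_cast (by omega : 2 * M + 1 ≠ 0)
  rw [← map_natCast (MvPolynomial.C : ℂ →+* Poly N), ← C_mul]
  congr 1
  push_cast
  field_simp

lemma polyDt_superpot (α : Fin N) (w : Fin M → Poly N) :
    polyDt α (superpot w) = evenPoly fun k => pderiv α (w k) := by
  rw [superpot, map_add, polyDt_evenPoly, polyDt_C_mul_X_pow]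
  simp

lemma polyDt_openPoly (α : Fin N) (w : Fin M → Poly N) :
    polyDt α (openPoly w) = oddPoly fun k => pderiv α (w k) := by
  rw [openPoly, map_add, polyDt_oddPoly, polyDt_C_mul_X_pow]
  simp

lemma coeff_derivative_superpot (w : Fin M → Poly N) (n : ℕ) (h : 2 * M - 1 < n) :
    (superpot w).derivative.coeff n = 0 := by
  rw [Polynomial.coeff_derivative, superpot, Polynomial.coeff_add,
    coeff_evenPoly_of_le _ _ (by omega), Polynomial.coeff_C_mul_X_pow, if_neg (by omega)]
  simp

lemma coeff_derivative_superpot_top (hM : M ≠ 0) (w : Fin M → Poly N) :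
    (superpot w).derivative.coeff (2 * M - 1) = C (1 / 2 ^ (M - 1) : ℂ) := by
  obtain ⟨m, rfl⟩ := Nat.exists_eq_succ_of_ne_zero hM
  have h : ((m : ℂ) + 1) ≠ 0 := by exact_mod_cast Nat.succ_ne_zero m
  rw [Polynomial.coeff_derivative, superpot, Polynomial.coeff_add,
    coeff_evenPoly_of_le _ _ (by omega), Polynomial.coeff_C_mul_X_pow, if_pos (by omega), zero_add]
  have e : ((2 * m.succ - 1 : ℕ) : Poly N) + 1 = C (2 * (m : ℂ) + 2) := by
    rw [← Nat.cast_add_one, ← map_natCast (C : ℂ →+* Poly N),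
      show 2 * m.succ - 1 + 1 = 2 * m + 2 by omega]
    push_cast
    rfl
  rw [e, ← C_mul, leadCoeff]
  congr 1
  push_cast [Nat.succ_eq_add_one, Nat.add_sub_cancel]
  field_simp
  ring

end Superpotential

end Substitution

/-! ### Flat coordinates from the expansion s(σ). -/

section FlatCoordinates

variable {M : ℕ}

/-- The series `s(σ) = σ - ∑ 2^{M-1-a} t_a σ^{2a+1-2M}`, in which the flat coordinates are the
coefficients. -/
def uniformizer (M : ℕ) : Laurent (M + 1) :=
  LaurentPolynomial.T 1 - ∑ a : Fin M,
    LaurentPolynomial.C ((2 ^ (M - 1 - a.val) : ℂ) • X a.castSucc) *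
      LaurentPolynomial.T (2 * (a.val : ℤ) + 1 - 2 * M)

lemma uniformizer_sub_T :
    uniformizer M - LaurentPolynomial.T 1 ∈ degLE (M + 1) (-1) := by
  rw [uniformizer, sub_sub_cancel_left]
  exact Submodule.neg_mem _ (Submodule.sum_mem _ fun a _ => C_mul_T_mem_degLE _ (by omega))

lemma uniformizer_mem_degLE : uniformizer M ∈ degLE (M + 1) 1 := by
  have := Submodule.add_mem _ (degLE_mono (by omega) (uniformizer_sub_T (M := M)))
    (T_mem_degLE (N := M + 1) (le_refl 1))
  simpa using this

lemma coeff_uniformizer : (uniformizer M).coeff 1 = 1 := by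
  have := uniformizer_sub_T (M := M) 1 (by omega)
  rw [AddMonoidAlgebra.coeff_sub, Finsupp.sub_apply, sub_eq_zero] at this
  simpa using this

lemma uniformizer_mem_parity : uniformizer M ∈ parity (M + 1) 1 := by
  refine Submodule.sub_mem _ ?_ (Submodule.sum_mem _ fun a _ => C_mul_T_mem_parity _ ?_)
  · simpa using C_mul_T_mem_parity (N := M + 1) 1 (m := 1) (e := 1) (by simp)
  · rw [show 2 * (a.val : ℤ) + 1 - 2 * M - 1 = 2 * (a.val - M) by ring]
    exact even_two_mul _

lemma dt_last_uniformizer : dt (Fin.last M) (uniformizer M) = 0 := by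
  rw [uniformizer, dt_sub, dt_sum, dt_T, zero_sub, neg_eq_zero]
  refine Finset.sum_eq_zero fun a _ => ?_
  rw [dt_C_mul_T, Derivation.map_smul, pderiv_X_of_ne (Fin.castSucc_lt_last a).ne]
  simp

lemma dt_castSucc_uniformizer (a : Fin M) : dt a.castSucc (uniformizer M) =
    -(LaurentPolynomial.C (C (2 ^ (M - 1 - a.val) : ℂ)) *
      LaurentPolynomial.T (2 * (a.val : ℤ) + 1 - 2 * M)) := by
  rw [uniformizer, dt_sub, dt_sum, dt_T, zero_sub, Finset.sum_eq_single a]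
  · rw [dt_C_mul_T, Derivation.map_smul, pderiv_X_self, smul_eq_C_mul, mul_one]
  · intro b _ hb
    rw [dt_C_mul_T, Derivation.map_smul,
      pderiv_X_of_ne (fun h => hb (Fin.castSucc_injective M h))]
    simp
  · simp

lemma dt_uniformizer_mem (α : Fin (M + 1)) : dt α (uniformizer M) ∈ degLE (M + 1) (-1) := by
  have := dt_mem_degLE α (uniformizer_sub_T (M := M))
  simpa [dt_sub] using this

/-- The expansion s(σ) is affine in t. This is the source of flatness. -/
lemma dt_dt_uniformizer (α β : Fin (M + 1)) : dt α (dt β (uniformizer M)) = 0 := by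
  induction β using Fin.lastCases with
  | last => rw [dt_last_uniformizer, dt_zero]
  | cast b =>
    rw [dt_castSucc_uniformizer, ← dtDer_apply, map_neg, dtDer_apply, dt_C_mul_T]
    simp

lemma ds_uniformizer_mem : ds (uniformizer M) ∈ degLE (M + 1) 0 := by
  have := ds_mem_degLE (uniformizer_mem_degLE (M := M))
  simpa using this

lemma coeff_ds_uniformizer : (ds (uniformizer M)).coeff 0 = 1 := by
  rw [coeff_ds]
  simp [coeff_uniformizer]

/-- The defining property of the unfolding parameters as functions of the flat coordinates:
on the curve `s = s(σ)` the superpotential is `σ^{2M} / (2^M M)` up to negative powers of `σ`. -/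
def IsFlatParam (w : Fin M → Poly (M + 1)) : Prop :=
  subst (uniformizer M) (superpot w) -
    LaurentPolynomial.C (C (leadCoeff M)) * LaurentPolynomial.T (2 * M) ∈ degLE (M + 1) (-1)

/-- The even powers of s(σ) are monic and even, so leading terms can be stripped two degrees at a
time: a multiple of the power removes the even exponent, and parity removes the odd one below it. -/
lemma exists_evenPoly_sub_mem (m : ℕ) (f : Laurent (M + 1)) (hp : f ∈ parity (M + 1) 0)
    (hf : f ∈ degLE (M + 1) (2 * m - 2)) :
    ∃ u : Fin m → Poly (M + 1), f - subst (uniformizer M) (evenPoly u) ∈ degLE (M + 1) (-1) := by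
  induction m generalizing f with
  | zero => exact ⟨Fin.elim0, by simpa [evenPoly] using degLE_mono (by omega) hf⟩
  | succ m ih =>
    set S := uniformizer M
    set a : Poly (M + 1) := f.coeff (2 * m)
    have hS : S ^ (2 * m) ∈ degLE (M + 1) (2 * m) := by
      simpa using pow_mem_degLE (uniformizer_mem_degLE (M := M)) (2 * m)
    have hSp : S ^ (2 * m) ∈ parity (M + 1) 0 := by
      intro n hn
      refine pow_mem_parity (uniformizer_mem_parity (M := M)) (2 * m) n fun h => hn ?_
      have : Even ((2 * m : ℕ) * 1 : ℤ) := by simp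
      simpa using h.add this
    have hf' : f ∈ degLE (M + 1) (2 * m) := degLE_mono (by push_cast; omega) hf
    have h0 : f - LaurentPolynomial.C a * S ^ (2 * m) ∈ parity (M + 1) 0 :=
      Submodule.sub_mem _ hp (C_mul_mem_parity _ hSp)
    have h1 : f - LaurentPolynomial.C a * S ^ (2 * m) ∈ degLE (M + 1) (2 * m - 1) := by
      refine degLE_of_coeff_eq_zero (Submodule.sub_mem _ hf' (C_mul_mem_degLE _ hS)) ?_
      have h3 := coeff_pow_top (uniformizer_mem_degLE (M := M)) (2 * m)
      rw [coeff_uniformizer, one_pow] at h3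
      rw [AddMonoidAlgebra.coeff_sub, Finsupp.sub_apply, coeff_C_mul]
      push_cast at h3
      rw [mul_one] at h3
      rw [h3, mul_one, sub_self]
    have h2 : f - LaurentPolynomial.C a * S ^ (2 * m) ∈ degLE (M + 1) (2 * m - 2) := by
      have := degLE_of_coeff_eq_zero h1 (h0 _ (by
        rw [sub_zero, Int.not_even_iff_odd]
        exact ⟨m - 1, by ring⟩))
      exact degLE_mono (by omega) this
    obtain ⟨u, hu⟩ := ih _ h0 h2
    -- The factor 2^m cancels the denominator built into `evenPoly`.
    refine ⟨Fin.snoc u ((2 ^ m : ℂ) • a), ?_⟩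
    convert hu using 1
    rw [evenPoly, evenPoly, Fin.sum_univ_castSucc]
    simp [smul_smul, sub_sub, S, add_comm]

/-- The difference σ^{2M} - s(σ)^{2M} is even of degree at most 2M - 2, because s(σ) is monic and
odd. Its nonnegative part is then absorbed by the even polynomial with coefficients `w`. -/
lemma exists_isFlatParam (M : ℕ) : ∃ w : Fin M → Poly (M + 1), IsFlatParam w := by
  set S := uniformizer M
  have hp : LaurentPolynomial.T (2 * M) - S ^ (2 * M) ∈ parity (M + 1) 0 := by
    refine Submodule.sub_mem _ ?_ ?_
    · simpa using C_mul_T_mem_parity (N := M + 1) 1 (m := 2 * M) (e := 0) (by simp)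
    · intro n hn
      refine pow_mem_parity (uniformizer_mem_parity (M := M)) (2 * M) n fun h => hn ?_
      have : Even ((2 * M : ℕ) * 1 : ℤ) := by simp
      simpa using h.add this
  have h1 : LaurentPolynomial.T (2 * M) - S ^ (2 * M) ∈ degLE (M + 1) (2 * M - 1) := by
    refine degLE_of_coeff_eq_zero (Submodule.sub_mem _ (T_mem_degLE le_rfl) ?_) ?_
    · simpa using pow_mem_degLE (uniformizer_mem_degLE (M := M)) (2 * M)
    · have h3 := coeff_pow_top (uniformizer_mem_degLE (M := M)) (2 * M)
      rw [coeff_uniformizer, one_pow] at h3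
      push_cast at h3
      rw [mul_one] at h3
      rw [AddMonoidAlgebra.coeff_sub, Finsupp.sub_apply, h3]
      simp
  have h2 : LaurentPolynomial.T (2 * M) - S ^ (2 * M) ∈ degLE (M + 1) (2 * M - 2) := by
    have := degLE_of_coeff_eq_zero h1 (hp _ (by
        rw [sub_zero, Int.not_even_iff_odd]
        exact ⟨M - 1, by ring⟩))
    exact degLE_mono (by omega) this
  obtain ⟨w, hw⟩ := exists_evenPoly_sub_mem M _ (C_mul_mem_parity (C (leadCoeff M)) hp)
    (C_mul_mem_degLE _ h2)
  refine ⟨w, ?_⟩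
  rw [IsFlatParam, superpot, map_add, subst_C_mul_X_pow]
  convert Submodule.neg_mem _ hw using 1
  ring

section FlatParam

variable {w : Fin M → Poly (M + 1)}

/-- The negative part of the superpotential on the curve `s = s(σ)`. -/
def remainder (w : Fin M → Poly (M + 1)) : Laurent (M + 1) :=
  subst (uniformizer M) (superpot w) -
    LaurentPolynomial.C (C (leadCoeff M)) * LaurentPolynomial.T (2 * M)

lemma subst_derivative_mem (hM : M ≠ 0) :
    subst (uniformizer M) (superpot w).derivative ∈ degLE (M + 1) (2 * M - 1) :=
  subst_mem_degLE uniformizer_mem_degLE fun n hn => coeff_derivative_superpot w n (by omega)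

lemma coeff_subst_derivative (hM : M ≠ 0) :
    (subst (uniformizer M) (superpot w).derivative).coeff (2 * M - 1) =
      C (1 / 2 ^ (M - 1) : ℂ) := by
  rw [← coeff_derivative_superpot_top hM w, ← coeff_subst_top uniformizer_mem_degLE
    coeff_uniformizer (fun n hn => coeff_derivative_superpot w n (by omega))]
  congr 1
  omega

/-- This is the t-derivative of the identity λ(s(σ)) = σ^{2M}/(2^M M) + remainder, where λ stands
for `superpot w`. The monomial in σ does not depend on t. -/
lemma subst_evenPoly_pderiv (α : Fin (M + 1)) :
    subst (uniformizer M) (evenPoly fun k => pderiv α (w k)) =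
      dt α (remainder w) - subst (uniformizer M) (superpot w).derivative *
        dt α (uniformizer M) := by
  rw [remainder, dt_sub, dt_C_mul_T, dt_subst, polyDt_superpot, pderiv_C]
  simp

/-- As s(σ) does not involve t^N, only the derivative of the remainder is left, which has no
nonnegative powers. -/
lemma pderiv_last_flatParam (hw : IsFlatParam w) (k : Fin M) : pderiv (Fin.last M) (w k) = 0 := by
  have h := subst_evenPoly_pderiv (w := w) (Fin.last M)
  rw [dt_last_uniformizer, mul_zero, sub_zero] at h
  have h2 : subst (uniformizer M) (evenPoly fun k => pderiv (Fin.last M) (w k)) ∈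
      degLE (M + 1) (-1) := h ▸ dt_mem_degLE _ hw
  refine evenPoly_eq_of_coeff (u := fun k => pderiv (Fin.last M) (w k)) ?_
  rw [coeff_eq_zero_of_subst_mem uniformizer_mem_degLE coeff_uniformizer h2 _ (by omega), smul_zero]

/-- The leading term comes from -λ'(s(σ)) ∂_a s(σ): its exponent is (2M-1) + (2a+1-2M) = 2a and its
coefficient 2^{M-1-a}/2^{M-1} = 2^{-a}. The powers of 2 in `uniformizer` are chosen for this. It
makes the Jacobian matrix of `w` unitriangular. -/
lemma evenPoly_castSucc (hw : IsFlatParam w) (hM : M ≠ 0) (a : Fin M) :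
    (∀ n : ℕ, 2 * a.val < n →
      (evenPoly fun k => pderiv a.castSucc (w k)).coeff n = 0) ∧
    (evenPoly fun k => pderiv a.castSucc (w k)).coeff (2 * a.val) = C (1 / 2 ^ a.val : ℂ) := by
  have h := subst_evenPoly_pderiv (w := w) a.castSucc
  set S := uniformizer M
  have h1 : dt a.castSucc (remainder w) ∈ degLE (M + 1) (2 * a.val - 1) :=
    degLE_mono (by omega) (dt_mem_degLE _ hw)
  have h2 : dt a.castSucc S ∈ degLE (M + 1) (2 * a.val + 1 - 2 * M) := by
    rw [dt_castSucc_uniformizer]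
    exact Submodule.neg_mem _ (C_mul_T_mem_degLE _ le_rfl)
  have h3 := mul_mem_degLE (subst_derivative_mem (w := w) hM) h2
  have h4 := coeff_mul_top (subst_derivative_mem (w := w) hM) h2
  rw [show (2 * M - 1 + (2 * a.val + 1 - 2 * M) : ℤ) = (2 * a.val : ℕ) by push_cast; ring] at h3 h4
  have h5 : ∀ n : ℕ, 2 * a.val < n →
      (evenPoly fun k => pderiv a.castSucc (w k)).coeff n = 0 := fun n hn =>
    coeff_eq_zero_of_subst_mem (d := (2 * a.val : ℕ)) uniformizer_mem_degLE coeff_uniformizer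
      (by rw [h]; exact Submodule.sub_mem _ (degLE_mono (by push_cast; omega) h1) h3) n (by omega)
  refine ⟨h5, ?_⟩
  rw [← coeff_subst_top uniformizer_mem_degLE coeff_uniformizer h5, h,
    AddMonoidAlgebra.coeff_sub, Finsupp.sub_apply, h4, h1 _ (by push_cast; omega),
    coeff_subst_derivative hM, dt_castSucc_uniformizer, AddMonoidAlgebra.coeff_neg,
    Finsupp.neg_apply, coeff_C_mul_T, if_pos rfl, mul_neg, zero_sub, neg_neg, ← C_mul]
  congr 1
  obtain ⟨j, hj⟩ : ∃ j, M - 1 = a.val + j := ⟨M - 1 - a.val, by omega⟩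
  rw [hj, Nat.add_sub_cancel_left, pow_add]
  field_simp

lemma pderiv_flatParam_of_lt (hw : IsFlatParam w) (hM : M ≠ 0) {a k : Fin M} (h : a < k) :
    pderiv a.castSucc (w k) = 0 := by
  refine evenPoly_eq_of_coeff (u := fun k => pderiv a.castSucc (w k)) ?_
  rw [(evenPoly_castSucc hw hM a).1 _ (by have : a.val < k.val := h; omega), smul_zero]

lemma pderiv_flatParam_self (hw : IsFlatParam w) (hM : M ≠ 0) (a : Fin M) : pderiv a.castSucc (w a) = 1 := by
  refine evenPoly_eq_of_coeff (u := fun k => pderiv a.castSucc (w k)) ?_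
  rw [(evenPoly_castSucc hw hM a).2, smul_eq_C_mul, mul_one]

end FlatParam

end FlatCoordinates

/-! ### Quasi-homogeneity of the unfolding parameters. -/

section Euler

variable {M : ℕ}

/-- The Euler derivation `∑ q_α t^α ∂/∂t^α` of polynomials. -/
def euler {N : ℕ} : Derivation ℂ (Poly N) (Poly N) :=
  ∑ α, (weight N α • X α : Poly N) • pderiv α

lemma euler_apply {N : ℕ} (p : Poly N) :
    euler p = ∑ α, weight N α • (X α * pderiv α p) := by
  have h := map_sum (Derivation.coeFnAddMonoidHom (R := ℂ) (A := Poly N) (M := Poly N))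
    (fun α => (weight N α • X α : Poly N) • (pderiv α : Derivation ℂ (Poly N) (Poly N)))
    Finset.univ
  have h2 : euler p = ∑ α, (weight N α • X α : Poly N) • pderiv α p :=
    (congrFun h p).trans (Finset.sum_apply p Finset.univ _)
  simp only [h2, smul_eq_mul, smul_mul_assoc]

lemma euler_X {N : ℕ} (i : Fin N) : euler (X i : Poly N) = weight N i • X i := by
  rw [euler_apply, Finset.sum_eq_single i]
  · rw [pderiv_X_self, mul_one]
  · intro j _ hj; rw [pderiv_X_of_ne hj.symm, mul_zero, smul_zero]
  · simp

lemma weight_castSucc (a : Fin M) :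
    weight (M + 1) a.castSucc = ((M : ℂ) - a.val) / M := by
  rw [weight, if_pos (by simp)]
  push_cast
  simp

lemma weight_last : weight (M + 1) (Fin.last M) = ((M : ℂ) + 1) / (2 * M) := by
  rw [weight, if_neg (by simp)]
  push_cast
  simp

lemma C_C_mul {N : ℕ} (c : ℂ) (f : Laurent N) : LaurentPolynomial.C (C c) * f = c • f := by
  rw [← mul_one (C c : Poly N), ← smul_eq_C_mul, C_smul, map_one, smul_mul_assoc, one_mul]

/-- The Euler operator `∑ q_α t^α ∂/∂t^α + (1/2M) s ∂/∂s`. -/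
def laurentEuler (f : Laurent (M + 1)) : Laurent (M + 1) :=
  ∑ α, weight (M + 1) α • (LaurentPolynomial.C (X α) * dt α f) +
    (1 / (2 * (M : ℂ))) • (LaurentPolynomial.T 1 * ds f)

lemma laurentEuler_add (f g : Laurent (M + 1)) :
    laurentEuler (f + g) = laurentEuler f + laurentEuler g := by
  simp only [laurentEuler, dt_add, ds_add, mul_add, smul_add, Finset.sum_add_distrib]
  abel

lemma laurentEuler_neg (f : Laurent (M + 1)) : laurentEuler (-f) = -laurentEuler f := by
  rw [eq_neg_iff_add_eq_zero, ← laurentEuler_add]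
  simp [laurentEuler]

lemma laurentEuler_sum {ι : Type*} (s : Finset ι) (f : ι → Laurent (M + 1)) :
    laurentEuler (∑ i ∈ s, f i) = ∑ i ∈ s, laurentEuler (f i) :=
  map_sum (AddMonoidHom.mk' laurentEuler laurentEuler_add) f s

lemma laurentEuler_C_mul_T (a : Poly (M + 1)) (n : ℤ) :
    laurentEuler (LaurentPolynomial.C a * LaurentPolynomial.T n) =
      LaurentPolynomial.C (euler a + ((n : ℂ) / (2 * M)) • a) * LaurentPolynomial.T n := by
  rw [laurentEuler, euler_apply]
  simp only [dt_C_mul_T, ds_C_mul_T, map_add, map_sum, add_mul, Finset.sum_mul]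
  congr 1
  · refine Finset.sum_congr rfl fun α _ => ?_
    rw [C_smul, map_mul, smul_mul_assoc, mul_assoc]
  · rw [C_smul, C_smul, smul_mul_assoc, smul_mul_assoc, mul_smul_comm, smul_smul,
      mul_left_comm, ← LaurentPolynomial.T_add]
    rw [add_sub_cancel, one_div_mul_eq_div]

lemma laurentEuler_mem {d : ℤ} {f : Laurent (M + 1)} (hf : f ∈ degLE (M + 1) d) :
    laurentEuler f ∈ degLE (M + 1) d := by
  refine Submodule.add_mem _ (Submodule.sum_mem _ fun α _ => Submodule.smul_mem _ _
    (C_mul_mem_degLE _ (dt_mem_degLE α hf))) (Submodule.smul_mem _ _ ?_)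
  exact degLE_mono (by omega) (mul_mem_degLE (T_mem_degLE le_rfl) (ds_mem_degLE hf))

/-- Each term t_a σ^{2a+1-2M} has weight (M-a)/M + (2a+1-2M)/(2M) = 1/(2M), the weight of σ itself.
-/
lemma laurentEuler_uniformizer (hM : M ≠ 0) :
    laurentEuler (uniformizer M) = (1 / (2 * (M : ℂ))) • uniformizer M := by
  have hM' : (M : ℂ) ≠ 0 := by exact_mod_cast hM
  have hT := laurentEuler_C_mul_T (M := M) 1 1
  rw [map_one, one_mul, Derivation.map_one_eq_zero, zero_add, C_smul, smul_mul_assoc, map_one,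
    one_mul] at hT
  rw [uniformizer, sub_eq_add_neg, laurentEuler_add, laurentEuler_neg, laurentEuler_sum, hT,
    smul_add, smul_neg, Finset.smul_sum]
  push_cast
  congr 2
  refine Finset.sum_congr rfl fun a _ => ?_
  rw [laurentEuler_C_mul_T, Derivation.map_smul, euler_X, weight_castSucc, ← smul_mul_assoc,
    ← C_smul]
  congr 2
  rw [smul_smul, smul_smul, smul_smul, ← add_smul]
  congr 1
  push_cast
  field_simp
  ring

/-- The Euler operator on polynomials in `s`. -/
def polyEuler (p : Polynomial (Poly (M + 1))) : Polynomial (Poly (M + 1)) :=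
  ∑ α, Polynomial.C (weight (M + 1) α • X α) * polyDt α p +
    Polynomial.C (C (1 / (2 * (M : ℂ)))) * (Polynomial.X * p.derivative)

lemma coeff_polyEuler (p : Polynomial (Poly (M + 1))) (n : ℕ) :
    (polyEuler p).coeff n = euler (p.coeff n) + ((n : ℂ) / (2 * M)) • p.coeff n := by
  rw [polyEuler, euler_apply, Polynomial.coeff_add, Polynomial.finsetSum_coeff,
    Polynomial.coeff_C_mul]
  congr 1
  · refine Finset.sum_congr rfl fun α _ => ?_
    rw [Polynomial.coeff_C_mul, coeff_polyDt, smul_mul_assoc]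
  · cases n with
    | zero => simp
    | succ n =>
      rw [Polynomial.coeff_X_mul, Polynomial.coeff_derivative, ← Nat.cast_add_one,
        ← map_natCast (C : ℂ →+* Poly (M + 1)), mul_comm (p.coeff _), ← mul_assoc, ← C_mul,
        smul_eq_C_mul]
      congr 2
      ring

/-- Since s(σ) has the weight of s, the Euler operators in (t, σ) and in (t, s) correspond. -/
lemma laurentEuler_subst (hM : M ≠ 0) (p : Polynomial (Poly (M + 1))) :
    laurentEuler (subst (uniformizer M) p) = subst (uniformizer M) (polyEuler p) := by
  have h : laurentEuler (subst (uniformizer M) p) =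
      ∑ α, LaurentPolynomial.C (weight (M + 1) α • X α) * subst (uniformizer M) (polyDt α p) +
        subst (uniformizer M) p.derivative * laurentEuler (uniformizer M) := by
    simp only [laurentEuler, dt_subst, ds_subst, mul_add, smul_add, Finset.sum_add_distrib,
      Finset.mul_sum, add_assoc, C_smul]
    congr 1
    · exact Finset.sum_congr rfl fun α _ => by rw [smul_mul_assoc]
    · congr 1
      · exact Finset.sum_congr rfl fun α _ => by rw [mul_left_comm, mul_smul_comm]
      · rw [mul_left_comm, mul_smul_comm]
  rw [h, laurentEuler_uniformizer hM, polyEuler]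
  simp only [map_add, map_sum, map_mul, subst_C, subst_X]
  congr 1
  rw [mul_smul_comm, mul_comm (uniformizer M), C_C_mul]

/-- The monomial σ^{2M} has weight 1, so the failure of λ(s(σ)) to be homogeneous of weight 1 comes
from the remainder alone and has only negative exponents. A polynomial in s(σ) with that property is
zero; its coefficient at s^{2k} gives the claim. -/
lemma euler_flatParam {w : Fin M → Poly (M + 1)} (hw : IsFlatParam w) (hM : M ≠ 0) (k : Fin M) :
    euler (w k) = weight (M + 1) k.castSucc • w k := by
  have hM' : (M : ℂ) ≠ 0 := by exact_mod_cast hM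
  have h1 : laurentEuler (remainder w) - remainder w =
      subst (uniformizer M) (polyEuler (superpot w) - superpot w) := by
    have h2 := laurentEuler_C_mul_T (M := M) (C (leadCoeff M)) (2 * M)
    have h3 : euler (C (leadCoeff M) : Poly (M + 1)) = 0 := by
      rw [← algebraMap_eq, Derivation.map_algebraMap]
    rw [h3, zero_add, show (((2 * M : ℤ) : ℂ) / (2 * M)) = 1 by push_cast; field_simp,
      one_smul] at h2
    rw [map_sub, ← laurentEuler_subst hM, remainder, sub_eq_add_neg (subst _ _),
      laurentEuler_add, laurentEuler_neg, h2]
    ring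
  have h4 : subst (uniformizer M) (polyEuler (superpot w) - superpot w) ∈ degLE (M + 1) (-1) :=
    h1 ▸ Submodule.sub_mem _ (laurentEuler_mem hw) hw
  have h5 := coeff_eq_zero_of_subst_mem uniformizer_mem_degLE coeff_uniformizer h4 (2 * k.val)
    (by omega)
  rw [Polynomial.coeff_sub, coeff_polyEuler, superpot, Polynomial.coeff_add, coeff_evenPoly,
    Polynomial.coeff_C_mul_X_pow, if_neg (by omega), add_zero, Derivation.map_smul,
    smul_comm _ (1 / 2 ^ k.val : ℂ), ← smul_add, ← smul_sub] at h5
  have h6 := (smul_eq_zero.1 h5).resolve_left (by simp)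
  rw [sub_eq_zero, ← eq_sub_iff_add_eq] at h6
  rw [h6, weight_castSucc]
  nth_rewrite 1 [← one_smul ℂ (w k)]
  rw [← sub_smul]
  congr 1
  push_cast
  field_simp

end Euler

/-! ### Polynomial inversion of triangular coordinate changes. -/

section Inverse

/-- In characteristic zero, differentiating by a variable that occurs in a monomial does not kill
it. -/
lemma mem_supported_of_pderiv_eq_zero {N : ℕ} {p : Poly N} {s : Set (Fin N)}
    (h : ∀ i ∉ s, pderiv i p = 0) : p ∈ supported ℂ s := by
  rw [mem_supported]
  intro i hi
  by_contra his
  obtain ⟨m, hm, him⟩ := (mem_vars_iff_mem_support i).1 hi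
  have h1 := congrArg (coeff (m - Finsupp.single i 1)) (h i his)
  have h2 : 1 ≤ m i := Nat.one_le_iff_ne_zero.2 (Finsupp.mem_support_iff.1 him)
  rw [coeff_pderiv, tsub_add_cancel_of_le (Finsupp.single_le_iff.2 h2), coeff_zero] at h1
  refine mul_ne_zero (mem_support_iff.1 hm) ?_ h1
  exact Nat.cast_add_one_ne_zero _

/-- The kernels of the iterates form an ascending chain, stable from some n on. If f a = 0 and a =
f^n b, then b lies in the kernel of f^{n+1}, hence of f^n, so a = 0. -/
lemma injective_of_surjective_endomorphism {R : Type*} [CommRing R] [IsNoetherianRing R]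
    (f : R →+* R) (hf : Function.Surjective f) : Function.Injective f := by
  let g : ℕ →o Ideal R := ⟨fun n => RingHom.ker (f ^ n), monotone_nat_of_le_succ fun n a ha => by
    rw [RingHom.mem_ker] at ha ⊢
    rw [pow_succ', RingHom.mul_def, RingHom.comp_apply, ha, map_zero]⟩
  obtain ⟨n, hn⟩ := monotone_stabilizes_iff_noetherian.2 ‹IsNoetherianRing R› g
  have hs : Function.Surjective (f ^ n : R →+* R) := by
    rw [RingHom.coe_pow]; exact hf.iterate n
  rw [injective_iff_map_eq_zero]
  intro a ha
  obtain ⟨b, rfl⟩ := hs a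
  have : b ∈ g (n + 1) := by
    change (f ^ (n + 1)) b = 0
    rw [pow_succ', RingHom.mul_def, RingHom.comp_apply, ha]
  rw [← hn (n + 1) (Nat.le_succ n)] at this
  exact this

/-- A triangular polynomial substitution has a polynomial inverse. -/
lemma exists_inverse {N : ℕ} (v : Fin N → Poly N)
    (hv : ∀ i, v i - X i ∈ supported ℂ (Set.Ioi i)) :
    ∃ t : Fin N → Poly N, (∀ i, aeval v (t i) = X i) ∧ ∀ i, aeval t (v i) = X i := by
  -- Downward induction on the index: `X i` is `v i` minus a polynomial in later variables, which
  -- are already in the range.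
  have hX : ∀ k : ℕ, ∀ i : Fin N, N ≤ i.val + k → X i ∈ (aeval v : Poly N →ₐ[ℂ] Poly N).range := by
    intro k
    induction k with
    | zero => intro i hi; omega
    | succ k ih =>
      intro i hi
      have h1 : supported ℂ (Set.Ioi i) ≤ (aeval v : Poly N →ₐ[ℂ] Poly N).range := by
        rw [supported, Algebra.adjoin_le_iff]
        rintro _ ⟨j, hj, rfl⟩
        exact ih j (by have : i.val < j.val := hj; omega)
      have h2 := Subalgebra.sub_mem _ (⟨X i, aeval_X v i⟩ : v i ∈ (aeval v).range) (h1 (hv i))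
      simpa using h2
  have hs : Function.Surjective (aeval v : Poly N →ₐ[ℂ] Poly N) := by
    rw [← AlgHom.range_eq_top, eq_top_iff, ← adjoin_range_X, Algebra.adjoin_le_iff]
    rintro _ ⟨i, rfl⟩
    exact hX N i (by omega)
  have hi : Function.Injective (aeval v : Poly N →ₐ[ℂ] Poly N) :=
    injective_of_surjective_endomorphism (aeval v : Poly N →ₐ[ℂ] Poly N).toRingHom hs
  choose t ht using fun i => hs (X i)
  refine ⟨t, ht, fun i => hi ?_⟩
  have : ((aeval v).comp (aeval t) : Poly N →ₐ[ℂ] Poly N) = AlgHom.id ℂ _ := by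
    refine algHom_ext fun j => ?_
    rw [AlgHom.comp_apply, aeval_X, ht, AlgHom.id_apply]
  have h := DFunLike.congr_fun this (v i)
  rw [AlgHom.comp_apply, AlgHom.id_apply] at h
  exact h.trans (aeval_X v i).symm

variable {M : ℕ}

/-- The unfolding parameters as functions of the flat coordinates. -/
def flatParam (w : Fin M → Poly (M + 1)) : Fin (M + 1) → Poly (M + 1) :=
  Fin.snoc w (X (Fin.last M))

@[simp] lemma flatParam_last (w : Fin M → Poly (M + 1)) :
    flatParam w (Fin.last M) = X (Fin.last M) := by simp [flatParam]

@[simp] lemma flatParam_castSucc (w : Fin M → Poly (M + 1)) (k : Fin M) :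
    flatParam w k.castSucc = w k := by simp [flatParam]

lemma flatParam_sub_X_mem {w : Fin M → Poly (M + 1)} (hw : IsFlatParam w) (hM : M ≠ 0)
    (i : Fin (M + 1)) : flatParam w i - X i ∈ supported ℂ (Set.Ioi i) := by
  induction i using Fin.lastCases with
  | last => simp
  | cast k =>
    refine mem_supported_of_pderiv_eq_zero fun j hj => ?_
    rw [Set.mem_Ioi, not_lt] at hj
    rw [flatParam_castSucc, map_sub]
    induction j using Fin.lastCases with
    | last => exact absurd hj (not_le.2 (Fin.castSucc_lt_last k))
    | cast a =>
      rcases eq_or_lt_of_le hj with h | h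
      · obtain rfl := Fin.castSucc_injective M h
        rw [pderiv_flatParam_self hw hM, pderiv_X_self, sub_self]
      · rw [pderiv_flatParam_of_lt hw hM h, pderiv_X_of_ne h.ne', sub_zero]

lemma euler_flatParam' {w : Fin M → Poly (M + 1)} (hw : IsFlatParam w) (hM : M ≠ 0)
    (i : Fin (M + 1)) : euler (flatParam w i) = weight (M + 1) i • flatParam w i := by
  induction i using Fin.lastCases with
  | last => rw [flatParam_last, euler_X]
  | cast k => rw [flatParam_castSucc, euler_flatParam hw hM]

end Inverse

/-! ### The division identity for F^o in flat coordinates. -/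

section OpenPotential

lemma exists_derivative_eq {N : ℕ} (p : Polynomial (Poly N)) :
    ∃ q : Polynomial (Poly N), q.derivative = p := by
  induction p using poly_induction with
  | add p q hp hq =>
    obtain ⟨p', rfl⟩ := hp
    obtain ⟨q', rfl⟩ := hq
    exact ⟨p' + q', by simp⟩
  | mono a n =>
    refine ⟨Polynomial.C ((1 / ((n : ℂ) + 1)) • a) * Polynomial.X ^ (n + 1), ?_⟩
    have h : ((n : ℂ) + 1) ≠ 0 := Nat.cast_add_one_ne_zero n
    rw [Polynomial.derivative_C_mul_X_pow, ← map_natCast (MvPolynomial.C : ℂ →+* Poly N),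
      mul_comm _ (MvPolynomial.C _), ← smul_eq_C_mul, smul_smul]
    push_cast
    rw [mul_one_div_cancel h, one_smul]

lemma laurent_neg_mul {N : ℕ} (f g : Laurent N) : -f * g = -(f * g) := by ring

lemma laurent_neg_mul_neg {N : ℕ} (f g : Laurent N) : -f * -g = f * g := by ring

/-- An exact differential has no residue. -/
lemma coeff_ds_neg_one {N : ℕ} (f : Laurent N) : (ds f).coeff (-1) = 0 := by
  rw [coeff_ds]
  simp

variable {M : ℕ} {w : Fin M → Poly (M + 1)}

/-- `∂_a λ ∂_b λ - ∂_a ∂_b Fo ∂_s λ` for the polynomial parts of `λ` and `Fo`. -/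
def residual (w : Fin M → Poly (M + 1)) (a b : Fin M) : Polynomial (Poly (M + 1)) :=
  (evenPoly fun k => pderiv a.castSucc (w k)) * (evenPoly fun k => pderiv b.castSucc (w k)) -
    (oddPoly fun k => pderiv a.castSucc (pderiv b.castSucc (w k))) * (superpot w).derivative

lemma subst_superpot : subst (uniformizer M) (superpot w) =
    LaurentPolynomial.C (C (leadCoeff M)) * LaurentPolynomial.T (2 * M) + remainder w := by
  rw [remainder]; ring

lemma dt_dt_subst_openPoly (α β : Fin (M + 1)) :
    dt α (dt β (subst (uniformizer M) (openPoly w))) =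
      subst (uniformizer M) (oddPoly fun k => pderiv α (pderiv β (w k))) -
      subst (uniformizer M) (superpot w).derivative * dt α (uniformizer M) * dt β (uniformizer M) +
      dt β (remainder w) * dt α (uniformizer M) + dt α (remainder w) * dt β (uniformizer M) := by
  rw [dt_subst, dt_add, dt_subst, dt_mul, derivative_openPoly, dt_dt_uniformizer, polyDt_openPoly,
    polyDt_oddPoly, derivative_oddPoly, subst_evenPoly_pderiv, subst_superpot, dt_add, dt_C_mul_T,
    pderiv_C]
  simp only [map_zero, zero_mul, zero_add, mul_zero]
  ring

/-- With G = `openPoly w` at s(σ), ∂_σ G = (σ^{2M}/(2^M M) + E) ∂_σ s(σ), E being the remainder. The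
first summand is affine in t and dies under two t-derivatives; the second has negative exponents
only. Integration in σ leaves exponents at most 0, and 0 is excluded because G is odd. -/
lemma dt_dt_subst_openPoly_mem (hw : IsFlatParam w) (α β : Fin (M + 1)) :
    dt α (dt β (subst (uniformizer M) (openPoly w))) ∈ degLE (M + 1) (-1) := by
  set G := subst (uniformizer M) (openPoly w) with hG
  have h1 : ds (dt α (dt β G)) ∈ degLE (M + 1) (-1) := by
    have h2 : dt α (dt β (LaurentPolynomial.C (C (leadCoeff M)) * LaurentPolynomial.T (2 * M) *
        ds (uniformizer M))) = 0 := by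
      rw [dt_mul, dt_C_mul_T, dt_add, dt_mul, dt_C_mul_T, dt_ds, dt_ds, dt_dt_uniformizer]
      simp
    rw [← dt_ds, ← dt_ds, hG, ds_subst, derivative_openPoly, subst_superpot, add_mul, dt_add,
      dt_add, h2, zero_add]
    exact dt_mem_degLE _ (dt_mem_degLE _ (degLE_mono (by omega)
      (mul_mem_degLE hw ds_uniformizer_mem)))
  have h3 : dt α (dt β G) ∈ degLE (M + 1) 0 := fun n hn => by
    have h4 := h1 (n - 1) (by omega)
    rw [coeff_ds, sub_add_cancel] at h4
    refine (smul_eq_zero.1 h4).resolve_left ?_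
    push_cast
    rw [sub_add_cancel]
    exact_mod_cast hn.ne'
  have h5 : dt α (dt β G) ∈ parity (M + 1) 1 := by
    refine dt_mem_parity _ (dt_mem_parity _ ?_)
    rw [hG, openPoly, map_add, subst_C_mul_X_pow]
    refine Submodule.add_mem _ (subst_oddPoly_mem_parity uniformizer_mem_parity w)
      (C_mul_mem_parity _ fun n hn => pow_mem_parity uniformizer_mem_parity _ n fun h => hn ?_)
    have := h.add (even_two_mul (M : ℤ))
    push_cast at this
    ring_nf at this ⊢
    exact this
  exact degLE_of_coeff_eq_zero h3 (h5 0 (by decide))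

/-- The degree bound is read off from `dt_dt_subst_openPoly`, in which every other term is of
negative degree. The coefficient at σ^{-1} is a residue, computed after multiplication by ∂_σ s(σ) =
1 + lower terms. -/
lemma residual_aux (hM : M ≠ 0) (hw : IsFlatParam w) (a b : Fin M) :
    let R := subst (uniformizer M) (superpot w).derivative * dt a.castSucc (uniformizer M) *
        dt b.castSucc (uniformizer M) -
      subst (uniformizer M) (oddPoly fun k => pderiv a.castSucc (pderiv b.castSucc (w k)))
    R ∈ degLE (M + 1) (-1) ∧ R.coeff (-1) = if a.val + b.val + 1 = M then 1 else 0 := by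
  intro R
  have hs := dt_uniformizer_mem (M := M)
  have hE : ∀ α, dt α (remainder w) ∈ degLE (M + 1) (-1) := fun α => dt_mem_degLE α hw
  have hR : R ∈ degLE (M + 1) (-1) := by
    have h1 : R = dt b.castSucc (remainder w) * dt a.castSucc (uniformizer M) +
        dt a.castSucc (remainder w) * dt b.castSucc (uniformizer M) -
        dt a.castSucc (dt b.castSucc (subst (uniformizer M) (openPoly w))) := by
      rw [dt_dt_subst_openPoly]; ring
    rw [h1]
    exact Submodule.sub_mem _ (Submodule.add_mem _
      (degLE_mono (by omega) (mul_mem_degLE (hE _) (hs _)))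
      (degLE_mono (by omega) (mul_mem_degLE (hE _) (hs _)))) (dt_dt_subst_openPoly_mem hw _ _)
  refine ⟨hR, ?_⟩
  have h2 := coeff_mul_top hR (ds_uniformizer_mem (M := M))
  rw [coeff_ds_uniformizer, mul_one, add_zero] at h2
  -- The term containing `oddPoly`, multiplied by ∂_σ s(σ), is exact and has no residue. In the
  -- other term λ'(s(σ)) ∂_σ s(σ) is the derivative of σ^{2M}/(2^M M) + remainder, and only its
  -- leading monomial can contribute.
  obtain ⟨q, hq⟩ := exists_derivative_eq
    (oddPoly fun k => pderiv a.castSucc (pderiv b.castSucc (w k)))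
  have h3 : R * ds (uniformizer M) =
      LaurentPolynomial.C ((2 * M * leadCoeff M : ℂ) • C (2 ^ (M - 1 - a.val) : ℂ) *
        C (2 ^ (M - 1 - b.val) : ℂ)) *
        LaurentPolynomial.T (2 * (a.val + b.val + 1) - 2 * M - 1) +
      ds (remainder w) * (dt a.castSucc (uniformizer M) * dt b.castSucc (uniformizer M)) -
      ds (subst (uniformizer M) q) := by
    have h4 : subst (uniformizer M) (superpot w).derivative * ds (uniformizer M) =
        LaurentPolynomial.C ((2 * M * leadCoeff M : ℂ) • (1 : Poly (M + 1))) *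
          LaurentPolynomial.T (2 * M - 1) + ds (remainder w) := by
      rw [← ds_subst, subst_superpot, ds_add, ds_C_mul_T, smul_eq_C_mul, ← C_mul, smul_eq_C_mul,
        mul_one]
      push_cast
      rfl
    have h5 : LaurentPolynomial.C ((2 * M * leadCoeff M : ℂ) • (1 : Poly (M + 1))) *
          LaurentPolynomial.T (2 * M - 1) *
          (dt a.castSucc (uniformizer M) * dt b.castSucc (uniformizer M)) =
        LaurentPolynomial.C ((2 * M * leadCoeff M : ℂ) • C (2 ^ (M - 1 - a.val) : ℂ) *
        C (2 ^ (M - 1 - b.val) : ℂ)) *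
        LaurentPolynomial.T (2 * (a.val + b.val + 1) - 2 * M - 1) := by
      rw [dt_castSucc_uniformizer, dt_castSucc_uniformizer, laurent_neg_mul_neg, C_mul_T_mul, C_mul_T_mul,
        smul_mul_assoc, one_mul, smul_mul_assoc]
      congr 2
      ring
    rw [ds_subst, hq, ← h5, ← add_mul, ← h4]
    ring
  have h6 : ds (remainder w) * (dt a.castSucc (uniformizer M) * dt b.castSucc (uniformizer M)) ∈
      degLE (M + 1) (-2) := degLE_mono (by omega)
    (mul_mem_degLE (ds_mem_degLE hw) (mul_mem_degLE (hs _) (hs _)))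
  rw [← h2, h3, AddMonoidAlgebra.coeff_sub, Finsupp.sub_apply, coeff_ds_neg_one, sub_zero,
    AddMonoidAlgebra.coeff_add, Finsupp.add_apply, h6 _ (by omega), add_zero, coeff_C_mul_T]
  by_cases h : a.val + b.val + 1 = M
  · have hM' : (M : ℂ) ≠ 0 := by exact_mod_cast hM
    rw [if_pos h, if_pos (by omega), show M - 1 - a.val = b.val by omega,
      show M - 1 - b.val = a.val by omega, smul_eq_C_mul, ← C_mul, ← C_mul, leadCoeff]
    have e : (2 : ℂ) ^ M = 2 ^ a.val * 2 ^ b.val * 2 := by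
      rw [← pow_add, ← pow_succ, h]
    rw [e, ← map_one C]
    congr 1
    field_simp
  · rw [if_neg h, if_neg (by omega)]

/-- Inserting s(σ) and expanding the product with `subst_evenPoly_pderiv`, the polynomial becomes
λ'(s(σ)) times the element of `residual_aux`, up to terms of degree at most 2M - 3. So its degree is
at most (2M-1) - 1, with top coefficient a product of two known ones. -/
lemma residual_spec (hM : M ≠ 0) (hw : IsFlatParam w) (a b : Fin M) :
    (∀ n : ℕ, 2 * M - 2 < n → (residual w a b).coeff n = 0) ∧
    (residual w a b).coeff (2 * M - 2) =
      C (1 / 2 ^ (M - 1) : ℂ) * if a.val + b.val + 1 = M then 1 else 0 := by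
  obtain ⟨hR, hR1⟩ := residual_aux hM hw a b
  set R := subst (uniformizer M) (superpot w).derivative * dt a.castSucc (uniformizer M) *
        dt b.castSucc (uniformizer M) -
      subst (uniformizer M) (oddPoly fun k => pderiv a.castSucc (pderiv b.castSucc (w k))) with hRdef
  have hs := dt_uniformizer_mem (M := M)
  have hE : ∀ α, dt α (remainder w) ∈ degLE (M + 1) (-1) := fun α => dt_mem_degLE α hw
  have h1 : subst (uniformizer M) (residual w a b) =
      subst (uniformizer M) (superpot w).derivative * R +
      (dt a.castSucc (remainder w) * dt b.castSucc (remainder w) -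
        subst (uniformizer M) (superpot w).derivative *
          (dt a.castSucc (remainder w) * dt b.castSucc (uniformizer M) +
          dt b.castSucc (remainder w) * dt a.castSucc (uniformizer M))) := by
    rw [residual, map_sub, map_mul, map_mul, subst_evenPoly_pderiv, subst_evenPoly_pderiv, hRdef]
    ring
  have hL := subst_derivative_mem (w := w) hM
  have h2 : dt a.castSucc (remainder w) * dt b.castSucc (remainder w) -
        subst (uniformizer M) (superpot w).derivative *
          (dt a.castSucc (remainder w) * dt b.castSucc (uniformizer M) +
          dt b.castSucc (remainder w) * dt a.castSucc (uniformizer M)) ∈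
        degLE (M + 1) (2 * M - 3) :=
    Submodule.sub_mem _ (degLE_mono (by omega) (mul_mem_degLE (hE _) (hE _)))
      (degLE_mono (by omega) (mul_mem_degLE hL (Submodule.add_mem _
        (mul_mem_degLE (hE _) (hs _)) (mul_mem_degLE (hE _) (hs _)))))
  have h3 := mul_mem_degLE hL hR
  have h4 := coeff_mul_top hL hR
  rw [show (2 * (M : ℤ) - 1 + -1) = (2 * M - 2 : ℕ) by omega] at h3 h4
  have h5 : ∀ n : ℕ, 2 * M - 2 < n → (residual w a b).coeff n = 0 := fun n hn =>
    coeff_eq_zero_of_subst_mem (d := (2 * M - 2 : ℕ)) uniformizer_mem_degLE coeff_uniformizer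
      (by rw [h1]; exact Submodule.add_mem _ h3 (degLE_mono (by omega) h2)) n (by omega)
  refine ⟨h5, ?_⟩
  rw [← coeff_subst_top uniformizer_mem_degLE coeff_uniformizer h5, h1,
    AddMonoidAlgebra.coeff_add, Finsupp.add_apply, h4, h2 _ (by omega), add_zero, hR1,
    coeff_subst_derivative hM]

/-- The open potential with unfolding parameters `v`. -/
def openPot (v : Fin (M + 1) → Poly (M + 1)) : Laurent (M + 1) :=
  Polynomial.toLaurent (openPoly fun k : Fin M => v k.castSucc) +
    LaurentPolynomial.C ((1 / 2 : ℂ) • v (Fin.last M) ^ 2) * LaurentPolynomial.T (-1)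

lemma ds_openPot (v : Fin (M + 1) → Poly (M + 1)) : ds (openPot v) =
    Polynomial.toLaurent (superpot fun k : Fin M => v k.castSucc) -
      LaurentPolynomial.C ((1 / 2 : ℂ) • v (Fin.last M) ^ 2) * LaurentPolynomial.T (-2) := by
  rw [openPot, ds_add, ds_toLaurent, derivative_openPoly, ds_C_mul_T, sub_eq_add_neg]
  rw [show (((-1 : ℤ)) : ℂ) = -1 by norm_num, C_smul, neg_one_smul, laurent_neg_mul]
  norm_num
  exact (sub_eq_add_neg _ _).symm

lemma ds_ds_openPot (v : Fin (M + 1) → Poly (M + 1)) : ds (ds (openPot v)) =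
    Polynomial.toLaurent (superpot fun k : Fin M => v k.castSucc).derivative +
      LaurentPolynomial.C (v (Fin.last M) ^ 2) * LaurentPolynomial.T (-3) := by
  rw [ds_openPot, ds_sub, ds_toLaurent, ds_C_mul_T, sub_eq_add_neg, ← laurent_neg_mul, ← map_neg,
    smul_smul, ← neg_smul]
  norm_num

lemma dt_ds_openPot (v : Fin (M + 1) → Poly (M + 1)) (α : Fin (M + 1)) : dt α (ds (openPot v)) =
    Polynomial.toLaurent (evenPoly fun k : Fin M => pderiv α (v k.castSucc)) -
      LaurentPolynomial.C (v (Fin.last M) * pderiv α (v (Fin.last M))) *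
        LaurentPolynomial.T (-2) := by
  rw [ds_openPot, dt_sub, dt_toLaurent, dt_C_mul_T, polyDt_superpot, Derivation.map_smul,
    pderiv_pow, smul_eq_C_mul]
  congr 3
  rw [show ((2 : ℕ) : Poly (M + 1)) = C 2 by simp [← map_ofNat (C : ℂ →+* Poly (M + 1)) 2],
    mul_assoc, ← mul_assoc, ← C_mul]
  simp

section Flat

lemma dt_castSucc_ds_openPot (w : Fin M → Poly (M + 1)) (a : Fin M) :
    dt a.castSucc (ds (openPot (flatParam w))) =
      Polynomial.toLaurent (evenPoly fun k => pderiv a.castSucc (w k)) := by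
  rw [dt_ds_openPot, flatParam_last, pderiv_X_of_ne (Fin.castSucc_lt_last a).ne']
  simp

lemma dt_last_ds_openPot (hw : IsFlatParam w) :
    dt (Fin.last M) (ds (openPot (flatParam w))) =
      -(LaurentPolynomial.C (X (Fin.last M)) * LaurentPolynomial.T (-2)) := by
  rw [dt_ds_openPot, flatParam_last, pderiv_X_self, mul_one]
  simp [pderiv_last_flatParam hw, evenPoly]

lemma dt_castSucc_openPot (w : Fin M → Poly (M + 1)) (a : Fin M) :
    dt a.castSucc (openPot (flatParam w)) =
      Polynomial.toLaurent (oddPoly fun k => pderiv a.castSucc (w k)) := by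
  rw [openPot, dt_add, dt_toLaurent, polyDt_openPoly, dt_C_mul_T, Derivation.map_smul, pderiv_pow,
    flatParam_last, pderiv_X_of_ne (Fin.castSucc_lt_last a).ne']
  simp

lemma dt_last_openPot (hw : IsFlatParam w) :
    dt (Fin.last M) (openPot (flatParam w)) =
      LaurentPolynomial.C (X (Fin.last M)) * LaurentPolynomial.T (-1) := by
  rw [openPot, dt_add, dt_toLaurent, polyDt_openPoly, dt_C_mul_T, Derivation.map_smul, pderiv_pow,
    flatParam_last, pderiv_X_self]
  rw [show ((2 : ℕ) : Poly (M + 1)) = C 2 by simp [← map_ofNat (C : ℂ →+* Poly (M + 1)) 2],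
    mul_one, smul_eq_C_mul, ← mul_assoc, ← C_mul]
  simp [pderiv_last_flatParam hw, oddPoly]

/-- The matrix of the metric in flat coordinates. -/
def flatMetric (M : ℕ) (α β : Fin (M + 1)) : ℂ :=
  if α.val + β.val + 1 = M then 1 else if α.val + β.val = 2 * M then -1 else 0

lemma flatMetric_comm (α β : Fin (M + 1)) : flatMetric M α β = flatMetric M β α := by
  simp only [flatMetric, add_comm]

/-- `∂_α λ ∂_β λ - ∂_α ∂_β Fo ∂_s λ`. -/
def defect (v : Fin (M + 1) → Poly (M + 1)) (α β : Fin (M + 1)) : Laurent (M + 1) :=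
  dt α (ds (openPot v)) * dt β (ds (openPot v)) - dt α (dt β (openPot v)) * ds (ds (openPot v))

lemma defect_comm (v : Fin (M + 1) → Poly (M + 1)) (α β : Fin (M + 1)) :
    defect v α β = defect v β α := by
  rw [defect, defect, dt_comm, mul_comm (dt α (ds _))]

lemma defect_castSucc_castSucc (a b : Fin M) :
    defect (flatParam w) a.castSucc b.castSucc = Polynomial.toLaurent (residual w a b) -
      Polynomial.toLaurent (oddPoly fun k => pderiv a.castSucc (pderiv b.castSucc (w k))) *
        (LaurentPolynomial.C (X (Fin.last M) ^ 2) * LaurentPolynomial.T (-3)) := by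
  rw [defect, dt_castSucc_ds_openPot, dt_castSucc_ds_openPot, dt_castSucc_openPot, dt_toLaurent,
    polyDt_oddPoly, ds_ds_openPot, residual, map_sub, map_mul, map_mul, flatParam_last]
  simp only [flatParam_castSucc]
  ring

lemma defect_last_castSucc (hw : IsFlatParam w) (b : Fin M) :
    defect (flatParam w) (Fin.last M) b.castSucc =
      -(LaurentPolynomial.C (X (Fin.last M)) * LaurentPolynomial.T (-2) *
        Polynomial.toLaurent (evenPoly fun k => pderiv b.castSucc (w k))) := by
  rw [defect, dt_last_ds_openPot hw, dt_castSucc_ds_openPot, dt_comm, dt_last_openPot hw,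
    dt_C_mul_T, pderiv_X_of_ne (Fin.castSucc_lt_last b).ne', laurent_neg_mul]
  simp

/-- The two contributions v_N² s^{-4}, one from (∂_N λ)² and one from the polar part of ∂_s λ,
cancel. -/
lemma defect_last_last (hw : IsFlatParam w) :
    defect (flatParam w) (Fin.last M) (Fin.last M) =
      -(LaurentPolynomial.T (-1) * Polynomial.toLaurent (superpot w).derivative) := by
  rw [defect, dt_last_ds_openPot hw, dt_last_openPot hw, dt_C_mul_T, pderiv_X_self, ds_ds_openPot,
    laurent_neg_mul_neg, C_mul_T_mul, flatParam_last, map_one, one_mul, mul_add]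
  have h : (LaurentPolynomial.T (-1) * (LaurentPolynomial.C (X (Fin.last M) ^ 2) *
      LaurentPolynomial.T (-3)) : Laurent (M + 1)) =
      LaurentPolynomial.C (X (Fin.last M) * X (Fin.last M)) * LaurentPolynomial.T (-2 + -2) := by
    rw [mul_left_comm, ← LaurentPolynomial.T_add, sq]
    rfl
  rw [h]
  simp

/-- The window [-2, 2M-2] is the one occupied by the restrictions of the φ_i to the curve, and the
top coefficient will be that of φ_{N-1}, that is, the metric. The two polynomial directions rest on
`residual_spec`; the direction of t^N is explicit. -/
lemma defect_spec (hM : M ≠ 0) (hw : IsFlatParam w) (α β : Fin (M + 1)) :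
    defect (flatParam w) α β ∈ degLE (M + 1) (2 * M - 2) ∧
    defect (flatParam w) α β ∈ degGE (M + 1) (-2) ∧
    (defect (flatParam w) α β).coeff (2 * M - 2) =
      C (1 / 2 ^ (M - 1) : ℂ) * C (flatMetric M α β) := by
  have hcast : (2 * (M : ℤ) - 2) = (2 * M - 2 : ℕ) := by omega
  have hmixed : ∀ b : Fin M, defect (flatParam w) (Fin.last M) b.castSucc ∈
      degLE (M + 1) (2 * M - 4) ∧
      defect (flatParam w) (Fin.last M) b.castSucc ∈ degGE (M + 1) (-2) := by
    intro b
    rw [defect_last_castSucc hw]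
    constructor
    · refine Submodule.neg_mem _ (degLE_mono (by omega) (mul_mem_degLE
        (C_mul_T_mem_degLE _ (le_refl (-2))) (toLaurent_mem_degLE (d := 2 * M - 2) fun n hn => ?_)))
      exact coeff_evenPoly_of_le _ _ (by omega)
    · exact Submodule.neg_mem _ (degGE_mono (by simp) (mul_mem_degGE
        (C_mul_T_mem_degGE _ (le_refl (-2))) (toLaurent_mem_degGE (d := 0) (by simp))))
  induction α using Fin.lastCases with
  | last =>
    induction β using Fin.lastCases with
    | last =>
      rw [defect_last_last hw]
      have h1 : Polynomial.toLaurent (superpot w).derivative ∈ degLE (M + 1) (2 * M - 1) :=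
        toLaurent_mem_degLE fun n hn => coeff_derivative_superpot w n (by omega)
      have h2 := mul_mem_degLE (T_mem_degLE (N := M + 1) (le_refl (-1))) h1
      have h3 := coeff_mul_top (T_mem_degLE (N := M + 1) (le_refl (-1))) h1
      rw [show (-1 + (2 * M - 1) : ℤ) = 2 * M - 2 by ring] at h2 h3
      refine ⟨Submodule.neg_mem _ h2, Submodule.neg_mem _ (degGE_mono (d := -1 + (0 : ℕ)) (by simp)
        (mul_mem_degGE ?_ (toLaurent_mem_degGE (by simp)))), ?_⟩
      · simpa using C_mul_T_mem_degGE (N := M + 1) 1 (le_refl (-1))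
      · rw [AddMonoidAlgebra.coeff_neg, Finsupp.neg_apply, h3,
          show (2 * M - 1 : ℤ) = (2 * M - 1 : ℕ) by omega, coeff_toLaurent_natCast,
          coeff_derivative_superpot_top hM, flatMetric, if_neg (by simp; omega),
          if_pos (by simp; omega)]
        simp
    | cast b =>
      obtain ⟨h1, h2⟩ := hmixed b
      refine ⟨degLE_mono (by omega) h1, h2, ?_⟩
      rw [h1 _ (by omega), flatMetric, if_neg (by simp; omega), if_neg (by simp; omega)]
      simp
  | cast a =>
    induction β using Fin.lastCases with
    | last =>
      obtain ⟨h1, h2⟩ := hmixed a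
      rw [defect_comm]
      refine ⟨degLE_mono (by omega) h1, h2, ?_⟩
      rw [h1 _ (by omega), flatMetric, if_neg (by simp; omega), if_neg (by simp; omega)]
      simp
    | cast b =>
      obtain ⟨h1, h2⟩ := residual_spec hM hw a b
      rw [defect_castSucc_castSucc]
      have h3 : Polynomial.toLaurent (oddPoly fun k =>
          pderiv a.castSucc (pderiv b.castSucc (w k))) *
        (LaurentPolynomial.C (X (Fin.last M) ^ 2) * LaurentPolynomial.T (-3)) ∈
          degLE (M + 1) (2 * M - 4) := degLE_mono (by omega) (mul_mem_degLE
        (toLaurent_mem_degLE (d := 2 * M - 1) fun n hn => coeff_oddPoly_of_lt _ _ (by omega))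
        (C_mul_T_mem_degLE _ (le_refl (-3))))
      -- An odd polynomial starts at s^1, so its product with s^{-3} stays at exponents at least -2.
      have h4 : Polynomial.toLaurent (oddPoly fun k =>
          pderiv a.castSucc (pderiv b.castSucc (w k))) *
        (LaurentPolynomial.C (X (Fin.last M) ^ 2) * LaurentPolynomial.T (-3)) ∈
          degGE (M + 1) (-2) := degGE_mono (by simp) (mul_mem_degGE
        (toLaurent_mem_degGE (d := 1) fun n hn => by
          rw [show n = 0 by omega, coeff_oddPoly_zero])
        (C_mul_T_mem_degGE _ (le_refl (-3))))
      refine ⟨Submodule.sub_mem _ (toLaurent_mem_degLE fun n hn => h1 n (by omega))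
        (degLE_mono (by omega) h3), Submodule.sub_mem _ (degGE_mono (d := (0 : ℕ)) (by simp)
          (toLaurent_mem_degGE (by simp))) h4, ?_⟩
      rw [AddMonoidAlgebra.coeff_sub, Finsupp.sub_apply, h3 _ (by omega), sub_zero, hcast,
        coeff_toLaurent_natCast, h2, flatMetric]
      congr 1
      simp only [Fin.val_castSucc]
      rw [if_neg (by omega : ¬ a.val + b.val = 2 * M)]
      split_ifs <;> simp

/-- The remainder of a division by `∂_s λ` is unique. -/
lemma eq_zero_of_mul_ds_ds_mem (hM : M ≠ 0) {v : Fin (M + 1) → Poly (M + 1)}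
    (hv : v (Fin.last M) ≠ 0) {q : Laurent (M + 1)}
    (h1 : q * ds (ds (openPot v)) ∈ degGE (M + 1) (-2))
    (h2 : q * ds (ds (openPot v)) ∈ degLE (M + 1) (2 * M - 2)) : q = 0 := by
  have hcast : (2 * M - 1 : ℤ) = (2 * M - 1 : ℕ) := by omega
  have h3 : Polynomial.toLaurent (superpot fun k : Fin M => v k.castSucc).derivative ∈
      degGE (M + 1) (0 : ℕ) := toLaurent_mem_degGE (by simp)
  -- The lowest coefficient of ∂_s λ is v_N², which is why v_N must be nonzero; the highest is
  -- 2^{-(M-1)}.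
  refine eq_zero_of_mul_mem (a := -3) (b := 2 * M - 1) (p := ds (ds (openPot v)))
    ?_ ?_ ?_ ?_ h1 (by convert h2 using 2; ring)
  · rw [ds_ds_openPot]
    exact Submodule.add_mem _ (degGE_mono (by simp) h3) (C_mul_T_mem_degGE _ le_rfl)
  · rw [ds_ds_openPot]
    exact Submodule.add_mem _ (toLaurent_mem_degLE fun n hn => coeff_derivative_superpot _ n
      (by omega)) (C_mul_T_mem_degLE _ (by omega))
  · rw [ds_ds_openPot, AddMonoidAlgebra.coeff_add, Finsupp.add_apply, h3 _ (by simp), zero_add,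
      coeff_C_mul_T, if_pos rfl]
    exact pow_ne_zero 2 hv
  · rw [ds_ds_openPot, AddMonoidAlgebra.coeff_add, Finsupp.add_apply, hcast,
      coeff_toLaurent_natCast, coeff_derivative_superpot_top hM, coeff_C_mul_T, if_neg (by omega),
      add_zero]
    simp

end Flat

end OpenPotential

/-! ### Restriction of the Jacobian ring to the curve ∂_yΛ = 0. -/

section Curve

lemma pderiv_aeval {N : ℕ} (v : Fin N → Poly N) (p : Poly N) (α : Fin N) :
    pderiv α (aeval v p) = ∑ k, aeval v (pderiv k p) * pderiv α (v k) := by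
  induction p using MvPolynomial.induction_on with
  | C a => simp
  | add p q hp hq => simp only [map_add, hp, hq, add_mul, Finset.sum_add_distrib]
  | mul_X p i hp =>
    simp only [map_mul, aeval_X, Derivation.leibniz, smul_eq_mul, map_add, hp, add_mul,
      Finset.sum_add_distrib, Finset.mul_sum]
    rw [Finset.sum_eq_single i (f := fun k => aeval v p * _ * _)]
    · rw [pderiv_X_self, map_one, mul_one]
      congr 1
      exact Finset.sum_congr rfl fun k _ => by ring
    · intro j _ hj; rw [pderiv_X_of_ne hj.symm]; simp
    · simp

section Jacobian

variable {N : ℕ} {t v : Fin N → Poly N}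

lemma jacobian_mul (h : ∀ i, aeval v (t i) = X i) (α γ : Fin N) :
    ∑ k, aeval v (pderiv k (t γ)) * pderiv α (v k) = if α = γ then 1 else 0 := by
  rw [← pderiv_aeval, h]
  split_ifs with h
  · rw [h, pderiv_X_self]
  · exact pderiv_X_of_ne (Ne.symm h)

/-- A one-sided inverse of a square matrix over a commutative ring is two-sided. -/
lemma jacobian_mul' (h : ∀ i, aeval v (t i) = X i) (k l : Fin N) :
    ∑ γ, pderiv γ (v k) * aeval v (pderiv l (t γ)) = if k = l then 1 else 0 := by
  have h1 : (Matrix.of fun γ k => aeval v (pderiv k (t γ))) *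
      (Matrix.of fun k α => pderiv α (v k)) = (1 : Matrix (Fin N) (Fin N) (Poly N)) := by
    ext γ α
    rw [Matrix.mul_apply, Matrix.one_apply]
    simp only [Matrix.of_apply]
    rw [jacobian_mul h]
    simp [eq_comm]
  have h2 := congrArg (fun A : Matrix (Fin N) (Fin N) (Poly N) => A k l) (mul_eq_one_comm.1 h1)
  beta_reduce at h2
  rwa [Matrix.mul_apply, Matrix.one_apply] at h2

end Jacobian

variable {M : ℕ}

/-- The restriction of `φ_i` to the curve `x = s^2 / 2`, `y = -v_N / s^2`. -/
def phiCurve (v : Fin (M + 1) → Poly (M + 1)) : Fin (M + 1) → Laurent (M + 1) :=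
  Fin.snoc (fun k : Fin M => LaurentPolynomial.C (C (1 / 2 ^ k.val : ℂ)) *
    LaurentPolynomial.T (2 * k.val))
    (-(LaurentPolynomial.C (v (Fin.last M)) * LaurentPolynomial.T (-2)))

lemma phiCurve_castSucc (v : Fin (M + 1) → Poly (M + 1)) (k : Fin M) :
    phiCurve v k.castSucc = LaurentPolynomial.C (C (1 / 2 ^ k.val : ℂ)) *
      LaurentPolynomial.T (2 * k.val) := by simp [phiCurve]

lemma phiCurve_last (v : Fin (M + 1) → Poly (M + 1)) : phiCurve v (Fin.last M) =
    -(LaurentPolynomial.C (v (Fin.last M)) * LaurentPolynomial.T (-2)) := by simp [phiCurve]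

/-- Evaluation at the parameters `v` and at the curve `x = s^2 / 2`, `y = -v_N / s^2`. -/
def curve (v : Fin (M + 1) → Poly (M + 1)) : PolyXY (M + 1) →+* Laurent (M + 1) :=
  eval₂Hom ((LaurentPolynomial.C : Poly (M + 1) →+* Laurent (M + 1)).comp
    (aeval v : Poly (M + 1) →ₐ[ℂ] Poly (M + 1)).toRingHom)
    ![LaurentPolynomial.C (C (1 / 2 : ℂ)) * LaurentPolynomial.T 2,
      -(LaurentPolynomial.C (v (Fin.last M)) * LaurentPolynomial.T (-2))]

variable (v : Fin (M + 1) → Poly (M + 1))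

lemma curve_C (a : Poly (M + 1)) : curve v (C a) = LaurentPolynomial.C (aeval v a) := by
  simp [curve]

lemma curve_C_C (a : ℂ) : curve v (C (C a)) = LaurentPolynomial.C (C a) := by
  rw [curve_C, aeval_C]; rfl

lemma curve_x : curve v (x (M + 1)) =
    LaurentPolynomial.C (C (1 / 2 : ℂ)) * LaurentPolynomial.T 2 := by
  rw [curve, x, eval₂Hom_X']; rfl

lemma curve_y : curve v (y (M + 1)) =
    -(LaurentPolynomial.C (v (Fin.last M)) * LaurentPolynomial.T (-2)) := by
  rw [curve, y, eval₂Hom_X']; rfl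

lemma curve_x_pow (k : ℕ) : curve v (x (M + 1) ^ k) =
    LaurentPolynomial.C (C (1 / 2 ^ k : ℂ)) * LaurentPolynomial.T (2 * k) := by
  rw [map_pow, curve_x, mul_pow, ← map_pow, ← map_pow, LaurentPolynomial.T_pow, one_div_pow,
    mul_comm (k : ℤ)]

lemma curve_phi (i : Fin (M + 1)) : curve v (phi (M + 1) i) = phiCurve v i := by
  induction i using Fin.lastCases with
  | last => rw [phi, if_neg (by simp), curve_y, phiCurve_last]
  | cast k => rw [phi, if_pos (by simp), curve_x_pow, phiCurve_castSucc]; rfl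

lemma sum_mul_phiCurve (u : Fin (M + 1) → Poly (M + 1)) :
    ∑ i, LaurentPolynomial.C (u i) * phiCurve v i =
      Polynomial.toLaurent (evenPoly fun k : Fin M => u k.castSucc) -
        LaurentPolynomial.C (u (Fin.last M) * v (Fin.last M)) * LaurentPolynomial.T (-2) := by
  have h : ∀ k : Fin M, LaurentPolynomial.C (u k.castSucc) * phiCurve v k.castSucc =
      Polynomial.toLaurent (Polynomial.C ((1 / 2 ^ k.val : ℂ) • u k.castSucc) *
        Polynomial.X ^ (2 * k.val)) := by
    intro k
    rw [phiCurve_castSucc, Polynomial.toLaurent_C_mul_X_pow, smul_eq_C_mul, map_mul,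
      mul_left_comm, mul_assoc, Nat.cast_mul]
    rfl
  rw [Fin.sum_univ_castSucc, phiCurve_last, evenPoly, map_sum, map_mul,
    Finset.sum_congr rfl fun k _ => h k]
  generalize (∑ k : Fin M, Polynomial.toLaurent (Polynomial.C ((1 / 2 ^ k.val : ℂ) •
    u k.castSucc) * Polynomial.X ^ (2 * k.val))) = A
  ring

/-- The curve itself moves with v_N, but only in the y-direction, along which Λ is stationary; so
differentiating λ sees only the explicit parameters of Λ. -/
lemma dt_ds_openPot_eq_sum (α : Fin (M + 1)) : dt α (ds (openPot v)) =
    ∑ i, LaurentPolynomial.C (pderiv α (v i)) * phiCurve v i := by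
  rw [sum_mul_phiCurve, dt_ds_openPot, mul_comm (v (Fin.last M))]

/-- For the polar part, x y² contributes v_N²/(2s²) and v_N y contributes -v_N²/s². -/
lemma curve_unfolding : curve v (unfolding (M + 1)) = ds (openPot v) := by
  have h1 : curve v (∑ i, C (X i) * phi (M + 1) i) =
      ∑ i, LaurentPolynomial.C (v i) * phiCurve v i := by
    rw [map_sum]
    refine Finset.sum_congr rfl fun i _ => ?_
    rw [map_mul, curve_phi, curve_C, aeval_X]
  rw [unfolding, map_add, h1, sum_mul_phiCurve, ds_openPot, superpot, singularity, map_add,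
    map_mul, map_mul, curve_C_C, Nat.add_sub_cancel, curve_x_pow, map_pow, curve_x, curve_y,
    map_add, Polynomial.toLaurent_C_mul_X_pow, leadCoeff]
  have h2 : (LaurentPolynomial.C (C (1 / 2 : ℂ)) * LaurentPolynomial.T 2 *
      (-(LaurentPolynomial.C (v (Fin.last M)) * LaurentPolynomial.T (-2))) ^ 2 :
        Laurent (M + 1)) =
      LaurentPolynomial.C ((1 / 2 : ℂ) • v (Fin.last M) ^ 2) * LaurentPolynomial.T (-2) := by
    have e : (LaurentPolynomial.T (-2) : Laurent (M + 1)) =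
        LaurentPolynomial.T 2 * (LaurentPolynomial.T (-2) * LaurentPolynomial.T (-2)) := by
      rw [← LaurentPolynomial.T_add, ← LaurentPolynomial.T_add]; rfl
    rw [smul_eq_C_mul, map_mul, map_pow]
    conv_rhs => rw [e]
    ring
  have h3 : (LaurentPolynomial.C (v (Fin.last M) * v (Fin.last M)) * LaurentPolynomial.T (-2) :
      Laurent (M + 1)) =
      LaurentPolynomial.C ((1 / 2 : ℂ) • v (Fin.last M) ^ 2) * LaurentPolynomial.T (-2) +
      LaurentPolynomial.C ((1 / 2 : ℂ) • v (Fin.last M) ^ 2) * LaurentPolynomial.T (-2) := by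
    rw [← add_mul, ← map_add, ← add_smul, ← sq]
    norm_num
  have h4 : (LaurentPolynomial.C (C (1 / (((M + 1 : ℕ) : ℂ) - 1))) *
      (LaurentPolynomial.C (C (1 / 2 ^ M)) * LaurentPolynomial.T (2 * M)) : Laurent (M + 1)) =
      LaurentPolynomial.C (C (1 / (2 ^ M * (M : ℂ)))) * LaurentPolynomial.T ((2 * M : ℕ) : ℤ) := by
    rw [← mul_assoc, ← map_mul, ← C_mul]
    push_cast
    rw [add_sub_cancel_right, one_div_mul_one_div_rev]
  rw [h2, h3, h4]
  ring

lemma pderiv_one_unfolding : pderiv 1 (unfolding (M + 1)) =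
    C (C 2) * (x (M + 1) * y (M + 1)) + C (X (Fin.last M)) := by
  have h1 : pderiv 1 (∑ i, C (X i) * phi (M + 1) i) = C (X (Fin.last M)) := by
    rw [map_sum, Finset.sum_eq_single (Fin.last M)]
    · rw [pderiv_C_mul, phi, if_neg (by simp), y, pderiv_X_self, mul_one]
    · intro i _ hi
      have : i.val + 1 < M + 1 := by
        have := Fin.val_lt_last hi
        omega
      rw [pderiv_C_mul, phi, if_pos this, x, pderiv_pow, pderiv_X_of_ne (by decide)]
      simp
    · simp
  have h2 : pderiv 1 (singularity (M + 1)) = C (C 2) * (x (M + 1) * y (M + 1)) := by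
    rw [singularity, map_add, pderiv_C_mul, pderiv_mul, pderiv_pow, pderiv_pow, x, y,
      pderiv_X_of_ne (by decide), pderiv_X_self, map_ofNat (C : ℂ →+* Poly (M + 1)) 2,
      map_ofNat (C : Poly (M + 1) →+* PolyXY (M + 1)) 2]
    push_cast
    ring
  rw [unfolding, map_add, h1, h2]

lemma curve_pderiv_one : curve v (pderiv 1 (unfolding (M + 1))) = 0 := by
  rw [pderiv_one_unfolding, map_add, map_mul, map_mul, curve_x, curve_y, curve_C_C, curve_C,
    aeval_X]
  have e : (LaurentPolynomial.T 2 * LaurentPolynomial.T (-2) : Laurent (M + 1)) = 1 := by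
    rw [← LaurentPolynomial.T_add]; rfl
  have e2 : (LaurentPolynomial.C (C 2) * LaurentPolynomial.C (C (1 / 2 : ℂ)) :
      Laurent (M + 1)) = 1 := by
    rw [← map_mul, ← C_mul]; norm_num
  linear_combination -LaurentPolynomial.C (v (Fin.last M)) * e -
    LaurentPolynomial.T 2 * LaurentPolynomial.T (-2) * LaurentPolynomial.C (v (Fin.last M)) * e2

lemma ds_curve (f : PolyXY (M + 1)) : ds (curve v f) =
    curve v (pderiv 0 f) * ds (curve v (x (M + 1))) +
      curve v (pderiv 1 f) * ds (curve v (y (M + 1))) := by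
  induction f using MvPolynomial.induction_on with
  | C a => rw [curve_C, ds_C, pderiv_C, pderiv_C]; simp
  | add p q hp hq => simp only [map_add, ds_add, hp, hq]; ring
  | mul_X p i hp =>
    rw [map_mul, ds_mul, hp, pderiv_mul, pderiv_mul]
    fin_cases i
    · have e : pderiv (R := Poly (M + 1)) (1 : Fin 2) (X (0 : Fin 2)) = 0 :=
        pderiv_X_of_ne (by decide)
      simp only [Fin.zero_eta, e, pderiv_X_self, x, y, map_add, map_mul, map_one, map_zero, mul_zero]
      ring
    · have e : pderiv (R := Poly (M + 1)) (0 : Fin 2) (X (1 : Fin 2)) = 0 :=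
        pderiv_X_of_ne (by decide)
      simp only [Fin.mk_one, e, pderiv_X_self, x, y, map_add, map_mul, map_one, map_zero, mul_zero]
      ring

/-- By the chain rule along the curve: ∂_yΛ vanishes there, and the derivative of x = s²/2 is s. -/
lemma ds_ds_openPot_eq_curve :
    ds (ds (openPot v)) = curve v (pderiv 0 (unfolding (M + 1))) * LaurentPolynomial.T 1 := by
  have e : (LaurentPolynomial.C (((2 : ℤ) : ℂ) • C (1 / 2 : ℂ)) : Laurent (M + 1)) = 1 := by
    rw [smul_eq_C_mul, ← C_mul]; norm_num
  rw [← curve_unfolding, ds_curve, curve_pderiv_one, zero_mul, add_zero, curve_x, ds_C_mul_T, e,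
    one_mul]
  rfl

/-- Relations in the Jacobian ring restrict to the curve modulo `∂_s λ`. -/
lemma exists_curve_eq {f : PolyXY (M + 1)} (hf : f ∈ jacobianIdeal (M + 1)) :
    ∃ q, curve v f = q * ds (ds (openPot v)) := by
  obtain ⟨a, b, rfl⟩ := Ideal.mem_span_pair.1 hf
  refine ⟨curve v a * LaurentPolynomial.T (-1), ?_⟩
  have e : (LaurentPolynomial.T (-1) * LaurentPolynomial.T 1 : Laurent (M + 1)) = 1 := by
    rw [← LaurentPolynomial.T_add]; rfl
  rw [map_add, map_mul, map_mul, curve_pderiv_one, mul_zero, add_zero, ds_ds_openPot_eq_curve]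
  linear_combination -curve v a * curve v (pderiv 0 (unfolding (M + 1))) * e

/-- The multiplication of the classes `[φ_i]` has the structure constants `c`. -/
def IsStructureConstants {N : ℕ} (c : Fin N → Fin N → Fin N → Poly N) : Prop :=
  ∀ i j, phiClass N i * phiClass N j = ∑ k, c i j k • phiClass N k

variable {c : Fin (M + 1) → Fin (M + 1) → Fin (M + 1) → Poly (M + 1)}

lemma exists_phiCurve_mul (hc : IsStructureConstants c) (i j : Fin (M + 1)) :
    ∃ q, phiCurve v i * phiCurve v j =
      ∑ k, LaurentPolynomial.C (aeval v (c i j k)) * phiCurve v k +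
        q * ds (ds (openPot v)) := by
  have h : phi (M + 1) i * phi (M + 1) j - ∑ k, C (c i j k) * phi (M + 1) k ∈
      jacobianIdeal (M + 1) := by
    rw [← Ideal.Quotient.eq, map_mul, map_sum]
    refine (hc i j).trans (Finset.sum_congr rfl fun k _ => ?_)
    rw [← smul_eq_C_mul]
    rfl
  obtain ⟨q, hq⟩ := exists_curve_eq v h
  refine ⟨q, ?_⟩
  rw [← hq, map_sub, map_mul, map_sum, curve_phi, curve_phi]
  simp only [map_mul, curve_phi, curve_C]
  ring

/-- The components of `∂/∂t^α ∘ ∂/∂t^β` in the basis `∂/∂v_k`. -/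
def mixedConst {N : ℕ} (c : Fin N → Fin N → Fin N → Poly N) (v : Fin N → Poly N)
    (α β k : Fin N) : Poly N :=
  ∑ i, ∑ j, pderiv α (v i) * pderiv β (v j) * aeval v (c i j k)

lemma exists_dt_mul_dt (hc : IsStructureConstants c) (α β : Fin (M + 1)) :
    ∃ q, dt α (ds (openPot v)) * dt β (ds (openPot v)) =
      ∑ k, LaurentPolynomial.C (mixedConst c v α β k) * phiCurve v k +
        q * ds (ds (openPot v)) := by
  choose q hq using exists_phiCurve_mul v hc
  refine ⟨∑ i, ∑ j, LaurentPolynomial.C (pderiv α (v i)) * LaurentPolynomial.C (pderiv β (v j)) *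
    q i j, ?_⟩
  rw [dt_ds_openPot_eq_sum, dt_ds_openPot_eq_sum, Finset.sum_mul_sum]
  have h : ∑ k, LaurentPolynomial.C (mixedConst c v α β k) * phiCurve v k =
      ∑ i, ∑ j, LaurentPolynomial.C (pderiv α (v i)) * LaurentPolynomial.C (pderiv β (v j)) *
        ∑ k, LaurentPolynomial.C (aeval v (c i j k)) * phiCurve v k := by
    simp only [mixedConst, map_sum, map_mul, Finset.sum_mul, Finset.mul_sum]
    rw [Finset.sum_comm]
    refine Finset.sum_congr rfl fun i _ => ?_
    rw [Finset.sum_comm]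
    exact Finset.sum_congr rfl fun j _ => Finset.sum_congr rfl fun k _ => by ring
  rw [h, Finset.sum_mul, ← Finset.sum_add_distrib]
  refine Finset.sum_congr rfl fun i _ => ?_
  rw [Finset.sum_mul, ← Finset.sum_add_distrib]
  refine Finset.sum_congr rfl fun j _ => ?_
  rw [mul_assoc (_ * _), ← mul_add, ← hq]
  ring

lemma sum_mul_phiCurve_mem (u : Fin (M + 1) → Poly (M + 1)) :
    ∑ i, LaurentPolynomial.C (u i) * phiCurve v i ∈ degGE (M + 1) (-2) ∧
      (M ≠ 0 → ∑ i, LaurentPolynomial.C (u i) * phiCurve v i ∈ degLE (M + 1) (2 * M - 2)) := by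
  rw [sum_mul_phiCurve]
  constructor
  · exact Submodule.sub_mem _ (degGE_mono (d := (0 : ℕ)) (by simp) (toLaurent_mem_degGE (by simp)))
      (C_mul_T_mem_degGE _ le_rfl)
  · intro hM
    exact Submodule.sub_mem _ (toLaurent_mem_degLE fun n hn => coeff_evenPoly_of_le _ _ (by omega))
      (C_mul_T_mem_degLE _ (by omega))

lemma coeff_sum_mul_phiCurve (u : Fin (M + 1) → Poly (M + 1)) (k : Fin M) :
    (∑ i, LaurentPolynomial.C (u i) * phiCurve v i).coeff (2 * k.val) =
      C (1 / 2 ^ k.val : ℂ) * u k.castSucc := by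
  rw [sum_mul_phiCurve, AddMonoidAlgebra.coeff_sub, Finsupp.sub_apply, coeff_C_mul_T,
    if_neg (by omega), sub_zero, show (2 * k.val : ℤ) = (2 * k.val : ℕ) by push_cast; rfl,
    coeff_toLaurent_natCast, coeff_evenPoly, smul_eq_C_mul]

/-- The restricted φ_i are monomials in s with the distinct exponents 0, 2, …, 2M-2 and -2; the last
has coefficient -v_N. -/
lemma eq_zero_of_sum_mul_phiCurve (hv : v (Fin.last M) ≠ 0) {u : Fin (M + 1) → Poly (M + 1)}
    (h : ∑ i, LaurentPolynomial.C (u i) * phiCurve v i = 0) (i : Fin (M + 1)) : u i = 0 := by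
  induction i using Fin.lastCases with
  | last =>
    have h1 : (∑ i, LaurentPolynomial.C (u i) * phiCurve v i).coeff (-2) =
        (0 : Laurent (M + 1)).coeff (-2) := by rw [h]
    have h2 : Polynomial.toLaurent (evenPoly fun k : Fin M => u k.castSucc) ∈
      degGE (M + 1) (0 : ℕ) := toLaurent_mem_degGE (by simp)
    rw [sum_mul_phiCurve, AddMonoidAlgebra.coeff_sub, Finsupp.sub_apply, coeff_C_mul_T,
      if_pos rfl, h2 _ (by simp), zero_sub, AddMonoidAlgebra.coeff_zero, Finsupp.zero_apply,
      neg_eq_zero] at h1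
    exact (mul_eq_zero.1 h1).resolve_right hv
  | cast k =>
    have h1 := coeff_sum_mul_phiCurve v u k
    rw [h, AddMonoidAlgebra.coeff_zero, Finsupp.zero_apply] at h1
    exact (mul_eq_zero.1 h1.symm).resolve_left (by simp)

variable {w : Fin M → Poly (M + 1)}

/-- Both sides are remainders of ∂_αλ ∂_βλ modulo ∂_s λ with exponents in [-2, 2M-2]. Such
remainders are unique, so the quotient coming from the Jacobian ring is ∂_α∂_β F^o. -/
lemma defect_eq_sum (hM : M ≠ 0) (hw : IsFlatParam w) (hc : IsStructureConstants c)
    (α β : Fin (M + 1)) :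
    defect (flatParam w) α β =
      ∑ k, LaurentPolynomial.C (mixedConst c (flatParam w) α β k) * phiCurve (flatParam w) k := by
  obtain ⟨q, hq⟩ := exists_dt_mul_dt (flatParam w) hc α β
  obtain ⟨h1, h2, -⟩ := defect_spec hM hw α β
  obtain ⟨h3, h4⟩ := sum_mul_phiCurve_mem (flatParam w) (mixedConst c (flatParam w) α β)
  have h5 : (q - dt α (dt β (openPot (flatParam w)))) * ds (ds (openPot (flatParam w))) =
      defect (flatParam w) α β -
      ∑ k, LaurentPolynomial.C (mixedConst c (flatParam w) α β k) * phiCurve (flatParam w) k := by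
    rw [defect, hq]
    ring
  have h6 := eq_zero_of_mul_ds_ds_mem hM (v := flatParam w) (by rw [flatParam_last]; exact X_ne_zero _)
    (h5 ▸ Submodule.sub_mem _ h2 h3) (h5 ▸ Submodule.sub_mem _ h1 (h4 hM))
  rw [h6, zero_mul] at h5
  exact sub_eq_zero.1 h5.symm

/-- The metric is constant in flat coordinates. -/
lemma mixedConst_eq_flatMetric (hM : M ≠ 0) (hw : IsFlatParam w) (hc : IsStructureConstants c)
    (α β : Fin (M + 1)) :
    mixedConst c (flatParam w) α β (Fin.castSucc ⟨M - 1, by omega⟩) = C (flatMetric M α β) := by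
  have h1 := (defect_spec hM hw α β).2.2
  have h2 := coeff_sum_mul_phiCurve (flatParam w) (mixedConst c (flatParam w) α β)
    ⟨M - 1, by omega⟩
  rw [← defect_eq_sum hM hw hc, show (2 * (M - 1 : ℕ) : ℤ) = 2 * M - 2 by omega, h1] at h2
  exact (mul_left_cancel₀ (by simp) h2).symm

end Curve

/-! ### The φ_i span the Jacobian ring over the parameters. -/

section StructureConstants

variable {M : ℕ}

lemma pderiv_zero_unfolding (hM : M ≠ 0) : pderiv 0 (unfolding (M + 1)) =
    x (M + 1) ^ (M - 1) + y (M + 1) ^ 2 +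
      ∑ k : Fin M, C ((k.val : Poly (M + 1)) * X k.castSucc) * x (M + 1) ^ (k.val - 1) := by
  have hM' : (M : ℂ) ≠ 0 := by exact_mod_cast hM
  have h1 : pderiv 0 (∑ i, C (X i) * phi (M + 1) i) =
      ∑ k : Fin M, C ((k.val : Poly (M + 1)) * X k.castSucc) * x (M + 1) ^ (k.val - 1) := by
    rw [map_sum, Fin.sum_univ_castSucc, pderiv_C_mul, phi, if_neg (by simp), y,
      pderiv_X_of_ne (by decide), mul_zero, add_zero]
    refine Finset.sum_congr rfl fun k _ => ?_
    rw [pderiv_C_mul, phi, if_pos (by simp), x, pderiv_pow, pderiv_X_self, map_mul, map_natCast]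
    simp only [Fin.val_castSucc]
    ring
  have h2 : pderiv 0 (singularity (M + 1)) = x (M + 1) ^ (M - 1) + y (M + 1) ^ 2 := by
    rw [singularity, map_add, pderiv_C_mul, pderiv_mul, pderiv_pow, pderiv_pow, x, y,
      pderiv_X_of_ne (by decide : (1 : Fin 2) ≠ 0), pderiv_X_self, Nat.add_sub_cancel]
    have e : (C (C (1 / (((M + 1 : ℕ) : ℂ) - 1))) : PolyXY (M + 1)) * (M : PolyXY (M + 1)) = 1 := by
      rw [← map_natCast (C : Poly (M + 1) →+* PolyXY (M + 1)),
        ← map_natCast (C : ℂ →+* Poly (M + 1)), ← C_mul, ← C_mul]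
      push_cast
      rw [add_sub_cancel_right, one_div_mul_cancel hM', C_1, C_1]
    linear_combination X 0 ^ (M - 1) * e
  rw [unfolding, map_add, h1, h2]

lemma jacobian_mul_left_comm (a b c : JacobianRing (M + 1)) : a * (b * c) = b * (a * c) := by
  ring

lemma jacobian_neg_mul (a b : JacobianRing (M + 1)) : -a * b = -(a * b) := by ring

/-- The class of a polynomial in the unfolding parameters. -/
def paramClass (M : ℕ) : Poly (M + 1) →+* JacobianRing (M + 1) :=
  (Ideal.Quotient.mk (jacobianIdeal (M + 1))).comp C

lemma mk_C (a : Poly (M + 1)) :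
    Ideal.Quotient.mk (jacobianIdeal (M + 1)) (C a) = paramClass M a := rfl

/-- The combinations of the classes `[φ_i]` with coefficients in `ℂ[v_1, …, v_N]`. -/
def phiSpan (M : ℕ) : AddSubgroup (JacobianRing (M + 1)) where
  carrier := {z | ∃ c : Fin (M + 1) → Poly (M + 1),
    z = ∑ k, paramClass M (c k) * phiClass (M + 1) k}
  add_mem' := by
    rintro _ _ ⟨c, rfl⟩ ⟨d, rfl⟩
    exact ⟨c + d, by simp only [Pi.add_apply, map_add, add_mul, Finset.sum_add_distrib]⟩
  zero_mem' := ⟨0, by simp only [Pi.zero_apply, map_zero, zero_mul, Finset.sum_const_zero]⟩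
  neg_mem' := by
    rintro _ ⟨c, rfl⟩
    refine ⟨fun k => -1 * c k, ?_⟩
    simp only [map_mul (paramClass M), mul_assoc, ← Finset.mul_sum]
    rw [map_neg, map_one]
    ring

lemma paramClass_mul_mem (a : Poly (M + 1)) {z : JacobianRing (M + 1)} (hz : z ∈ phiSpan M) :
    paramClass M a * z ∈ phiSpan M := by
  obtain ⟨c, rfl⟩ := hz
  exact ⟨fun k => a * c k, by simp only [Finset.mul_sum, map_mul, mul_assoc]⟩

lemma phiClass_mem (i : Fin (M + 1)) : phiClass (M + 1) i ∈ phiSpan M := by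
  refine ⟨Pi.single i 1, ?_⟩
  rw [Finset.sum_eq_single i]
  · rw [Pi.single_eq_same, map_one, one_mul]
  · intro j _ hj; rw [Pi.single_eq_of_ne hj, map_zero, zero_mul]
  · intro h; exact absurd (Finset.mem_univ i) h

/-- The class of `x`. -/
def xClass (M : ℕ) : JacobianRing (M + 1) := Ideal.Quotient.mk _ (x (M + 1))

/-- The class of `y`. -/
def yClass (M : ℕ) : JacobianRing (M + 1) := Ideal.Quotient.mk _ (y (M + 1))

lemma phiClass_castSucc (k : Fin M) : phiClass (M + 1) k.castSucc = xClass M ^ k.val := by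
  rw [phiClass, phi, if_pos (by simp), map_pow]; rfl

lemma phiClass_last : phiClass (M + 1) (Fin.last M) = yClass M := by
  rw [phiClass, phi, if_neg (by simp)]; rfl

lemma xClass_pow_mem {k : ℕ} (h : k < M) : xClass M ^ k ∈ phiSpan M := by
  have := phiClass_mem (⟨k, h⟩ : Fin M).castSucc
  rwa [phiClass_castSucc] at this

lemma yClass_mem : yClass M ∈ phiSpan M := by
  have := phiClass_mem (Fin.last M)
  rwa [phiClass_last] at this

lemma xClass_mul_yClass :
    xClass M * yClass M = -paramClass M (C (1 / 2 : ℂ) * X (Fin.last M)) := by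
  have h : pderiv 1 (unfolding (M + 1)) ∈ jacobianIdeal (M + 1) := Ideal.subset_span (by simp)
  rw [← Ideal.Quotient.eq_zero_iff_mem, pderiv_one_unfolding, map_add, map_mul, map_mul, mk_C,
    mk_C] at h
  have e : paramClass M (C (1 / 2 : ℂ)) * paramClass M (C 2) = 1 := by
    rw [← map_mul, ← C_mul, show (1 / 2 * 2 : ℂ) = 1 by norm_num, C_1, map_one]
  rw [map_mul]
  change paramClass M (C 2) * (xClass M * yClass M) + _ = 0 at h
  linear_combination paramClass M (C (1 / 2 : ℂ)) * h - xClass M * yClass M * e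

lemma yClass_sq (hM : M ≠ 0) : yClass M ^ 2 = -(xClass M ^ (M - 1) +
    ∑ k : Fin M, paramClass M ((k.val : Poly (M + 1)) * X k.castSucc) *
      xClass M ^ (k.val - 1)) := by
  have h : pderiv 0 (unfolding (M + 1)) ∈ jacobianIdeal (M + 1) := Ideal.subset_span (by simp)
  rw [← Ideal.Quotient.eq_zero_iff_mem, pderiv_zero_unfolding hM, map_add, map_add, map_pow,
    map_pow, map_sum] at h
  simp only [map_mul (Ideal.Quotient.mk _), mk_C, map_pow] at h
  change xClass M ^ (M - 1) + yClass M ^ 2 + ∑ k : Fin M,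
    paramClass M ((k.val : Poly (M + 1)) * X k.castSucc) * xClass M ^ (k.val - 1) = 0 at h
  linear_combination h

lemma yClass_sq_mem (hM : M ≠ 0) : yClass M ^ 2 ∈ phiSpan M := by
  rw [yClass_sq hM]
  exact neg_mem (add_mem (xClass_pow_mem (by omega))
    (sum_mem fun k _ => paramClass_mul_mem _ (xClass_pow_mem (by omega))))

/-- Multiply the relation ∂_xΛ = 0 by x and replace x y² = y (x y) by -v_N y/2. -/
lemma xClass_pow_M_mem (hM : M ≠ 0) : xClass M ^ M ∈ phiSpan M := by
  have h2 : xClass M * xClass M ^ (M - 1) = xClass M ^ M := by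
    rw [← pow_succ', Nat.sub_add_cancel (by omega)]
  have h3 : xClass M * ∑ k : Fin M, paramClass M ((k.val : Poly (M + 1)) * X k.castSucc) *
      xClass M ^ (k.val - 1) =
      ∑ k : Fin M, paramClass M ((k.val : Poly (M + 1)) * X k.castSucc) * xClass M ^ k.val := by
    rw [Finset.mul_sum]
    refine Finset.sum_congr rfl fun k _ => ?_
    rw [jacobian_mul_left_comm, ← pow_succ']
    -- For k = 0 the truncated exponent k - 1 is harmless, since the coefficient k vanishes.
    rcases Nat.eq_zero_or_pos k.val with h | h
    · rw [h, Nat.cast_zero, zero_mul, map_zero, zero_mul, zero_mul]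
    · rw [Nat.sub_add_cancel h]
  have h : xClass M ^ M = paramClass M (C (1 / 2 : ℂ) * X (Fin.last M)) * yClass M -
      ∑ k : Fin M, paramClass M ((k.val : Poly (M + 1)) * X k.castSucc) * xClass M ^ k.val := by
    linear_combination xClass M * yClass_sq hM - h2 - h3 - yClass M * xClass_mul_yClass (M := M)
  rw [h]
  exact sub_mem (paramClass_mul_mem _ yClass_mem)
    (sum_mem fun k _ => paramClass_mul_mem _ (xClass_pow_mem k.isLt))

lemma mul_mem_phiSpan {a z : JacobianRing (M + 1)}
    (h : ∀ i, a * phiClass (M + 1) i ∈ phiSpan M) (hz : z ∈ phiSpan M) : a * z ∈ phiSpan M := by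
  obtain ⟨c, rfl⟩ := hz
  rw [Finset.mul_sum]
  refine sum_mem fun k _ => ?_
  rw [jacobian_mul_left_comm]
  exact paramClass_mul_mem _ (h k)

lemma xClass_mul_mem (hM : M ≠ 0) {z : JacobianRing (M + 1)} (hz : z ∈ phiSpan M) :
    xClass M * z ∈ phiSpan M := by
  refine mul_mem_phiSpan (fun i => ?_) hz
  induction i using Fin.lastCases with
  | last =>
    rw [phiClass_last, xClass_mul_yClass, ← mul_one (paramClass M _), ← pow_zero (xClass M)]
    exact neg_mem (paramClass_mul_mem _ (xClass_pow_mem (by omega)))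
  | cast k =>
    rw [phiClass_castSucc, ← pow_succ']
    rcases eq_or_ne (k.val + 1) M with h | h
    · rw [h]; exact xClass_pow_M_mem hM
    · exact xClass_pow_mem (by omega)

lemma yClass_mul_mem (hM : M ≠ 0) {z : JacobianRing (M + 1)} (hz : z ∈ phiSpan M) :
    yClass M * z ∈ phiSpan M := by
  refine mul_mem_phiSpan (fun i => ?_) hz
  induction i using Fin.lastCases with
  | last => rw [phiClass_last, ← sq]; exact yClass_sq_mem hM
  | cast k =>
    rw [phiClass_castSucc]
    rcases h : k.val with _ | n
    · rw [pow_zero, mul_one]; exact yClass_mem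
    · rw [pow_succ', ← mul_assoc, mul_comm (yClass M), xClass_mul_yClass, jacobian_neg_mul]
      exact neg_mem (paramClass_mul_mem _ (xClass_pow_mem (by omega)))

/-- The span of the [φ_i] is stable under multiplication by the classes of x and y, and every φ_i is
a monomial in them. -/
lemma exists_structureConstants (hM : M ≠ 0) :
    ∃ c : Fin (M + 1) → Fin (M + 1) → Fin (M + 1) → Poly (M + 1), IsStructureConstants c := by
  have h : ∀ i j, phiClass (M + 1) i * phiClass (M + 1) j ∈ phiSpan M := by
    intro i j
    induction i using Fin.lastCases with
    | last => rw [phiClass_last]; exact yClass_mul_mem hM (phiClass_mem j)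
    | cast k =>
      rw [phiClass_castSucc]
      induction k.val with
      | zero => rw [pow_zero, one_mul]; exact phiClass_mem j
      | succ n ih => rw [pow_succ', mul_assoc]; exact xClass_mul_mem hM ih
  choose c hc using h
  refine ⟨c, fun i j => (hc i j).trans (Finset.sum_congr rfl fun k _ => ?_)⟩
  rw [phiClass, ← mk_C, ← map_mul, ← smul_eq_C_mul]
  rfl

end StructureConstants

/-! ### Polynomial Poincaré lemma and existence of potentials. -/

section Poincare

variable {N : ℕ}

/-- A closed polynomial one-form has a primitive. -/
lemma exists_primitive (ω : Fin N → Poly N) (h : ∀ i j, pderiv i (ω j) = pderiv j (ω i)) :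
    ∃ f : Poly N, ∀ i, pderiv i f = ω i := by
  classical
  -- `J p` is the integral of p(τ t) over τ from 0 to 1, so the primitive below is the radial one, ∑
  -- t^i J(ω_i).
  let J : Poly N → Poly N := fun p =>
    ∑ m ∈ p.support, monomial m ((1 / ((m.degree : ℂ) + 1)) * coeff m p)
  have hJ : ∀ p m, coeff m (J p) = (1 / ((m.degree : ℂ) + 1)) * coeff m p := by
    intro p m
    simp only [J, coeff_sum, coeff_monomial, Finset.sum_ite_eq']
    split_ifs with hm
    · rfl
    · rw [notMem_support_iff.1 hm, mul_zero]
  refine ⟨∑ i, X i * J (ω i), fun j => ?_⟩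
  ext m
  have hd : ((m.degree : ℂ) + 1) ≠ 0 := Nat.cast_add_one_ne_zero _
  -- Closedness trades coefficients of ω_i for those of ω_j, with factor m_i + δ_{ij}. These factors
  -- add up to deg m + 1, which cancels the denominator of `J`.
  have key : ∀ i, coeff (m + Finsupp.single j 1) (X i * J (ω i)) * ((m j : ℂ) + 1) =
      (1 / ((m.degree : ℂ) + 1)) * (((m i : ℂ) + if i = j then 1 else 0) * coeff m (ω j)) := by
    intro i
    rw [coeff_X_mul']
    rcases eq_or_ne i j with rfl | hij
    · rw [if_pos (by simp), add_tsub_cancel_right, hJ, if_pos rfl]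
      ring
    · rw [if_neg hij, add_zero]
      by_cases hi : m i = 0
      · rw [if_neg (by simp [hi, Finsupp.single_eq_of_ne hij]), hi]
        simp
      · obtain ⟨n, rfl⟩ : ∃ n, m = n + Finsupp.single i 1 :=
          ⟨m - Finsupp.single i 1, (tsub_add_cancel_of_le (Finsupp.single_le_iff.2
            (Nat.one_le_iff_ne_zero.2 hi))).symm⟩
        have h1 := congrArg (coeff n) (h i j)
        rw [coeff_pderiv, coeff_pderiv] at h1
        rw [if_pos (by simp), add_right_comm, add_tsub_cancel_right, hJ, mul_assoc]
        have e1 : (n + Finsupp.single i 1 : Fin N →₀ ℕ) j = n j := by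
          simp [Finsupp.single_eq_of_ne hij.symm]
        have e2 : (((n + Finsupp.single i 1 : Fin N →₀ ℕ) i : ℕ) : ℂ) = n i + 1 := by simp
        rw [e1, e2, ← h1.symm.trans (mul_comm _ _)]
        simp [map_add]
  rw [coeff_pderiv, coeff_sum, Finset.sum_mul, Finset.sum_congr rfl fun i _ => key i,
    ← Finset.mul_sum, ← Finset.sum_mul, Finset.sum_add_distrib, Finset.sum_ite_eq',
    if_pos (Finset.mem_univ j), ← Nat.cast_sum, ← Finsupp.degree_eq_sum, ← mul_assoc,
    one_div_mul_cancel hd, one_mul]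

lemma eq_zero_of_pderiv_eq_zero {f : Poly N} (h : ∀ i, pderiv i f = 0)
    (h0 : constantCoeff f = 0) : f = 0 := by
  ext m
  rw [coeff_zero]
  by_cases hm : m = 0
  · rw [hm, ← constantCoeff_eq, h0]
  · obtain ⟨i, hi⟩ : ∃ i, m i ≠ 0 := by
      by_contra! hc
      exact hm (Finsupp.ext hc)
    have h1 := congrArg (coeff (m - Finsupp.single i 1)) (h i)
    rw [coeff_pderiv, tsub_add_cancel_of_le (Finsupp.single_le_iff.2
      (Nat.one_le_iff_ne_zero.2 hi)), coeff_zero] at h1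
    exact (mul_eq_zero.1 h1).resolve_right (Nat.cast_add_one_ne_zero _)

/-- A symmetric tensor with symmetric derivative is a third derivative. -/
lemma exists_potential (A : Fin N → Fin N → Fin N → Poly N) (h1 : ∀ a b c, A a b c = A b a c)
    (h2 : ∀ a b c, A a b c = A a c b)
    (h3 : ∀ d a b c, pderiv d (A a b c) = pderiv a (A d b c)) :
    ∃ F : Poly N, (∀ a b c, pderiv a (pderiv b (pderiv c F)) = A a b c) ∧
      ∀ m ∈ F.support, 3 ≤ m.degree := by
  classical
  choose g hg using fun b c => exists_primitive (fun a => A a b c) fun i j => h3 i j b c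
  -- Primitives are determined up to constants; dropping the constant terms makes them symmetric in
  -- the two indices.
  let g' : Fin N → Fin N → Poly N := fun b c => g b c - C (constantCoeff (g b c))
  have hg' : ∀ a b c, pderiv a (g' b c) = A a b c := fun a b c => by
    rw [map_sub, hg, pderiv_C, sub_zero]
  have hsymm : ∀ b c, g' b c = g' c b := fun b c => by
    rw [← sub_eq_zero]
    refine eq_zero_of_pderiv_eq_zero (fun a => ?_) ?_
    · rw [map_sub, hg', hg', h2, sub_self]
    · simp [g']
  choose k hk using fun c => exists_primitive (fun b => g' b c) fun i j => by
    rw [hg', hg', h1]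
  obtain ⟨F, hF⟩ := exists_primitive k fun i j => by rw [hk, hk, hsymm]
  have hF3 : ∀ a b c, pderiv a (pderiv b (pderiv c F)) = A a b c := fun a b c => by
    rw [hF, hk, hg']
  -- Monomials of degree below 3 are invisible to third derivatives and can be discarded.
  let G : Poly N := ∑ m ∈ F.support with 3 ≤ m.degree, monomial m (coeff m F)
  have hG : ∀ m, coeff m G = if 3 ≤ m.degree then coeff m F else 0 := by
    intro m
    simp only [G, coeff_sum, coeff_monomial, Finset.sum_ite_eq', Finset.mem_filter]
    by_cases hm : m ∈ F.support
    · simp [hm]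
    · rw [if_neg (fun h => hm h.1), notMem_support_iff.1 hm, ite_self]
  refine ⟨G, fun a b c => ?_, fun m hm => ?_⟩
  · rw [← hF3]
    ext m
    simp only [coeff_pderiv]
    rw [hG, if_pos]
    simp only [map_add, Finsupp.degree_single]
    omega
  · by_contra hc
    rw [mem_support_iff, hG, if_neg hc] at hm
    exact hm rfl

end Poincare

/-! ### Formal consequences of the product formula for λ. -/

section Associativity

variable {N : ℕ}

/-- `c` are the structure constants of a multiplication on tangent vectors for which
`∂_α λ ∂_β λ = ∑ c_{αβ}^μ ∂_μ λ + ∂_α ∂_β Fo ∂_s λ` with `λ = ∂_s Fo`. -/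
structure IsOpenMul (c : Fin N → Fin N → Fin N → Poly N) (Fo : Laurent N) : Prop where
  mul_eq : ∀ α β, dt α (ds Fo) * dt β (ds Fo) =
    ∑ μ, LaurentPolynomial.C (c α β μ) * dt μ (ds Fo) + dt α (dt β Fo) * ds (ds Fo)
  indep : ∀ (a : Fin N → Poly N) (q : Laurent N),
    ∑ μ, LaurentPolynomial.C (a μ) * dt μ (ds Fo) = q * ds (ds Fo) → (∀ μ, a μ = 0) ∧ q = 0

namespace IsOpenMul

variable {c : Fin N → Fin N → Fin N → Poly N} {Fo : Laurent N}

lemma comm (h : IsOpenMul c Fo) (α β μ : Fin N) : c α β μ = c β α μ := by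
  have h1 := (h.indep (fun μ => c α β μ - c β α μ) 0 (by
    simp only [map_sub, sub_mul, Finset.sum_sub_distrib]
    have e1 := h.mul_eq α β
    have e2 := h.mul_eq β α
    rw [dt_comm β α] at e2
    linear_combination e2 - e1)).1 μ
  exact sub_eq_zero.1 h1

/-- Expand ∂_αλ ∂_βλ ∂_γλ starting from the first pair or from the last pair of factors. By
independence, the coefficients of the ∂_νλ agree, which is associativity, and so do the quotients by
∂_s λ, which is the first open WDVV equation. -/
lemma assoc_and_open (h : IsOpenMul c Fo) (α β γ : Fin N) :
    (∀ ν, ∑ μ, c α β μ * c μ γ ν = ∑ μ, c γ β μ * c μ α ν) ∧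
    ∑ μ, LaurentPolynomial.C (c α β μ) * dt μ (dt γ Fo) + dt α (dt β Fo) * dt γ (ds Fo) =
      ∑ μ, LaurentPolynomial.C (c γ β μ) * dt μ (dt α Fo) + dt γ (dt β Fo) * dt α (ds Fo) := by
  have key : ∀ α γ, dt α (ds Fo) * dt β (ds Fo) * dt γ (ds Fo) =
      ∑ ν, LaurentPolynomial.C (∑ μ, c α β μ * c μ γ ν) * dt ν (ds Fo) +
      (∑ μ, LaurentPolynomial.C (c α β μ) * dt μ (dt γ Fo) + dt α (dt β Fo) * dt γ (ds Fo)) *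
        ds (ds Fo) := by
    intro α γ
    have e : ∑ μ, LaurentPolynomial.C (c α β μ) * dt μ (ds Fo) * dt γ (ds Fo) =
        ∑ ν, LaurentPolynomial.C (∑ μ, c α β μ * c μ γ ν) * dt ν (ds Fo) +
        (∑ μ, LaurentPolynomial.C (c α β μ) * dt μ (dt γ Fo)) * ds (ds Fo) := by
      have e1 : ∀ μ, LaurentPolynomial.C (c α β μ) * dt μ (ds Fo) * dt γ (ds Fo) =
          ∑ ν, LaurentPolynomial.C (c α β μ * c μ γ ν) * dt ν (ds Fo) +
          LaurentPolynomial.C (c α β μ) * dt μ (dt γ Fo) * ds (ds Fo) := by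
        intro μ
        rw [mul_assoc, h.mul_eq, mul_add, Finset.mul_sum, mul_assoc]
        simp only [map_mul, mul_assoc]
      have e2 : ∀ ν, LaurentPolynomial.C (∑ μ, c α β μ * c μ γ ν) * dt ν (ds Fo) =
          ∑ μ, LaurentPolynomial.C (c α β μ * c μ γ ν) * dt ν (ds Fo) := by
        intro ν
        rw [map_sum, Finset.sum_mul]
      rw [Finset.sum_congr rfl fun μ _ => e1 μ, Finset.sum_congr rfl fun ν _ => e2 ν,
        Finset.sum_comm, Finset.sum_mul, Finset.sum_add_distrib, Finset.sum_comm]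
    rw [h.mul_eq α β, add_mul, Finset.sum_mul, e]
    ring
  have h1 := h.indep (fun ν => ∑ μ, c α β μ * c μ γ ν - ∑ μ, c γ β μ * c μ α ν)
    (-(∑ μ, LaurentPolynomial.C (c α β μ) * dt μ (dt γ Fo) + dt α (dt β Fo) * dt γ (ds Fo)) +
      (∑ μ, LaurentPolynomial.C (c γ β μ) * dt μ (dt α Fo) + dt γ (dt β Fo) * dt α (ds Fo))) (by
    have e1 := key α γ
    have e2 := key γ α
    rw [Finset.sum_congr rfl fun ν _ => by rw [map_sub, sub_mul], Finset.sum_sub_distrib]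
    linear_combination e2 - e1)
  exact ⟨fun ν => sub_eq_zero.1 (h1.1 ν), (neg_add_eq_zero.1 h1.2)⟩

/-- Differentiate the product formula for ∂_αλ ∂_βλ by t^γ and antisymmetrize in α and γ. The terms
without derivatives of c cancel by the s-derivative of the first open WDVV equation; independence
gives the rest. -/
lemma closed (h : IsOpenMul c Fo) (γ α β μ : Fin N) :
    pderiv γ (c α β μ) = pderiv α (c γ β μ) := by
  have key : ∀ α γ, ∑ μ, LaurentPolynomial.C (pderiv γ (c α β μ)) * dt μ (ds Fo) =
      dt γ (dt α (ds Fo)) * dt β (ds Fo) + dt α (ds Fo) * dt γ (dt β (ds Fo)) -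
      ∑ μ, LaurentPolynomial.C (c α β μ) * dt μ (dt γ (ds Fo)) -
      dt γ (dt α (dt β Fo)) * ds (ds Fo) - dt α (dt β Fo) * ds (dt γ (ds Fo)) := by
    intro α γ
    have e := congrArg (dt γ) (h.mul_eq α β)
    rw [dt_mul, dt_add, dt_sum, dt_mul, dt_ds γ (ds Fo)] at e
    have e2 : ∑ μ, dt γ (LaurentPolynomial.C (c α β μ) * dt μ (ds Fo)) =
        ∑ μ, LaurentPolynomial.C (c α β μ) * dt μ (dt γ (ds Fo)) +
        ∑ μ, LaurentPolynomial.C (pderiv γ (c α β μ)) * dt μ (ds Fo) := by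
      rw [← Finset.sum_add_distrib]
      refine Finset.sum_congr rfl fun μ _ => ?_
      rw [dt_mul, dt_C, dt_comm γ μ]
      ring
    rw [e2] at e
    linear_combination -e
  have hs := congrArg ds (h.assoc_and_open α β γ).2
  have e3 : ∀ α γ, ds (∑ μ, LaurentPolynomial.C (c α β μ) * dt μ (dt γ Fo)) =
      ∑ μ, LaurentPolynomial.C (c α β μ) * dt μ (dt γ (ds Fo)) := by
    intro α γ
    rw [ds_sum]
    refine Finset.sum_congr rfl fun μ _ => ?_
    rw [ds_mul, ds_C, mul_zero, add_zero, dt_ds γ, dt_ds]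
  rw [ds_add, ds_add, ds_mul, ds_mul, e3, e3, ← dt_ds, ← dt_ds, ← dt_ds, ← dt_ds] at hs
  have h1 := (h.indep (fun μ => pderiv γ (c α β μ) - pderiv α (c γ β μ)) 0 (by
    simp only [map_sub, sub_mul, Finset.sum_sub_distrib]
    rw [key, key, dt_comm γ α (ds Fo), dt_comm γ α (dt β Fo)]
    simp only [dt_ds] at hs ⊢
    linear_combination -hs)).1 μ
  exact sub_eq_zero.1 h1

end IsOpenMul

end Associativity

/-! ### Multiplication, metric and potential in flat coordinates. -/

section FlatMultiplication

variable {M : ℕ} {w : Fin M → Poly (M + 1)} {t : Fin (M + 1) → Poly (M + 1)}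
  {c : Fin (M + 1) → Fin (M + 1) → Fin (M + 1) → Poly (M + 1)}

/-- The structure constants of the multiplication in the coordinates `t`. -/
def flatConst {N : ℕ} (c : Fin N → Fin N → Fin N → Poly N) (t v : Fin N → Poly N)
    (α β γ : Fin N) : Poly N :=
  ∑ k, mixedConst c v α β k * aeval v (pderiv k (t γ))

lemma flatConst_mul_jacobian {N : ℕ} (c : Fin N → Fin N → Fin N → Poly N) {t v : Fin N → Poly N}
    (h : ∀ i, aeval v (t i) = X i) (α β k : Fin N) :
    ∑ γ, flatConst c t v α β γ * pderiv γ (v k) = mixedConst c v α β k := by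
  have e : ∀ γ, flatConst c t v α β γ * pderiv γ (v k) =
      ∑ l, mixedConst c v α β l * (pderiv γ (v k) * aeval v (pderiv l (t γ))) := by
    intro γ
    rw [flatConst, Finset.sum_mul]
    exact Finset.sum_congr rfl fun l _ => by ring
  rw [Finset.sum_congr rfl fun γ _ => e γ, Finset.sum_comm, Finset.sum_eq_single k]
  · rw [← Finset.mul_sum, jacobian_mul' h, if_pos rfl, mul_one]
  · intro l _ hl
    rw [← Finset.mul_sum, jacobian_mul' h, if_neg hl.symm, mul_zero]
  · simp

lemma sum_mul_dt_ds_openPot (v a : Fin (M + 1) → Poly (M + 1)) :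
    ∑ μ, LaurentPolynomial.C (a μ) * dt μ (ds (openPot v)) =
      ∑ l, LaurentPolynomial.C (∑ μ, a μ * pderiv μ (v l)) * phiCurve v l := by
  have e1 : ∀ μ, LaurentPolynomial.C (a μ) * dt μ (ds (openPot v)) =
      ∑ l, LaurentPolynomial.C (a μ * pderiv μ (v l)) * phiCurve v l := by
    intro μ
    rw [dt_ds_openPot_eq_sum, Finset.mul_sum]
    simp only [map_mul, mul_assoc]
  have e2 : ∀ l, LaurentPolynomial.C (∑ μ, a μ * pderiv μ (v l)) * phiCurve v l =
      ∑ μ, LaurentPolynomial.C (a μ * pderiv μ (v l)) * phiCurve v l := by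
    intro l
    rw [map_sum, Finset.sum_mul]
  rw [Finset.sum_congr rfl fun μ _ => e1 μ, Finset.sum_congr rfl fun l _ => e2 l, Finset.sum_comm]

/-- The product formula is `defect_eq_sum` in the basis ∂/∂t^μ. For independence, the window of
exponents forces q = 0; then the restricted φ_i are independent and the Jacobian matrix is
invertible. -/
lemma isOpenMul_flatConst (hM : M ≠ 0) (hw : IsFlatParam w) (hc : IsStructureConstants c)
    (h : ∀ i, aeval (flatParam w) (t i) = X i) :
    IsOpenMul (flatConst c t (flatParam w)) (openPot (flatParam w)) where
  mul_eq α β := by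
    rw [sum_mul_dt_ds_openPot,
      Finset.sum_congr rfl fun l _ => by rw [flatConst_mul_jacobian c h α β l],
      ← defect_eq_sum hM hw hc, defect]
    ring
  indep a q hq := by
    have hv : flatParam w (Fin.last M) ≠ 0 := by rw [flatParam_last]; exact X_ne_zero _
    rw [sum_mul_dt_ds_openPot] at hq
    obtain ⟨h1, h2⟩ := sum_mul_phiCurve_mem (flatParam w)
      (fun l => ∑ μ, a μ * pderiv μ (flatParam w l))
    have hq0 : q = 0 := eq_zero_of_mul_ds_ds_mem hM hv (hq ▸ h1) (hq ▸ h2 hM)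
    rw [hq0, zero_mul] at hq
    refine ⟨fun γ => ?_, hq0⟩
    have h3 := eq_zero_of_sum_mul_phiCurve _ hv hq
    have h4 : ∑ l, (∑ μ, a μ * pderiv μ (flatParam w l)) *
        aeval (flatParam w) (pderiv l (t γ)) = a γ := by
      have e : ∀ l, (∑ μ, a μ * pderiv μ (flatParam w l)) *
          aeval (flatParam w) (pderiv l (t γ)) =
          ∑ μ, a μ * (aeval (flatParam w) (pderiv l (t γ)) * pderiv μ (flatParam w l)) := by
        intro l
        rw [Finset.sum_mul]
        exact Finset.sum_congr rfl fun μ _ => by ring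
      rw [Finset.sum_congr rfl fun l _ => e l, Finset.sum_comm, Finset.sum_eq_single γ]
      · rw [← Finset.mul_sum, jacobian_mul h, if_pos rfl, mul_one]
      · intro μ _ hμ
        rw [← Finset.mul_sum, jacobian_mul h, if_neg hμ, mul_zero]
      · simp
    rw [← h4]
    exact Finset.sum_eq_zero fun l _ => by rw [h3 l, zero_mul]

lemma pderiv_flatParam_min (hM : M ≠ 0) (hw : IsFlatParam w) (γ : Fin (M + 1)) :
    pderiv γ (flatParam w (Fin.castSucc ⟨M - 1, by omega⟩)) =
      if γ = Fin.castSucc ⟨M - 1, by omega⟩ then 1 else 0 := by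
  rw [flatParam_castSucc]
  induction γ using Fin.lastCases with
  | last => rw [pderiv_last_flatParam hw, if_neg (Fin.castSucc_lt_last _).ne']
  | cast a =>
    split_ifs with h
    · rw [Fin.castSucc_injective M h, pderiv_flatParam_self hw hM]
    · refine pderiv_flatParam_of_lt hw hM (Fin.lt_def.2 ?_)
      have h1 : a.val ≠ M - 1 := fun h1 => h (by congr 1; exact Fin.ext h1)
      have := a.isLt
      simp only
      omega

/-- Triangularity gives dv_{N-1} = dt^{N-1}, so the component of a product that defines the metric
is the same in both bases. -/
lemma flatConst_min (hM : M ≠ 0) (hw : IsFlatParam w) (hc : IsStructureConstants c)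
    (h : ∀ i, aeval (flatParam w) (t i) = X i) (α β : Fin (M + 1)) :
    flatConst c t (flatParam w) α β (Fin.castSucc ⟨M - 1, by omega⟩) = C (flatMetric M α β) := by
  rw [← mixedConst_eq_flatMetric hM hw hc, ← flatConst_mul_jacobian c h, Finset.sum_eq_single
    (Fin.castSucc ⟨M - 1, by omega⟩)]
  · rw [pderiv_flatParam_min hM hw, if_pos rfl, mul_one]
  · intro γ _ hγ
    rw [pderiv_flatParam_min hM hw, if_neg hγ, mul_zero]
  · simp

/-- By `flatConst_min` the tensor is the t^{N-1}-component of a triple product, hence symmetric by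
commutativity and associativity; `IsOpenMul.closed` supplies the symmetry of its derivative. -/
lemma exists_flat_potential (hM : M ≠ 0) (hw : IsFlatParam w) (hc : IsStructureConstants c)
    (h : ∀ i, aeval (flatParam w) (t i) = X i) :
    ∃ F : Poly (M + 1), (∀ α β γ, pderiv α (pderiv β (pderiv γ F)) =
        ∑ μ, flatMetric M γ μ • flatConst c t (flatParam w) α β μ) ∧
      ∀ m ∈ F.support, 3 ≤ m.degree := by
  have hm := isOpenMul_flatConst hM hw hc h
  refine exists_potential _ (fun α β γ => ?_) (fun α β γ => ?_) (fun δ α β γ => ?_)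
  · exact Finset.sum_congr rfl fun μ _ => by rw [hm.comm]
  · have e : ∀ α β γ, ∑ μ, flatMetric M γ μ • flatConst c t (flatParam w) α β μ =
        ∑ μ, flatConst c t (flatParam w) α β μ *
          flatConst c t (flatParam w) μ γ (Fin.castSucc ⟨M - 1, by omega⟩) := by
      intro α β γ
      refine Finset.sum_congr rfl fun μ _ => ?_
      rw [flatConst_min hM hw hc h, flatMetric_comm, smul_eq_C_mul, mul_comm]
    rw [e, e, Finset.sum_congr rfl fun μ _ => by rw [hm.comm α β μ],
      (hm.assoc_and_open β α γ).1 _]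
    exact Finset.sum_congr rfl fun μ _ => by rw [hm.comm γ α μ]
  · simp only [map_sum, Derivation.map_smul]
    exact Finset.sum_congr rfl fun μ _ => by rw [hm.closed]

lemma flatMetric_castSucc (a : Fin M) (β : Fin (M + 1)) :
    flatMetric M a.castSucc β = if β = a.rev.castSucc then 1 else 0 := by
  have ha := a.isLt
  have hβ := β.isLt
  have h1 : (β = a.rev.castSucc) ↔ a.val + β.val + 1 = M := by
    rw [Fin.ext_iff]
    simp only [Fin.val_castSucc, Fin.val_rev]
    omega
  simp only [flatMetric, h1, Fin.val_castSucc]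
  rw [if_neg (by omega : ¬ a.val + β.val = 2 * M)]

lemma flatMetric_last (β : Fin (M + 1)) :
    flatMetric M (Fin.last M) β = if β = Fin.last M then -1 else 0 := by
  have hβ := β.isLt
  have h1 : (β = Fin.last M) ↔ M + β.val = 2 * M := by
    rw [Fin.ext_iff]
    simp only [Fin.val_last]
    omega
  simp only [flatMetric, h1, Fin.val_last]
  rw [if_neg (by omega : ¬ M + β.val + 1 = M)]

lemma flatMetric_mul_self :
    Matrix.of (flatMetric M) * Matrix.of (flatMetric M) = 1 := by
  ext α γ
  rw [Matrix.mul_apply, Matrix.one_apply]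
  simp only [Matrix.of_apply]
  induction α using Fin.lastCases with
  | last =>
    simp only [flatMetric_last, ite_mul, zero_mul, Finset.sum_ite_eq', Finset.mem_univ, if_true]
    simp [eq_comm]
  | cast a =>
    simp only [flatMetric_castSucc, ite_mul, zero_mul, one_mul, Finset.sum_ite_eq',
      Finset.mem_univ, if_true, Fin.rev_rev]
    simp only [eq_comm]

lemma flatMetric_det_ne_zero : (Matrix.of (flatMetric M)).det ≠ 0 := fun h => by
  have h1 := congrArg Matrix.det (flatMetric_mul_self (M := M))
  rw [Matrix.det_mul, h, zero_mul, Matrix.det_one] at h1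
  exact zero_ne_one h1

end FlatMultiplication

/-! ### Rigidity of normalized flat coordinates. -/

section Uniqueness

variable {N : ℕ}

/-- The coordinates `t` agree with the given ones up to terms of second order. -/
def IsNormalized (t : Fin N → Poly N) : Prop :=
  (∀ i, constantCoeff (t i) = 0) ∧
    ∀ i k, constantCoeff (pderiv k (t i)) = if i = k then 1 else 0

lemma constantCoeff_aeval {t : Fin N → Poly N} (ht : ∀ i, constantCoeff (t i) = 0) (p : Poly N) :
    constantCoeff (aeval t p) = constantCoeff p := by
  induction p using MvPolynomial.induction_on with
  | C a => rw [aeval_C, algebraMap_eq]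
  | add p q hp hq => rw [map_add, map_add, hp, hq, map_add]
  | mul_X p i hp => rw [map_mul, map_mul, aeval_X, ht, map_mul, constantCoeff_X, mul_zero, mul_zero]

lemma constantCoeff_pderiv_aeval {s t : Fin N → Poly N} (ht : IsNormalized t) (i k : Fin N) :
    constantCoeff (pderiv k (aeval t (s i))) = constantCoeff (pderiv k (s i)) := by
  rw [pderiv_aeval, map_sum, Finset.sum_eq_single k]
  · rw [map_mul, constantCoeff_aeval ht.1, ht.2, if_pos rfl, mul_one]
  · intro j _ hj; rw [map_mul, ht.2, if_neg hj, mul_zero]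
  · simp

lemma IsNormalized.inverse {t v : Fin N → Poly N} (ht : IsNormalized t)
    (h : ∀ i, aeval t (v i) = X i) : IsNormalized v := by
  refine ⟨fun i => ?_, fun i k => ?_⟩
  · rw [← constantCoeff_aeval ht.1, h, constantCoeff_X]
  · rw [← constantCoeff_pderiv_aeval ht, h]
    split_ifs with hik
    · rw [hik, pderiv_X_self, map_one]
    · rw [pderiv_X_of_ne hik, map_zero]

lemma IsNormalized.comp {s t : Fin N → Poly N} (hs : IsNormalized s) (ht : IsNormalized t) :
    IsNormalized fun i => aeval t (s i) :=
  ⟨fun i => by rw [constantCoeff_aeval ht.1, hs.1],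
    fun i k => by rw [constantCoeff_pderiv_aeval ht, hs.2]⟩

lemma constantCoeff_pderiv (i : Fin N) (p : Poly N) :
    constantCoeff (pderiv i p) = coeff (Finsupp.single i 1) p := by
  rw [constantCoeff_eq, coeff_pderiv, zero_add, Finsupp.zero_apply, Nat.cast_zero, zero_add,
    mul_one]

/-- The pullback of the metric `g` under the coordinate change `v`. -/
def pullback (g : Fin N → Fin N → Poly N) (v : Fin N → Poly N) (α β : Fin N) : Poly N :=
  ∑ i, ∑ j, pderiv α (v i) * pderiv β (v j) * aeval v (g i j)

lemma aeval_aeval (s t : Fin N → Poly N) (p : Poly N) :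
    aeval t (aeval s p) = aeval (fun i => aeval t (s i)) p := by
  have h : (aeval t : Poly N →ₐ[ℂ] Poly N).comp (aeval s) = aeval (fun i => aeval t (s i)) :=
    algHom_ext fun i => by rw [AlgHom.comp_apply, aeval_X, aeval_X]
  exact DFunLike.congr_fun h p

lemma pullback_comp (g : Fin N → Fin N → Poly N) (v ψ : Fin N → Poly N) (α β : Fin N) :
    pullback g (fun i => aeval ψ (v i)) α β = pullback (pullback g v) ψ α β := by
  have e : ∀ i j, pderiv α (aeval ψ (v i)) * pderiv β (aeval ψ (v j)) *
      aeval (fun i => aeval ψ (v i)) (g i j) =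
      ∑ a, ∑ b, pderiv α (ψ a) * pderiv β (ψ b) * aeval ψ (pderiv a (v i) * pderiv b (v j) *
        aeval v (g i j)) := by
    intro i j
    rw [pderiv_aeval, pderiv_aeval, ← aeval_aeval, Finset.sum_mul_sum, Finset.sum_mul]
    refine Finset.sum_congr rfl fun a _ => ?_
    rw [Finset.sum_mul]
    refine Finset.sum_congr rfl fun b _ => ?_
    rw [map_mul, map_mul]
    ring
  simp only [pullback, e, map_sum, Finset.mul_sum]
  rw [Finset.sum_congr rfl fun i _ => Finset.sum_comm, Finset.sum_comm]
  refine Finset.sum_congr rfl fun a _ => ?_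
  rw [Finset.sum_congr rfl fun i _ => Finset.sum_comm, Finset.sum_comm]

/-- A normalized isometry between constant metrics is the identity. -/
lemma eq_X_of_isometry {η η' : Matrix (Fin N) (Fin N) ℂ} (hsymm : ∀ a b, η a b = η b a)
    (hη : η * η = 1) {ψ χ : Fin N → Poly N} (hinv : ∀ i, aeval ψ (χ i) = X i)
    (hψ : IsNormalized ψ)
    (h : ∀ α β, pullback (fun a b => C (η a b)) ψ α β = C (η' α β)) (a : Fin N) : ψ a = X a := by
  -- This is ⟨∂_γ∂_αψ, ∂_βψ⟩, as in the Levi-Civita argument. It is symmetric in γ, α, and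
  -- antisymmetric in α, β because the pulled-back metric is constant; hence it vanishes.
  let S : Fin N → Fin N → Fin N → Poly N := fun γ α β =>
    ∑ a, ∑ b, pderiv γ (pderiv α (ψ a)) * pderiv β (ψ b) * C (η a b)
  have hS1 : ∀ γ α β, S γ α β = S α γ β := fun γ α β => by simp only [S, pderiv_comm γ α]
  have hS2 : ∀ γ α β, S γ α β + S γ β α = 0 := by
    intro γ α β
    have h1 := congrArg (pderiv γ) (h α β)
    rw [pderiv_C, pullback] at h1
    have h2 : S γ β α = ∑ a, ∑ b, pderiv α (ψ a) * pderiv γ (pderiv β (ψ b)) * C (η a b) := by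
      simp only [S]
      rw [Finset.sum_comm]
      refine Finset.sum_congr rfl fun a _ => Finset.sum_congr rfl fun b _ => ?_
      rw [hsymm b a]
      ring
    rw [h2, ← h1]
    simp only [S, map_sum, ← Finset.sum_add_distrib]
    refine Finset.sum_congr rfl fun a _ => Finset.sum_congr rfl fun b _ => ?_
    rw [aeval_C, algebraMap_eq, pderiv_mul, pderiv_mul, pderiv_C]
    ring
  have hS0 : ∀ γ α β, S γ α β = 0 := by
    intro γ α β
    have h3 : (2 : Poly N) * S γ α β = 0 := by
      linear_combination hS2 γ α β - hS2 β γ α + hS2 α β γ + hS1 β γ α - hS1 α β γ + hS1 γ α β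
    exact (mul_eq_zero.1 h3).resolve_left two_ne_zero
  have hu : ∀ γ α b, ∑ a, pderiv γ (pderiv α (ψ a)) * C (η a b) = 0 := by
    intro γ α b
    -- The inverse Jacobian removes the factor ∂_βψ; afterwards η² = 1 removes η. So all second
    -- derivatives of ψ vanish and the normalization fixes the affine part.
    have h4 : ∑ β, S γ α β * aeval ψ (pderiv b (χ β)) =
        ∑ a, pderiv γ (pderiv α (ψ a)) * C (η a b) := by
      have e : ∀ β, S γ α β * aeval ψ (pderiv b (χ β)) = ∑ a, ∑ l,
          pderiv γ (pderiv α (ψ a)) * C (η a l) *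
            (pderiv β (ψ l) * aeval ψ (pderiv b (χ β))) := by
        intro β
        simp only [S, Finset.sum_mul]
        exact Finset.sum_congr rfl fun a _ => Finset.sum_congr rfl fun l _ => by ring
      rw [Finset.sum_congr rfl fun β _ => e β, Finset.sum_comm]
      refine Finset.sum_congr rfl fun a _ => ?_
      rw [Finset.sum_comm, Finset.sum_eq_single b]
      · rw [← Finset.mul_sum, jacobian_mul' hinv, if_pos rfl, mul_one]
      · intro l _ hl
        rw [← Finset.mul_sum, jacobian_mul' hinv, if_neg hl, mul_zero]
      · simp
    rw [← h4]
    exact Finset.sum_eq_zero fun β _ => by rw [hS0, zero_mul]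
  have h0 : ∀ γ α a, pderiv γ (pderiv α (ψ a)) = 0 := by
    intro γ α d
    have h5 : ∑ b, (∑ a, pderiv γ (pderiv α (ψ a)) * C (η a b)) * C (η b d) =
        pderiv γ (pderiv α (ψ d)) := by
      have e : ∀ b, (∑ a, pderiv γ (pderiv α (ψ a)) * C (η a b)) * C (η b d) =
          ∑ a, pderiv γ (pderiv α (ψ a)) * C (η a b * η b d) := by
        intro b
        rw [Finset.sum_mul]
        exact Finset.sum_congr rfl fun a _ => by rw [C_mul, mul_assoc]
      rw [Finset.sum_congr rfl fun b _ => e b, Finset.sum_comm, Finset.sum_eq_single d]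
      · rw [← Finset.mul_sum, ← map_sum, ← Matrix.mul_apply, hη, Matrix.one_apply_eq, C_1, mul_one]
      · intro a _ ha
        rw [← Finset.mul_sum, ← map_sum, ← Matrix.mul_apply, hη, Matrix.one_apply_ne ha, C_0,
          mul_zero]
      · simp
    rw [← h5]
    exact Finset.sum_eq_zero fun b _ => by rw [hu, zero_mul]
  rw [← sub_eq_zero]
  refine eq_zero_of_pderiv_eq_zero (fun γ => ?_) ?_
  · refine eq_zero_of_pderiv_eq_zero (fun δ => ?_) ?_
    · rw [map_sub, map_sub, h0, zero_sub, neg_eq_zero]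
      by_cases hag : a = γ
      · rw [hag, pderiv_X_self, pderiv_one]
      · rw [pderiv_X_of_ne hag, map_zero]
    · rw [map_sub, map_sub, hψ.2]
      split_ifs with hag
      · rw [hag, pderiv_X_self, map_one, sub_self]
      · rw [pderiv_X_of_ne hag, map_zero, sub_self]
  · rw [map_sub, hψ.1, constantCoeff_X, sub_self]

variable {M : ℕ} {w : Fin M → Poly (M + 1)}

/-- For k < N, a constant term in v_k is excluded since q_k ≠ 0, and a linear term t^a with a ≠ k, a
< N, since q_a ≠ q_k. The variable t^N does not occur in these v_k. -/
lemma isNormalized_flatParam (hM : M ≠ 0) (hw : IsFlatParam w) : IsNormalized (flatParam w) := by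
  have hM' : (M : ℂ) ≠ 0 := by exact_mod_cast hM
  have hcc : ∀ i : Fin (M + 1), constantCoeff (euler (flatParam w i)) = 0 := by
    intro i
    rw [euler_apply, map_sum]
    refine Finset.sum_eq_zero fun α _ => ?_
    rw [smul_eq_C_mul, map_mul, map_mul, constantCoeff_X, zero_mul, mul_zero]
  constructor
  · intro i
    induction i using Fin.lastCases with
    | last => rw [flatParam_last, constantCoeff_X]
    | cast k =>
      have h1 := hcc k.castSucc
      rw [euler_flatParam' hw hM, smul_eq_C_mul, map_mul, constantCoeff_C, weight_castSucc] at h1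
      refine (mul_eq_zero.1 h1).resolve_left (div_ne_zero ?_ hM')
      rw [sub_ne_zero]
      exact_mod_cast k.isLt.ne'
  · intro i l
    induction i using Fin.lastCases with
    | last =>
      rw [flatParam_last]
      split_ifs with h
      · rw [← h, pderiv_X_self, map_one]
      · rw [pderiv_X_of_ne h, map_zero]
    | cast k =>
      induction l using Fin.lastCases with
      | last =>
        rw [flatParam_castSucc, pderiv_last_flatParam hw, map_zero,
          if_neg (Fin.castSucc_lt_last k).ne]
      | cast a =>
        by_cases hka : k = a
        · rw [hka, if_pos rfl, flatParam_castSucc, pderiv_flatParam_self hw hM, map_one]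
        · rw [if_neg fun h => hka (Fin.castSucc_injective M h)]
          have h1 : constantCoeff (pderiv a.castSucc (euler (flatParam w k.castSucc))) =
              weight (M + 1) a.castSucc *
                constantCoeff (pderiv a.castSucc (flatParam w k.castSucc)) := by
            rw [euler_apply, map_sum, map_sum, Finset.sum_eq_single a.castSucc]
            · rw [Derivation.map_smul, pderiv_mul, pderiv_X_self, smul_eq_C_mul, map_mul,
                constantCoeff_C, map_add, map_mul, map_mul, constantCoeff_X, map_one, one_mul,
                zero_mul, add_zero]
            · intro j _ hj
              rw [Derivation.map_smul, pderiv_mul, pderiv_X_of_ne hj, smul_eq_C_mul, map_mul,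
                map_add, map_mul, map_mul, constantCoeff_X, map_zero, zero_mul, zero_mul, add_zero,
                mul_zero]
            · simp
          rw [euler_flatParam' hw hM, Derivation.map_smul, smul_eq_C_mul, map_mul,
            constantCoeff_C, weight_castSucc, weight_castSucc, ← sub_eq_zero, ← sub_mul] at h1
          refine (mul_eq_zero.1 h1).resolve_left ?_
          rw [← sub_div, sub_sub_sub_cancel_left]
          refine div_ne_zero (sub_ne_zero.2 ?_) hM'
          exact fun h => hka (Fin.ext (by exact_mod_cast h.symm))

end Uniqueness

/-! ### Existence of the data and the asserted properties. -/

section Main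

variable {M : ℕ}

lemma idxMin_eq (hN : 4 ≤ M + 1) :
    idxMin hN = Fin.castSucc ⟨M - 1, by omega⟩ := Fin.ext (by simp [idxMin])

lemma idxLast_eq (hN : 4 ≤ M + 1) : idxLast hN = Fin.last M := Fin.ext (by simp [idxLast])

namespace FlatData

lemma cT_eq {N : ℕ} (D : FlatData N) (α β γ : Fin N) :
    D.cT α β γ = flatConst D.c D.t D.v α β γ := by
  simp only [cT, flatConst, mixedConst, Finset.sum_mul]
  rw [Finset.sum_congr rfl fun i _ => Finset.sum_comm, Finset.sum_comm]

lemma Fo_eq (hN : 4 ≤ M + 1) (D : FlatData (M + 1)) : D.Fo hN = openPot D.v := by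
  have hM : (M : ℂ) ≠ 0 := by exact_mod_cast (by omega : M ≠ 0)
  have hM1 : (2 * M + 1 : ℂ) ≠ 0 := by exact_mod_cast (by omega : 2 * M + 1 ≠ 0)
  have h : (1 / (2 ^ (M + 1 - 2) * (2 * ((M + 1 : ℕ) : ℂ) - 1) * (2 * ((M + 1 : ℕ) : ℂ) - 2))) =
      leadCoeff M / (2 * M + 1) := by
    obtain ⟨m, rfl⟩ : ∃ m, M = m + 1 := ⟨M - 1, by omega⟩
    rw [leadCoeff, show m + 1 + 1 - 2 = m by omega, div_div]
    congr 1
    push_cast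
    ring
  rw [Fo, h, Fin.sum_univ_castSucc, if_neg (by simp), add_zero, openPot, openPoly, oddPoly,
    map_add, map_sum, idxLast_eq, Polynomial.toLaurent_C_mul_X_pow]
  refine congrArg₂ (· + ·) (congrArg₂ (· + ·) (Finset.sum_congr rfl fun k _ => ?_) ?_) rfl
  · rw [if_pos (by simp), Polynomial.toLaurent_C_mul_X_pow]
    push_cast
    rfl
  · rw [show 2 * ((M + 1 : ℕ) : ℤ) - 1 = (2 * M + 1 : ℕ) by push_cast; ring]

end FlatData

lemma exists_isSaito (hN : 4 ≤ M + 1) : ∃ D : FlatData (M + 1), D.IsSaito hN := by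
  have hM : M ≠ 0 := by omega
  obtain ⟨w, hw⟩ := exists_isFlatParam M
  obtain ⟨t, h1, h2⟩ := exists_inverse (flatParam w) (flatParam_sub_X_mem hw hM)
  obtain ⟨c, hc⟩ := exists_structureConstants hM
  obtain ⟨F, hF, hF3⟩ := exists_flat_potential hM hw hc h1
  have ht : IsNormalized t := (isNormalized_flatParam hM hw).inverse h1
  refine ⟨⟨c, Matrix.of (flatMetric M), t, flatParam w, F⟩, hc, h1, h2, ht.1, fun α i => ?_,
    fun α β => ?_, flatMetric_det_ne_zero, fun α β γ => ?_, hF3⟩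
  · rw [← constantCoeff_pderiv, ht.2]
  · change _ = C (flatMetric M α β)
    rw [← mixedConst_eq_flatMetric hM hw hc, ← idxMin_eq hN]
    rfl
  · simp only [FlatData.cT_eq]
    exact hF α β γ

namespace FlatData.IsSaito

variable {hN : 4 ≤ M + 1} {D : FlatData (M + 1)} {w : Fin M → Poly (M + 1)}

lemma isNormalized_t (h : D.IsSaito hN) : IsNormalized D.t :=
  ⟨h.t_const, fun i k => by rw [constantCoeff_pderiv, h.t_linear]⟩

/-- The transition map between the two coordinate systems pulls one constant matrix of the same
metric back to the other and is normalized, so it is the identity by `eq_X_of_isometry`. -/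
lemma v_eq_flatParam (h : D.IsSaito hN) (hw : IsFlatParam w) : D.v = flatParam w := by
  have hM : M ≠ 0 := by omega
  obtain ⟨t, h1, h2⟩ := exists_inverse (flatParam w) (flatParam_sub_X_mem hw hM)
  have ht : IsNormalized t := (isNormalized_flatParam hM hw).inverse h1
  have hv : IsNormalized D.v := h.isNormalized_t.inverse h.v_comp_t
  have hcomp : ∀ i, aeval (fun a => aeval D.v (t a)) (flatParam w i) = D.v i := fun i => by
    rw [← aeval_aeval, h2, aeval_X]
  have hψ : ∀ a, aeval D.v (t a) = X a := by
    refine eq_X_of_isometry (η := Matrix.of (flatMetric M)) (η' := D.eta)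
      (χ := fun β => aeval (flatParam w) (D.t β)) flatMetric_comm flatMetric_mul_self
      (fun i => ?_) (ht.comp hv) fun α β => ?_
    · rw [aeval_aeval]
      simp only [hcomp]
      exact h.t_comp_v i
    · rw [← h.flat]
      have e : (fun a b => C (Matrix.of (flatMetric M) a b)) =
          pullback (D.metricV hN) (flatParam w) := by
        funext a b
        rw [Matrix.of_apply, ← mixedConst_eq_flatMetric hM hw h.mul_phi, ← idxMin_eq hN]
        rfl
      rw [e, ← pullback_comp]
      simp only [hcomp]
      rfl
  funext i
  rw [← hcomp i]
  simp only [hψ]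
  exact aeval_X_left_apply _

lemma eta_eq (h : D.IsSaito hN) : D.eta = Matrix.of (flatMetric M) := by
  have hM : M ≠ 0 := by omega
  obtain ⟨w, hw⟩ := exists_isFlatParam M
  ext α β
  refine C_injective (Fin (M + 1)) ℂ ?_
  rw [← h.flat, Matrix.of_apply, ← mixedConst_eq_flatMetric hM hw h.mul_phi, ← idxMin_eq hN,
    ← h.v_eq_flatParam hw]
  rfl

lemma isOpenMul (h : D.IsSaito hN) : IsOpenMul D.cT (D.Fo hN) := by
  obtain ⟨w, hw⟩ := exists_isFlatParam M
  have hv := h.v_eq_flatParam hw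
  have e : D.cT = flatConst D.c D.t (flatParam w) := by
    funext α β γ
    rw [cT_eq, hv]
  rw [e, Fo_eq, hv]
  exact isOpenMul_flatConst (by omega) hw h.mul_phi fun i => by rw [← hv, h.t_comp_v]

/-- Raising the last index of the third derivatives of F recovers the structure constants; here η is
its own inverse. -/
lemma sum_inv_smul_thirdDeriv (h : D.IsSaito hN) (α β : Fin (M + 1))
    (f : Fin (M + 1) → Laurent (M + 1)) :
    ∑ μ, ∑ ν, D.eta⁻¹ μ ν • (thirdDeriv D.F α β μ * f ν) =
      ∑ ν, LaurentPolynomial.C (D.cT α β ν) * f ν := by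
  rw [Finset.sum_comm]
  refine Finset.sum_congr rfl fun ν _ => ?_
  have hinv : D.eta⁻¹ = D.eta := by
    rw [h.eta_eq]
    exact Matrix.inv_eq_right_inv flatMetric_mul_self
  have hsq : ∀ ρ, ∑ μ, D.eta μ ν * D.eta μ ρ = if ρ = ν then 1 else 0 := by
    intro ρ
    have h1 := congrFun₂ (flatMetric_mul_self (M := M)) ρ ν
    rw [Matrix.mul_apply, Matrix.one_apply] at h1
    rw [← h1, h.eta_eq]
    refine Finset.sum_congr rfl fun μ _ => ?_
    rw [mul_comm, Matrix.of_apply, Matrix.of_apply, flatMetric_comm μ ρ]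
    rfl
  have h2 : ∑ μ, D.eta μ ν • pderiv α (pderiv β (pderiv μ D.F)) = D.cT α β ν := by
    simp only [h.potential, Finset.smul_sum, smul_smul]
    rw [Finset.sum_comm]
    simp only [← Finset.sum_smul, hsq, ite_smul, one_smul, zero_smul, Finset.sum_ite_eq',
      Finset.mem_univ, if_true]
  rw [← h2, map_sum, Finset.sum_mul, hinv]
  simp only [C_smul, smul_mul_assoc, thirdDeriv]

lemma openWDVV (h : D.IsSaito hN) : OpenWDVV D.eta D.F (D.Fo hN) where
  eq_one α β γ := by
    rw [h.sum_inv_smul_thirdDeriv, h.sum_inv_smul_thirdDeriv, ← dt_ds, ← dt_ds]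
    exact (h.isOpenMul.assoc_and_open α β γ).2
  eq_two α β := by
    rw [h.sum_inv_smul_thirdDeriv, ← dt_ds, ← dt_ds, mul_comm (dt β _)]
    exact (h.isOpenMul.mul_eq α β).symm

/-- By triangularity t^1 enters v_1 alone, with derivative 1, and the coefficient of v_1 in F^o is
s. -/
lemma dt_idxOne_Fo (h : D.IsSaito hN) : dt (idxOne hN) (D.Fo hN) = LaurentPolynomial.T 1 := by
  have hM : M ≠ 0 := by omega
  obtain ⟨w, hw⟩ := exists_isFlatParam M
  let o : Fin M := ⟨0, by omega⟩
  have ho : idxOne hN = o.castSucc := rfl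
  rw [ho, Fo_eq, h.v_eq_flatParam hw, dt_castSucc_openPot, oddPoly, Finset.sum_eq_single o]
  · rw [pderiv_flatParam_self hw hM, Polynomial.toLaurent_C_mul_X_pow]
    simp [o]
  · intro k _ hk
    rw [pderiv_flatParam_of_lt hw hM, smul_zero, map_zero, zero_mul]
    exact Fin.lt_def.2 (Nat.pos_of_ne_zero fun h0 => hk (Fin.ext h0))
  · simp

lemma unitCondition (h : D.IsSaito hN) : UnitCondition hN (D.Fo hN) where
  dt_dt α := by rw [dt_comm, h.dt_idxOne_Fo, dt_T]
  dt_ds := by rw [SaitoDN.dt_ds, h.dt_idxOne_Fo, ds_T]; simp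

lemma quasiHomogeneous (h : D.IsSaito hN) : QuasiHomogeneous hN (D.Fo hN) := by
  have hM : M ≠ 0 := by omega
  have hM' : (M : ℂ) ≠ 0 := by exact_mod_cast hM
  obtain ⟨w, hw⟩ := exists_isFlatParam M
  have hδ : confDim hN = 1 - 1 / (M : ℂ) := by
    rw [confDim, idxMin_eq hN, weight_castSucc]
    have : ((M - 1 : ℕ) : ℂ) = M - 1 := by
      rw [Nat.cast_sub (by omega), Nat.cast_one]
    simp only [this]
    ring
  have h1 : (1 - confDim hN) / 2 = 1 / (2 * (M : ℂ)) := by rw [hδ]; field_simp; ring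
  have h3 : (3 - confDim hN) / 2 = (2 * M + 1) / (2 * (M : ℂ)) := by rw [hδ]; field_simp; ring
  -- Every term of F^o is separately homogeneous; its weight is that of the coefficient plus n/(2M),
  -- and the total is always (2M+1)/(2M) = (3-δ)/2.
  have key : ∀ (a : Poly (M + 1)) (q : ℂ) (n : ℤ), euler a = q • a →
      q + n / (2 * M) = (2 * M + 1) / (2 * (M : ℂ)) →
      laurentEuler (LaurentPolynomial.C a * LaurentPolynomial.T n) =
        ((2 * M + 1) / (2 * (M : ℂ))) • (LaurentPolynomial.C a * LaurentPolynomial.T n) := by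
    intro a q n ha hq
    rw [laurentEuler_C_mul_T, ha, ← add_smul, hq, C_smul, smul_mul_assoc]
  rw [QuasiHomogeneous, h1, h3]
  change laurentEuler _ = _
  rw [Fo_eq, h.v_eq_flatParam hw, openPot, openPoly, oddPoly, map_add, map_sum, laurentEuler_add,
    laurentEuler_add, laurentEuler_sum, smul_add, smul_add, Finset.smul_sum]
  refine congrArg₂ (· + ·) (congrArg₂ (· + ·) (Finset.sum_congr rfl fun k _ => ?_) ?_) ?_
  · rw [Polynomial.toLaurent_C_mul_X_pow]
    refine key _ (weight (M + 1) k.castSucc) _ ?_ ?_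
    · rw [Derivation.map_smul, euler_flatParam', smul_comm]
      exacts [hw, hM]
    · rw [weight_castSucc]
      push_cast
      field_simp
      ring
  · rw [Polynomial.toLaurent_C_mul_X_pow]
    refine key _ 0 _ ?_ ?_
    · rw [zero_smul, ← algebraMap_eq, Derivation.map_algebraMap]
    · push_cast
      ring
  · refine key _ (2 * weight (M + 1) (Fin.last M)) _ ?_ ?_
    · rw [Derivation.map_smul, Derivation.leibniz_pow, euler_flatParam' hw hM]
      simp only [nsmul_eq_mul, smul_eq_mul, smul_eq_C_mul, map_mul, map_ofNat]
      ring
    · rw [weight_last]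
      push_cast
      field_simp
      ring

lemma coeff_Fo_odd (D : FlatData (M + 1)) (hN : 4 ≤ M + 1) (k : Fin M) :
    (D.Fo hN).coeff (2 * (k.val : ℤ) + 1) =
      (1 / (2 ^ k.val * (2 * k.val + 1)) : ℂ) • D.v k.castSucc := by
  have hk := k.isLt
  rw [Fo_eq, openPot, AddMonoidAlgebra.coeff_add, Finsupp.add_apply, coeff_C_mul_T,
    if_neg (by omega), add_zero,
    show 2 * (k.val : ℤ) + 1 = (2 * k.val + 1 : ℕ) by push_cast; rfl,
    coeff_toLaurent_natCast, openPoly, Polynomial.coeff_add, coeff_oddPoly,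
    Polynomial.coeff_C_mul_X_pow, if_neg (by omega), add_zero]

lemma coeff_Fo_neg_one (D : FlatData (M + 1)) (hN : 4 ≤ M + 1) :
    (D.Fo hN).coeff (-1) = (1 / 2 : ℂ) • D.v (Fin.last M) ^ 2 := by
  rw [Fo_eq, openPot, AddMonoidAlgebra.coeff_add, Finsupp.add_apply, coeff_C_mul_T, if_pos rfl,
    toLaurent_mem_degGE (d := 0) (fun n hn => absurd hn (by omega)) (-1) (by norm_num), zero_add]

lemma v_last (h : D.IsSaito hN) : D.v (Fin.last M) = X (Fin.last M) := by
  obtain ⟨w, hw⟩ := exists_isFlatParam M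
  rw [h.v_eq_flatParam hw, flatParam_last]

lemma v_eq_smul_coeff (k : Fin (M + 1)) (hk : k.val + 1 < M + 1) :
    D.v k = ((2 : ℂ) ^ k.val * (2 * (k.val : ℂ) + 1)) •
      (D.Fo hN).coeff (2 * (k.val : ℤ) + 1) := by
  have h0 : (2 : ℂ) ^ k.val * (2 * (k.val : ℂ) + 1) ≠ 0 := by
    exact_mod_cast (by positivity : 2 ^ k.val * (2 * k.val + 1) ≠ 0)
  have e : k = Fin.castSucc ⟨k.val, by omega⟩ := rfl
  have h1 := coeff_Fo_odd D hN ⟨k.val, by omega⟩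
  simp only at h1
  rw [h1, smul_smul, mul_one_div_cancel h0, one_smul]
  rfl

lemma eq_v_last_iff (h : D.IsSaito hN) (r : Poly (M + 1)) :
    r = D.v (Fin.last M) ↔ r ^ 2 = (2 : ℂ) • (D.Fo hN).coeff (-1) ∧
      MvPolynomial.coeff (Finsupp.single (Fin.last M) 1) r = 1 := by
  have hc : MvPolynomial.coeff (Finsupp.single (Fin.last M) 1)
      (X (Fin.last M) : Poly (M + 1)) = 1 := by rw [coeff_X, if_pos rfl]
  rw [coeff_Fo_neg_one, h.v_last, smul_smul, mul_one_div_cancel two_ne_zero, one_smul]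
  refine ⟨fun hr => ⟨by rw [hr], by rw [hr, hc]⟩, fun ⟨hr, hr1⟩ => ?_⟩
  -- In a domain the square root is determined up to sign, and the coefficient of t^N selects the
  -- sign.
  rcases sq_eq_sq_iff_eq_or_eq_neg.1 hr with hr | hr
  · exact hr
  · rw [hr, coeff_neg, hc] at hr1
    norm_num at hr1

end FlatData.IsSaito

end Main

end

end SaitoDN

theorem mainTheorem3 (N : ℕ) (hN : 4 ≤ N) :
    (∃ D : SaitoDN.FlatData N, D.IsSaito hN) ∧
    ∀ D : SaitoDN.FlatData N, D.IsSaito hN →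
      SaitoDN.OpenWDVV D.eta D.F (D.Fo hN) ∧
      SaitoDN.UnitCondition hN (D.Fo hN) ∧
      SaitoDN.QuasiHomogeneous hN (D.Fo hN) ∧
      (∀ k : Fin N, k.val + 1 < N →
        D.v k = ((2 : ℂ) ^ k.val * (2 * (k.val : ℂ) + 1)) •
          (D.Fo hN).coeff (2 * (k.val : ℤ) + 1)) ∧
      (∀ r : SaitoDN.Poly N, r = D.v (SaitoDN.idxLast hN) ↔
        r ^ 2 = (2 : ℂ) • (D.Fo hN).coeff (-1) ∧
          MvPolynomial.coeff (Finsupp.single (SaitoDN.idxLast hN) 1) r = 1) := by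
  obtain ⟨M, rfl⟩ : ∃ M, N = M + 1 := ⟨N - 1, by omega⟩
  refine ⟨SaitoDN.exists_isSaito hN, fun D h => ⟨h.openWDVV, h.unitCondition, h.quasiHomogeneous,
    SaitoDN.FlatData.IsSaito.v_eq_smul_coeff, ?_⟩⟩
  rw [SaitoDN.idxLast_eq]
  exact h.eq_v_last_iff
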